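/- Let $d\in\mathbb N$ and $\varepsilon>0$ with $d\ge e^{\varepsilon}+1$. An $\varepsilon$-LDP mechanism is a column-stochastic matrix $P\in\mathbb R^{m\times d}$ ($m$ finite and arbitrary) with $P_{o,x}\le e^{\varepsilon}P_{o,x'}$ for all $o\in[m]$, $x,x'\in[d]$, where $P_{o,x}$ is the probability of response $o$ on input $x$. Each of $n\ge 1$ users, holding $X^{(i)}\in[d]$, independently sends a response $O^{(i)}\sim P_{\cdot,X^{(i)}}$; an estimator consists of $P$ and a function mapping $(O^{(1)},\dots,O^{(n)})$ to a vector in $\mathbb R^d$. Let $f(x)=\frac1n|\{i: X^{(i)}=x\}|$. A frequency estimator $\hat f$ is unbiased if $\mathbb E[\hat f]=f$ for every dataset, and its losses are $$\mathcal L_1(\hat f,n)=\max_{X\in[d]^n}\mathbb E\sum_{x}|\hat f(x)-f(x)|,\qquad \mathcal L_2(\hat f,n)=\max_{X\in[d]^n}\mathbb E\sum_{x}(\hat f(x)-f(x))^2 .$$ If instead the $X^{(i)}$ are i.i.d. from a distribution $\theta$ on $[d]$, a distribution estimator $\hat\theta$ is unbiased if $\mathbb E_\theta[\hat\theta]=\theta$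 for every $\theta$, and $\mathcal L_2(\hat\theta,n)=\max_\theta\mathbb E_\theta\sum_x(\hat\theta(x)-\theta(x))^2$. An estimator has an optimal symmetric configuration (OSC) with support size $k$ if there are $b_o>0$ and sets $S_o\subseteq[d]$ with $|S_o|=k$ such that $P_{o,x}=e^{\varepsilon}b_o$ for $x\in S_o$ and $P_{o,x}=b_o$ otherwise; $\sum_{o:\,x\in S_o}P_{o,x}=p^*$ for all $x$ and $\sum_{o:\,x\in S_o}P_{o,x'}=q^*$ for all $x\ne x'$, with constants $p^*,q^*$; and its $x$-th output is $\big(\frac1n|\{i:x\in S_{O^{(i)}}\}|-q^*\big)/(p^*-q^*)$. Put $$\mathcal L_2^*(n)=\frac{(d-1)\,[\,4de^{\varepsilon}-(e^{\varepsilon}+1)^2\,]}{n\,d\,(e^{\varepsilon}-1)^2}.$$ 1. For every $n\ge1$, every unbiased $\varepsilon$-LDP frequency estimator has $\mathcal L_2(\hat f,n)\ge\mathcal L_2^*(n)$, and every unbiased $\varepsilon$-LDP distribution estimator has $\mathcal L_2(\hat\theta,n)\ge\mathcal L_2^*(n)+\frac{1-1/d}{n}$. Suppose moreover that $k=d/(e^{\varepsilon}+1)$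 is an integer. Then: 2. For every $n\ge1$, $\min_{\hat f}\mathcal L_2(\hat f,n)=\mathcal L_2^*(n)$ and $\min_{\hat\theta}\mathcal L_2(\hat\theta,n)=\mathcal L_2^*(n)+\frac{1-1/d}{n}$, the minima being over unbiased $\varepsilon$-LDP estimators. Estimators with an OSC of support size $k$ exist, and each of them is unbiased for both problems and attains both minima. 3. As $n\to\infty$, $$\inf_{\hat f}\mathcal L_1(\hat f,n)\;\sim\;\sqrt{\tfrac{2d}{\pi}\,\mathcal L_2^*(n)}=\frac{\sqrt{2(d-1)[4de^{\varepsilon}-(e^{\varepsilon}+1)^2]}}{\sqrt{\pi n}\,(e^{\varepsilon}-1)},$$ the infimum being over unbiased $\varepsilon$-LDP frequency estimators, and $\mathcal L_1(\hat f_n,n)$ has the same asymptotics for every sequence $(\hat f_n)$ of estimators for $n$ users that have an OSC of support size $k$. Here $a_n\sim b_n$ means $a_n/b_n\to1$. -/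

import Mathlib

namespace LDP

/-- An `ε`-locally differentially private mechanism with inputs `Fin d` and responses `Fin m`.
`P o x` is the probability of the response `o` on the input `x` (the perturbation matrix). -/
structure Mechanism (d m : ℕ) (ε : ℝ) where
  P : Matrix (Fin m) (Fin d) ℝ
  nonneg : ∀ o x, 0 ≤ P o x
  sum_eq_one : ∀ x, ∑ o, P o x = 1
  ldp : ∀ o x x', P o x ≤ Real.exp ε * P o x'

/-- An `ε`-LDP estimator for `n` users and dictionary `Fin d`: every user applies the same
mechanism to his own value, independently of the others, and the server applies `recon` to the
list of the `n` responses. Functions of the response frequencies are a special case. -/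
structure Estimator (d n : ℕ) (ε : ℝ) where
  m : ℕ
  mech : Mechanism d m ε
  recon : (Fin n → Fin m) → Fin d → ℝ

/-- The frequency of the value `x` in the dataset `X`. -/
noncomputable def freq {d n : ℕ} (X : Fin n → Fin d) (x : Fin d) : ℝ :=
  ((Finset.univ.filter (fun i => X i = x)).card : ℝ) / n

namespace Estimator

variable {d n : ℕ} {ε : ℝ}

/-- The expectation of `g` (a function of the responses) for the fixed dataset `X`. -/
noncomputable def expect (A : Estimator d n ε) (X : Fin n → Fin d)
    (g : (Fin n → Fin A.m) → ℝ) : ℝ :=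
  ∑ r, (∏ i, A.mech.P (r i) (X i)) * g r

/-- The expectation of `g` when the `n` values are drawn i.i.d. from the distribution `θ`
on `Fin d` and then perturbed. -/
noncomputable def expectIID (A : Estimator d n ε) (θ : Fin d → ℝ)
    (g : (Fin n → Fin A.m) → ℝ) : ℝ :=
  ∑ X : Fin n → Fin d, (∏ i, θ (X i)) * A.expect X g

/-- Unbiased as a frequency estimator. -/
def UnbiasedFreq (A : Estimator d n ε) : Prop :=
  ∀ (X : Fin n → Fin d) (x : Fin d), A.expect X (fun r => A.recon r x) = freq X x

/-- Unbiased as a distribution estimator. -/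
def UnbiasedDist (A : Estimator d n ε) : Prop :=
  ∀ θ ∈ stdSimplex ℝ (Fin d), ∀ x : Fin d, A.expectIID θ (fun r => A.recon r x) = θ x

/-- Worst-case `L₁` loss for frequency estimation (a maximum over finitely many datasets). -/
noncomputable def freqL1 (A : Estimator d n ε) : ℝ :=
  ⨆ X : Fin n → Fin d, A.expect X (fun r => ∑ x, |A.recon r x - freq X x|)

/-- Worst-case `L₂` loss for frequency estimation (a maximum over finitely many datasets). -/
noncomputable def freqL2 (A : Estimator d n ε) : ℝ :=
  ⨆ X : Fin n → Fin d, A.expect X (fun r => ∑ x, (A.recon r x - freq X x) ^ 2)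

/-- Worst-case `L₂` loss for distribution estimation (the supremum of a function that is
continuous on the compact simplex). -/
noncomputable def distL2 (A : Estimator d n ε) : ℝ :=
  ⨆ θ : stdSimplex ℝ (Fin d), A.expectIID θ.1 (fun r => ∑ x, (A.recon r x - θ.1 x) ^ 2)

/-- Optimal symmetric configuration with support size `k`. The mechanism is extremal, with base
probabilities `b o` and support sets `S o`; all support sets have `k` elements; the self-support
probability `p` and the cross-support probability `q` do not depend on the values; and the server
uses the standard estimator for symmetric configurations. -/
def IsOSC (A : Estimator d n ε) (k : ℕ) : Prop :=
  ∃ (b : Fin A.m → ℝ) (S : Fin A.m → Finset (Fin d)) (p q : ℝ),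
    (∀ o, 0 < b o) ∧
    (∀ o x, A.mech.P o x = if x ∈ S o then Real.exp ε * b o else b o) ∧
    (∀ o, (S o).card = k) ∧
    (∀ x, ∑ o ∈ Finset.univ.filter (fun o => x ∈ S o), A.mech.P o x = p) ∧
    (∀ x x', x ≠ x' → ∑ o ∈ Finset.univ.filter (fun o => x ∈ S o), A.mech.P o x' = q) ∧
    (∀ r x, A.recon r x =
      (((Finset.univ.filter (fun i => x ∈ S (r i))).card : ℝ) / n - q) / (p - q))

end Estimator

/-- Worst-case `L₁` losses of all unbiased `ε`-LDP frequency estimators. -/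
def freqL1Losses (d n : ℕ) (ε : ℝ) : Set ℝ :=
  {L | ∃ A : Estimator d n ε, A.UnbiasedFreq ∧ A.freqL1 = L}

/-- Worst-case `L₂` losses of all unbiased `ε`-LDP frequency estimators. -/
def freqL2Losses (d n : ℕ) (ε : ℝ) : Set ℝ :=
  {L | ∃ A : Estimator d n ε, A.UnbiasedFreq ∧ A.freqL2 = L}

/-- Worst-case `L₂` losses of all unbiased `ε`-LDP distribution estimators. -/
def distL2Losses (d n : ℕ) (ε : ℝ) : Set ℝ :=
  {L | ∃ A : Estimator d n ε, A.UnbiasedDist ∧ A.distL2 = L}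

/-- The closed form `(d - 1) [4 d e^ε - (e^ε + 1)²] / (n d (e^ε - 1)²)`. -/
noncomputable def optL2 (d n : ℕ) (ε : ℝ) : ℝ :=
  ((d : ℝ) - 1) * (4 * d * Real.exp ε - (Real.exp ε + 1) ^ 2) /
    (n * d * (Real.exp ε - 1) ^ 2)

end LDP

/-! The `L₂` lower bounds are a Cramér–Rao inequality at the uniform distribution. The score of a
response `o` in the direction of the value `x` is `d * P o x / rowSum o - 1`; its variance is `d *
info x`, and unbiasedness fixes its covariance with the estimate (`UnbiasedDist.prodExp_mul_score`).
Privacy confines each row of `P` to an interval `[b, e^ε b]`, which bounds the sum of squares of the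
row in terms of its sum (`sum_sq_le`) and hence gives `∑ x, info x ≤ (e^ε - 1)² / (4 e^ε)`
(`sum_info_le`). Using one multiplier for all values, the sum of the Cramér–Rao bounds needs only
this total. For frequency estimators the risk at the uniform distribution is the mean risk over
datasets plus the sampling variance `(1 - 1/d)/n` (`UnbiasedFreq.expectIID_sq`), so the same bound
applies.

For an optimal symmetric configuration, double counting forces `p = 1/2` and `q = (k - 1/2)/(d -
1)`. Its error is a sum of independent centred terms whose total variance does not depend on the
dataset and equals the lower bound (`IsOSC.expect_sq`). Taking all images of a `k`-set under
permutations shows existence.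

For the `L₁` loss, Lindeberg's exchange argument compares mean absolute deviations with the Gaussian
value `√(2/π) σ`. Together with Cauchy–Schwarz over the values this gives the upper bound.

The `L₁` lower bound holds for biased estimators too and is Bayesian. Users are split into blocks of
fixed size `B`; in each block the values are i.i.d. from a random distribution close to uniform, the
softmax of a small Gaussian vector. A van Trees argument, with Stein's identity for the prior,
bounds from below the mean square error of any estimator of the counts in one block
(`exists_prior`). Given the responses, the blocks are independent, so the total count is nearly
Gaussian around its posterior mean, and no predictor beats `√(2/π)` times its standard deviation
(`exists_predictor_le`). Finally, the standard deviation per value is bounded below by a tangent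
line in the information (`tangent_le`), so again only the sum of the informations matters. All
estimates are uniform over mechanisms. -/

namespace LDP

open Finset

/-! ### Expectations under product weights. -/

section ProductExpectation

variable {ι α : Type*} [Fintype ι] [DecidableEq ι] [Fintype α]

/-- The expectation of `f` under the product of the (possibly signed) weights `w i`. -/
def prodExp (w : ι → α → ℝ) (f : (ι → α) → ℝ) : ℝ :=
  ∑ a, (∏ i, w i (a i)) * f a

/-- Distributivity of the product over the sum. Moments of one or two coordinates follow by taking
factors equal to `1` elsewhere. -/
theorem prodExp_prod (w k : ι → α → ℝ) :
    prodExp w (fun a => ∏ i, k i (a i)) = ∏ i, ∑ o, w i o * k i o := by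
  classical
  simp only [prodExp, ← Finset.prod_mul_distrib]
  rw [Finset.prod_univ_sum]
  simp [Fintype.piFinset_univ]

theorem prodExp_add (w : ι → α → ℝ) (f g : (ι → α) → ℝ) :
    prodExp w (fun a => f a + g a) = prodExp w f + prodExp w g := by
  simp [prodExp, mul_add, Finset.sum_add_distrib]

theorem prodExp_sub (w : ι → α → ℝ) (f g : (ι → α) → ℝ) :
    prodExp w (fun a => f a - g a) = prodExp w f - prodExp w g := by
  simp [prodExp, mul_sub, Finset.sum_sub_distrib]

theorem prodExp_const_mul (w : ι → α → ℝ) (c : ℝ) (f : (ι → α) → ℝ) :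
    prodExp w (fun a => c * f a) = c * prodExp w f := by
  simp only [prodExp, Finset.mul_sum]
  exact Finset.sum_congr rfl fun a _ => by ring

theorem prodExp_sum {β : Type*} (s : Finset β) (w : ι → α → ℝ) (f : β → (ι → α) → ℝ) :
    prodExp w (fun a => ∑ b ∈ s, f b a) = ∑ b ∈ s, prodExp w (f b) := by
  simp only [prodExp, Finset.mul_sum]
  exact Finset.sum_comm

theorem prodExp_mono {w : ι → α → ℝ} (hw : ∀ i o, 0 ≤ w i o) {f g : (ι → α) → ℝ}
    (h : ∀ a, f a ≤ g a) : prodExp w f ≤ prodExp w g :=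
  Finset.sum_le_sum fun a _ =>
    mul_le_mul_of_nonneg_left (h a) (Finset.prod_nonneg fun i _ => hw i _)

theorem prodExp_nonneg {w : ι → α → ℝ} (hw : ∀ i o, 0 ≤ w i o) {f : (ι → α) → ℝ}
    (h : ∀ a, 0 ≤ f a) : 0 ≤ prodExp w f :=
  Finset.sum_nonneg fun a _ => mul_nonneg (Finset.prod_nonneg fun i _ => hw i _) (h a)

theorem prodExp_const {w : ι → α → ℝ} (hw : ∀ i, ∑ o, w i o = 1) (c : ℝ) :
    prodExp w (fun _ => c) = c := by
  have h := prodExp_prod w (fun _ _ => 1)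
  simp only [Finset.prod_const_one, mul_one, hw] at h
  have := prodExp_const_mul w c (fun _ => 1)
  simpa [h] using this

theorem prodExp_eval {w : ι → α → ℝ} (hw : ∀ i, ∑ o, w i o = 1) (i : ι) (h : α → ℝ) :
    prodExp w (fun a => h (a i)) = ∑ o, w i o * h o := by
  have := prodExp_prod w (fun j o => if j = i then h o else 1)
  rw [Finset.prod_eq_single i (by
      intro j _ hj
      simp [hj, hw]) (by simp)] at this
  simpa using this

theorem prodExp_eval_mul {w : ι → α → ℝ} (hw : ∀ i, ∑ o, w i o = 1) {i j : ι} (hij : i ≠ j)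
    (h k : α → ℝ) :
    prodExp w (fun a => h (a i) * k (a j)) = (∑ o, w i o * h o) * ∑ o, w j o * k o := by
  have := prodExp_prod w (fun l o => (if l = i then h o else 1) * (if l = j then k o else 1))
  simp only [Finset.prod_mul_distrib, Finset.prod_ite_eq', Finset.mem_univ, if_true] at this
  rw [this, ← Finset.mul_prod_erase univ _ (Finset.mem_univ i),
    ← Finset.mul_prod_erase (univ.erase i) _ (Finset.mem_erase.2 ⟨hij.symm, Finset.mem_univ j⟩)]
  rw [Finset.prod_eq_one (s := (univ.erase i).erase j)]
  · simp [hij, hij.symm]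
  · intro l hl
    simp only [Finset.mem_erase, Finset.mem_univ, and_true] at hl
    simp [hl.1, hl.2, hw]

/-- The second moment of two sums of independent centred variables. -/
theorem prodExp_sum_mul_sum {w : ι → α → ℝ} (hw : ∀ i, ∑ o, w i o = 1) (h k : ι → α → ℝ)
    (hh : ∀ i, ∑ o, w i o * h i o = 0) :
    prodExp w (fun a => (∑ i, h i (a i)) * ∑ i, k i (a i)) =
      ∑ i, ∑ o, w i o * (h i o * k i o) := by
  simp only [Finset.sum_mul_sum]
  rw [prodExp_sum]
  refine Finset.sum_congr rfl fun i _ => ?_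
  rw [prodExp_sum, Finset.sum_eq_single i]
  · exact prodExp_eval hw i (fun o => h i o * k i o)
  · intro j _ hj
    rw [prodExp_eval_mul hw hj.symm, hh, zero_mul]
  · simp

theorem prodExp_sum_eval {w : ι → α → ℝ} (hw : ∀ i, ∑ o, w i o = 1) (h : ι → α → ℝ) :
    prodExp w (fun a => ∑ i, h i (a i)) = ∑ i, ∑ o, w i o * h i o := by
  rw [prodExp_sum]
  exact Finset.sum_congr rfl fun i _ => prodExp_eval hw i (h i)

theorem prodExp_sum_sq {w : ι → α → ℝ} (hw : ∀ i, ∑ o, w i o = 1) (h : ι → α → ℝ)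
    (hh : ∀ i, ∑ o, w i o * h i o = 0) :
    prodExp w (fun a => (∑ i, h i (a i)) ^ 2) = ∑ i, ∑ o, w i o * (h i o) ^ 2 := by
  simp only [pow_two]
  exact prodExp_sum_mul_sum hw h h hh

end ProductExpectation

/-- Averaging over the inputs first turns the mixture of products into a product. -/
theorem sum_prod_mul_prodExp {ι α β : Type*} [Fintype ι] [DecidableEq ι] [Fintype α] [Fintype β]
    (θ : ι → β → ℝ) (P : α → β → ℝ) (g : (ι → α) → ℝ) :
    prodExp θ (fun X => prodExp (fun i o => P o (X i)) g) =
      prodExp (fun i o => ∑ x, θ i x * P o x) g := by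
  simp only [prodExp, Finset.mul_sum]
  rw [Finset.sum_comm]
  refine Finset.sum_congr rfl fun r _ => ?_
  have := prodExp_prod θ (fun i x => P (r i) x)
  rw [← this, prodExp, Finset.sum_mul]
  exact Finset.sum_congr rfl fun X _ => by ring

/-- The product expectation for a nonempty list of users, one user at a time. -/
theorem prodExp_fin_succ {α : Type*} [Fintype α] {J : ℕ} (w : Fin (J + 1) → α → ℝ)
    (f : (Fin (J + 1) → α) → ℝ) :
    prodExp w f = ∑ o, w 0 o * prodExp (fun j => w j.succ) (fun a => f (Fin.cons o a)) := by
  simp only [prodExp, Finset.mul_sum]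
  rw [← (Fin.consEquiv fun _ : Fin (J + 1) => α).sum_comp, Fintype.sum_prod_type]
  refine Finset.sum_congr rfl fun o _ => Finset.sum_congr rfl fun a _ => ?_
  simp [Fin.consEquiv, Fin.prod_univ_succ, mul_assoc]

/-! ### Gaussian approximation of mean absolute deviations by Lindeberg's exchange argument. -/

section Lindeberg

open MeasureTheory ProbabilityTheory
open scoped NNReal

/-- Taylor's formula of order two, with a remainder controlled by the third derivative. -/
theorem abs_taylor_two_le {f f₁ f₂ f₃ : ℝ → ℝ} {K : ℝ}
    (h₁ : ∀ x, HasDerivAt f (f₁ x) x) (h₂ : ∀ x, HasDerivAt f₁ (f₂ x) x)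
    (h₃ : ∀ x, HasDerivAt f₂ (f₃ x) x) (hK : ∀ x, |f₃ x| ≤ K) (u h : ℝ) :
    |f (u + h) - f u - f₁ u * h - f₂ u * h ^ 2 / 2| ≤ K * |h| ^ 3 := by
  have hK0 : 0 ≤ K := (abs_nonneg _).trans (hK 0)
  have e₂ : ∀ t, |f₂ (u + t) - f₂ u| ≤ K * |t| := fun t => by
    have := Convex.norm_image_sub_le_of_norm_hasDerivWithin_le (s := Set.univ) (x := u)
      (y := u + t) (fun x _ => (h₃ x).hasDerivWithinAt) (fun x _ => hK x) convex_univ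
      (Set.mem_univ _) (Set.mem_univ _)
    simpa using this
  -- Each use of this mean value inequality raises the power of `|h|` by one; the factor `1/6` of
  -- the sharp remainder is given up.
  have key : ∀ {g g' : ℝ → ℝ} {C : ℝ} (h : ℝ), 0 ≤ C → g 0 = 0 → (∀ t, HasDerivAt g (g' t) t) →
      (∀ t, |t| ≤ |h| → |g' t| ≤ C) → |g h| ≤ C * |h| := by
    intro g g' C h _ g0 hg hC
    have := Convex.norm_image_sub_le_of_norm_hasDerivWithin_le (s := Set.Icc (-|h|) |h|) (x := 0)
      (y := h) (fun x _ => (hg x).hasDerivWithinAt) (fun x hx => hC x (abs_le.2 hx))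
      (convex_Icc _ _) (by simp) (abs_le.1 le_rfl)
    simpa [g0] using this
  have hadd : ∀ {g g' : ℝ → ℝ}, (∀ x, HasDerivAt g (g' x) x) →
      ∀ t, HasDerivAt (fun t => g (u + t)) (g' (u + t)) t := fun hg t =>
    (hg (u + t)).comp_const_add u t
  have e₁ : ∀ t, |f₁ (u + t) - f₁ u - f₂ u * t| ≤ K * |t| * |t| := fun t => by
    refine key (g := fun t => f₁ (u + t) - f₁ u - f₂ u * t)
      (g' := fun t => f₂ (u + t) - f₂ u) t (by positivity) (by simp) (fun s => ?_)
      fun s hs => (e₂ s).trans (by gcongr)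
    exact (((hadd h₂ s).sub_const (f₁ u)).sub ((hasDerivAt_id s).const_mul (f₂ u))).congr_deriv
      (by simp)
  have e₀ := key (g := fun t => f (u + t) - f u - f₁ u * t - f₂ u * t ^ 2 / 2)
      (g' := fun t => f₁ (u + t) - f₁ u - f₂ u * t) (C := K * |h| * |h|) h (by positivity) (by simp)
      (fun s => ?_) fun s hs => (e₁ s).trans (by gcongr)
  · refine e₀.trans (le_of_eq (by ring))
  · have := (((hadd h₁ s).sub_const (f u)).sub ((hasDerivAt_id s).const_mul (f₁ u))).sub
      ((((hasDerivAt_id s).pow 2).const_mul (f₂ u)).div_const 2)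
    refine this.congr_deriv ?_
    simp
    ring

theorem integrable_abs_pow_gaussianReal (v : ℝ≥0) (k : ℕ) :
    Integrable (fun z : ℝ => |z| ^ k) (gaussianReal 0 v) := by
  have := (memLp_id_gaussianReal (μ := 0) (v := v) k).integrable_norm_pow'
  simpa using this

theorem integrable_id_gaussianReal (v : ℝ≥0) : Integrable (fun z : ℝ => z) (gaussianReal 0 v) := by
  have := (memLp_id_gaussianReal (μ := 0) (v := v) 1).integrable le_rfl
  exact this

theorem integrable_sq_gaussianReal (v : ℝ≥0) :
    Integrable (fun z : ℝ => z ^ 2) (gaussianReal 0 v) := by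
  simpa using integrable_abs_pow_gaussianReal v 2

theorem integral_sq_gaussianReal (v : ℝ≥0) : ∫ z, z ^ 2 ∂gaussianReal 0 v = v := by
  have h := variance_fun_id_gaussianReal (μ := 0) (v := v)
  rw [variance_eq_integral (by fun_prop)] at h
  simpa using h

theorem gaussianReal_eq_map_sqrt_mul (v : ℝ≥0) :
    gaussianReal 0 v = (gaussianReal 0 1).map (fun z => √(v : ℝ) * z) := by
  rw [gaussianReal_map_const_mul]
  congr 1
  · simp
  · ext
    simp

theorem integral_gaussianReal_eq (v : ℝ≥0) {f : ℝ → ℝ} (hf : Continuous f) :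
    ∫ z, f z ∂gaussianReal 0 v = ∫ z, f (√(v : ℝ) * z) ∂gaussianReal 0 1 := by
  rw [gaussianReal_eq_map_sqrt_mul, integral_map (by fun_prop) hf.aestronglyMeasurable]

/-- The third absolute moment of the standard normal distribution. -/
noncomputable def gaussThird : ℝ := ∫ z, |z| ^ 3 ∂gaussianReal 0 1

theorem gaussThird_nonneg : 0 ≤ gaussThird := integral_nonneg fun _ => by positivity

theorem integral_abs_cube_gaussianReal (v : ℝ≥0) :
    ∫ z, |z| ^ 3 ∂gaussianReal 0 v = √(v : ℝ) ^ 3 * gaussThird := by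
  rw [integral_gaussianReal_eq v (by fun_prop), gaussThird, ← integral_const_mul]
  congr 1 with z
  rw [abs_mul, mul_pow, abs_of_nonneg (Real.sqrt_nonneg _)]

theorem integral_abs_gaussianReal_one : ∫ z, |z| ∂gaussianReal 0 1 = √(2 / Real.pi) := by
  rw [integral_gaussianReal_eq_integral_smul one_ne_zero]
  have h := integral_comp_abs (f := fun z : ℝ => (√(2 * Real.pi))⁻¹ * (Real.exp (-z ^ 2 / 2) * z))
  have e : ∀ z : ℝ, gaussianPDFReal 0 1 z • |z| =
      (√(2 * Real.pi))⁻¹ * (Real.exp (-|z| ^ 2 / 2) * |z|) := fun z => by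
    simp [gaussianPDFReal, mul_assoc]
  simp_rw [e]
  rw [h, integral_const_mul]
  have h2 := integral_rpow_mul_exp_neg_mul_rpow (p := 2) (q := 1) (b := 1 / 2) (by norm_num)
    (by norm_num) (by norm_num)
  have h3 : ∫ x in Set.Ioi (0 : ℝ), Real.exp (-x ^ 2 / 2) * x = 1 := by
    have e2 : (fun x : ℝ => Real.exp (-x ^ 2 / 2) * x) =
        fun x : ℝ => x ^ (1 : ℝ) * Real.exp (-(1 / 2) * x ^ (2 : ℝ)) := by
      ext x
      have : x ^ (2 : ℝ) = x ^ 2 := by exact_mod_cast Real.rpow_natCast x 2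
      rw [this, Real.rpow_one, mul_comm]
      congr 2
      ring
    rw [e2, h2]
    norm_num [Real.rpow_neg_one]
  rw [h3, mul_one, Real.sqrt_mul (by norm_num), Real.sqrt_div (by norm_num)]
  have : √(2 : ℝ) * √2 = 2 := Real.mul_self_sqrt (by norm_num)
  field_simp
  nlinarith

variable {α : Type*} [Fintype α]

/-- Replacing one centred bounded variable by a Gaussian variable of the same variance. -/
theorem abs_sum_sub_integral_gaussianReal_le {f f₁ f₂ f₃ : ℝ → ℝ} {K b : ℝ}
    (h₁ : ∀ x, HasDerivAt f (f₁ x) x) (h₂ : ∀ x, HasDerivAt f₁ (f₂ x) x)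
    (h₃ : ∀ x, HasDerivAt f₂ (f₃ x) x) (hK : ∀ x, |f₃ x| ≤ K)
    (hf : ∀ u v, Integrable (fun z => f (u + z)) (gaussianReal 0 v))
    {w ξ : α → ℝ} (hw : ∀ o, 0 ≤ w o) (hw1 : ∑ o, w o = 1) (hξ : ∑ o, w o * ξ o = 0)
    (hb : ∀ o, |ξ o| ≤ b) {v : ℝ≥0} (hv : (v : ℝ) = ∑ o, w o * ξ o ^ 2) (hb0 : 0 ≤ b) (u : ℝ) :
    |∑ o, w o * f (u + ξ o) - ∫ z, f (u + z) ∂gaussianReal 0 v| ≤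
      K * b ^ 3 * (1 + gaussThird) := by
  have hK0 : 0 ≤ K := (abs_nonneg _).trans (hK 0)
  have T := abs_taylor_two_le h₁ h₂ h₃ hK u
  -- The Gaussian has standard deviation at most `b`, so `b ^ 3` controls both third moments.
  have hvb : √(v : ℝ) ≤ b := by
    rw [Real.sqrt_le_left hb0, hv]
    calc ∑ o, w o * ξ o ^ 2 ≤ ∑ o, w o * b ^ 2 := Finset.sum_le_sum fun o _ =>
          mul_le_mul_of_nonneg_left (sq_le_sq.2 ((hb o).trans (le_abs_self b))) (hw o)
      _ = b ^ 2 := by rw [← Finset.sum_mul, hw1, one_mul]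
  -- The first two moments of `ξ` and of the Gaussian agree, so both Taylor expansions have the same
  -- main term.
  have A : |∑ o, w o * f (u + ξ o) - (f u + f₂ u * v / 2)| ≤ K * b ^ 3 := by
    have : ∑ o, w o * f (u + ξ o) - (f u + f₂ u * v / 2) =
        ∑ o, w o * (f (u + ξ o) - f u - f₁ u * ξ o - f₂ u * ξ o ^ 2 / 2) := by
      have e : ∀ o, w o * (f (u + ξ o) - f u - f₁ u * ξ o - f₂ u * ξ o ^ 2 / 2) =
          w o * f (u + ξ o) - w o * f u - f₁ u * (w o * ξ o) - f₂ u / 2 * (w o * ξ o ^ 2) :=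
        fun o => by ring
      simp only [e, Finset.sum_sub_distrib, ← Finset.mul_sum, ← Finset.sum_mul, hξ, hw1, ← hv]
      ring
    rw [this]
    refine (Finset.abs_sum_le_sum_abs _ _).trans ?_
    calc ∑ o, |w o * (f (u + ξ o) - f u - f₁ u * ξ o - f₂ u * ξ o ^ 2 / 2)|
        ≤ ∑ o, w o * (K * b ^ 3) := Finset.sum_le_sum fun o _ => by
          rw [abs_mul, abs_of_nonneg (hw o)]
          refine mul_le_mul_of_nonneg_left ((T _).trans ?_) (hw o)
          have := hb o
          gcongr
      _ = K * b ^ 3 := by rw [← Finset.sum_mul, hw1, one_mul]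
  have B : |∫ z, f (u + z) ∂gaussianReal 0 v - (f u + f₂ u * v / 2)| ≤
      K * b ^ 3 * gaussThird := by
    have i1 := integrable_id_gaussianReal v
    have i2 := integrable_sq_gaussianReal v
    have : ∫ z, f (u + z) ∂gaussianReal 0 v - (f u + f₂ u * v / 2) =
        ∫ z, (f (u + z) - f u - f₁ u * z - f₂ u * z ^ 2 / 2) ∂gaussianReal 0 v := by
      rw [integral_sub, integral_sub, integral_sub (hf u v) (integrable_const _),
        integral_const_mul, integral_div, integral_const_mul, integral_sq_gaussianReal,
        integral_id_gaussianReal]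
      · simp
        ring
      · exact (hf u v).sub (integrable_const _)
      · exact i1.const_mul _
      · exact ((hf u v).sub (integrable_const _)).sub (i1.const_mul _)
      · exact (i2.const_mul _).div_const _
    rw [this, ← Real.norm_eq_abs]
    refine (norm_integral_le_integral_norm _).trans ?_
    calc ∫ z, ‖f (u + z) - f u - f₁ u * z - f₂ u * z ^ 2 / 2‖ ∂gaussianReal 0 v
        ≤ ∫ z, K * |z| ^ 3 ∂gaussianReal 0 v := by
          refine integral_mono_of_nonneg (.of_forall fun _ => norm_nonneg _)
            ((integrable_abs_pow_gaussianReal v 3).const_mul K) (.of_forall fun z => T z)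
      _ = K * (√(v : ℝ) ^ 3 * gaussThird) := by
          rw [integral_const_mul, integral_abs_cube_gaussianReal]
      _ ≤ K * (b ^ 3 * gaussThird) := by
          have := gaussThird_nonneg
          gcongr
      _ = K * b ^ 3 * gaussThird := by ring
  rw [abs_le] at A B ⊢
  constructor <;> linarith [A.1, A.2, B.1, B.2]

/-- Lindeberg's exchange argument: a sum of independent centred bounded variables against the
Gaussian variable of the same variance, for a test function with bounded third derivative. -/
theorem abs_prodExp_sub_integral_gaussianReal_le {f f₁ f₂ f₃ : ℝ → ℝ} {K b : ℝ}
    (h₁ : ∀ x, HasDerivAt f (f₁ x) x) (h₂ : ∀ x, HasDerivAt f₁ (f₂ x) x)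
    (h₃ : ∀ x, HasDerivAt f₂ (f₃ x) x) (hK : ∀ x, |f₃ x| ≤ K)
    (hf : ∀ u v, Integrable (fun z => f (u + z)) (gaussianReal 0 v)) (hb0 : 0 ≤ b) :
    ∀ (J : ℕ) (w ξ : Fin J → α → ℝ), (∀ j o, 0 ≤ w j o) → (∀ j, ∑ o, w j o = 1) →
      (∀ j, ∑ o, w j o * ξ j o = 0) → (∀ j o, |ξ j o| ≤ b) →
      ∀ v : Fin J → ℝ≥0, (∀ j, (v j : ℝ) = ∑ o, w j o * ξ j o ^ 2) → ∀ u : ℝ,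
      |prodExp w (fun r => f (u + ∑ j, ξ j (r j))) -
        ∫ z, f (u + z) ∂gaussianReal 0 (∑ j, v j)| ≤ J * (K * b ^ 3 * (1 + gaussThird)) := by
  intro J
  induction J with
  | zero =>
    intro w ξ _ _ _ _ v _ u
    simp [prodExp]
  | succ J ih =>
    intro w ξ hw hw1 hξ hb v hv u
    set C := K * b ^ 3 * (1 + gaussThird) with hC
    rw [prodExp_fin_succ]
    simp only [Fin.sum_univ_succ, Fin.cons_zero, Fin.cons_succ]
    set v' := ∑ j : Fin J, v j.succ with hv'
    have IH : ∀ o, |prodExp (fun j : Fin J => w j.succ)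
          (fun r => f (u + (ξ 0 o + ∑ j : Fin J, ξ j.succ (r j)))) -
        ∫ z, f (u + ξ 0 o + z) ∂gaussianReal 0 v'| ≤ J * C := fun o => by
      simp only [← add_assoc]
      exact ih (fun j => w j.succ) (fun j => ξ j.succ) (fun j => hw _) (fun j => hw1 _)
        (fun j => hξ _) (fun j => hb _) (fun j => v j.succ) (fun j => hv _) (u + ξ 0 o)
    have S1 : |∑ o, w 0 o * prodExp (fun j : Fin J => w j.succ)
          (fun r => f (u + (ξ 0 o + ∑ j : Fin J, ξ j.succ (r j)))) -
        ∑ o, w 0 o * ∫ z, f (u + ξ 0 o + z) ∂gaussianReal 0 v'| ≤ J * C := by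
      rw [← Finset.sum_sub_distrib]
      refine (Finset.abs_sum_le_sum_abs _ _).trans ?_
      calc _ ≤ ∑ o, w 0 o * (J * C) := Finset.sum_le_sum fun o _ => by
            rw [← mul_sub, abs_mul, abs_of_nonneg (hw 0 o)]
            exact mul_le_mul_of_nonneg_left (IH o) (hw 0 o)
        _ = J * C := by rw [← Finset.sum_mul, hw1, one_mul]
    -- In this order the inner integral of the convolution is over the Gaussian replacing variable
    -- `0`, with shift `u + z`, as the one-variable exchange requires.
    have hconv : gaussianReal 0 (v 0 + v') = gaussianReal 0 v' ∗ gaussianReal 0 (v 0) := by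
      rw [gaussianReal_conv_gaussianReal, add_comm, add_zero]
    have hint : Integrable (fun z => f (u + z)) (gaussianReal 0 v' ∗ gaussianReal 0 (v 0)) := by
      rw [← hconv]
      exact hf _ _
    have hprod : Integrable (fun p : ℝ × ℝ => f (u + (p.1 + p.2)))
        ((gaussianReal 0 v').prod (gaussianReal 0 (v 0))) := by
      rw [Measure.conv] at hint
      exact (integrable_map_measure (g := fun z => f (u + z)) (f := fun p : ℝ × ℝ => p.1 + p.2)
        hint.aestronglyMeasurable (by fun_prop)).1 hint
    have S2 : |∑ o, w 0 o * ∫ z, f (u + ξ 0 o + z) ∂gaussianReal 0 v' -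
        ∫ z, f (u + z) ∂gaussianReal 0 (v 0 + v')| ≤ C := by
      have i1 : ∀ o ∈ univ, Integrable (fun z => w 0 o * f (u + z + ξ 0 o)) (gaussianReal 0 v') :=
        fun o _ => by
          have := (hf (u + ξ 0 o) v').const_mul (w 0 o)
          refine this.congr (.of_forall fun z => ?_)
          simp only
          ring_nf
      have e1 : ∑ o, w 0 o * ∫ z, f (u + ξ 0 o + z) ∂gaussianReal 0 v' =
          ∫ z, ∑ o, w 0 o * f (u + z + ξ 0 o) ∂gaussianReal 0 v' := by
        rw [integral_finsetSum _ i1]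
        refine Finset.sum_congr rfl fun o _ => ?_
        rw [← integral_const_mul]
        congr 1 with z
        ring_nf
      rw [e1, hconv, integral_conv hint, ← integral_sub (integrable_finsetSum _ i1)
        hprod.integral_prod_left, ← Real.norm_eq_abs]
      refine (norm_integral_le_of_norm_le_const (C := C) (.of_forall fun z => ?_)).trans
        (le_of_eq (by simp))
      simp only [← add_assoc, Real.norm_eq_abs]
      exact abs_sum_sub_integral_gaussianReal_le h₁ h₂ h₃ hK hf (hw 0) (hw1 0) (hξ 0) (hb 0)
        (hv 0) hb0 (u + z)
    have := abs_sub_le (∑ o, w 0 o * prodExp (fun j : Fin J => w j.succ)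
          (fun r => f (u + (ξ 0 o + ∑ j : Fin J, ξ j.succ (r j)))))
        (∑ o, w 0 o * ∫ z, f (u + ξ 0 o + z) ∂gaussianReal 0 v')
        (∫ z, f (u + z) ∂gaussianReal 0 (v 0 + v'))
    push_cast
    linarith

/-- A smooth approximation of the absolute value. -/
noncomputable def smoothAbs (δ u : ℝ) : ℝ := √(u ^ 2 + δ ^ 2)

theorem abs_le_smoothAbs (δ u : ℝ) : |u| ≤ smoothAbs δ u :=
  Real.abs_le_sqrt (by nlinarith [sq_nonneg δ])

theorem smoothAbs_le {δ : ℝ} (hδ : 0 ≤ δ) (u : ℝ) : smoothAbs δ u ≤ |u| + δ := by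
  rw [smoothAbs, Real.sqrt_le_left (by positivity)]
  nlinarith [abs_nonneg u, sq_abs u]

theorem smoothAbs_pos {δ : ℝ} (hδ : 0 < δ) (u : ℝ) : 0 < smoothAbs δ u :=
  Real.sqrt_pos.2 (by positivity)

theorem smoothAbs_sq (δ u : ℝ) : smoothAbs δ u ^ 2 = u ^ 2 + δ ^ 2 :=
  Real.sq_sqrt (by positivity)

theorem continuous_smoothAbs (δ : ℝ) : Continuous (smoothAbs δ) := by
  unfold smoothAbs
  fun_prop

theorem hasDerivAt_smoothAbs {δ : ℝ} (hδ : 0 < δ) (u : ℝ) :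
    HasDerivAt (smoothAbs δ) (u / smoothAbs δ u) u := by
  have h : HasDerivAt (fun u : ℝ => u ^ 2 + δ ^ 2) (2 * u) u := by
    simpa using (hasDerivAt_pow 2 u).add_const (δ ^ 2)
  refine (h.sqrt (by positivity)).congr_deriv ?_
  rw [smoothAbs]
  field_simp

theorem hasDerivAt_smoothAbs₂ {δ : ℝ} (hδ : 0 < δ) (u : ℝ) :
    HasDerivAt (fun u => u / smoothAbs δ u) (δ ^ 2 / smoothAbs δ u ^ 3) u := by
  have hp := smoothAbs_pos hδ u
  refine ((hasDerivAt_id u).div (hasDerivAt_smoothAbs hδ u) hp.ne').congr_deriv ?_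
  have := smoothAbs_sq δ u
  simp only [id]
  field_simp
  linarith

theorem hasDerivAt_smoothAbs₃ {δ : ℝ} (hδ : 0 < δ) (u : ℝ) :
    HasDerivAt (fun u => δ ^ 2 / smoothAbs δ u ^ 3)
      (-(3 * δ ^ 2 * u / smoothAbs δ u ^ 5)) u := by
  have hp := smoothAbs_pos hδ u
  refine ((hasDerivAt_const u (δ ^ 2)).div ((hasDerivAt_smoothAbs hδ u).pow 3)
    (pow_ne_zero 3 hp.ne')).congr_deriv ?_
  simp
  field_simp

/-- Both `δ` and `|u|` are at most `smoothAbs δ u`. This supplies the constant `K` in the exchange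
argument. -/
theorem abs_smoothAbs₃_le {δ : ℝ} (hδ : 0 < δ) (u : ℝ) :
    |-(3 * δ ^ 2 * u / smoothAbs δ u ^ 5)| ≤ 3 / δ ^ 2 := by
  have hp := smoothAbs_pos hδ u
  have h1 := abs_le_smoothAbs δ u
  have h2 : δ ≤ smoothAbs δ u := Real.le_sqrt_of_sq_le (by nlinarith [sq_nonneg u])
  rw [abs_neg, abs_div, abs_mul, abs_of_pos (by positivity : 0 < 3 * δ ^ 2),
    abs_of_pos (by positivity : 0 < smoothAbs δ u ^ 5), div_le_div_iff₀ (by positivity)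
    (by positivity)]
  calc 3 * δ ^ 2 * |u| * δ ^ 2 = 3 * (δ ^ 4 * |u|) := by ring
    _ ≤ 3 * (smoothAbs δ u ^ 4 * smoothAbs δ u) := by gcongr
    _ = 3 * smoothAbs δ u ^ 5 := by ring

theorem integrable_smoothAbs_add {δ : ℝ} (hδ : 0 ≤ δ) (u : ℝ) (v : ℝ≥0) :
    Integrable (fun z => smoothAbs δ (u + z)) (gaussianReal 0 v) := by
  have i1 : Integrable (fun z : ℝ => |z|) (gaussianReal 0 v) := by
    simpa using integrable_abs_pow_gaussianReal v 1
  refine Integrable.mono' (i1.add (integrable_const (|u| + δ)))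
    ((continuous_smoothAbs δ).comp (by fun_prop)).aestronglyMeasurable (.of_forall fun z => ?_)
  rw [Real.norm_eq_abs, abs_of_nonneg ((abs_nonneg _).trans (abs_le_smoothAbs _ _))]
  simp only [Pi.add_apply]
  linarith [smoothAbs_le hδ (u + z), abs_add_le u z]

theorem integral_abs_gaussianReal (v : ℝ≥0) :
    ∫ z, |z| ∂gaussianReal 0 v = √(2 / Real.pi) * √(v : ℝ) := by
  rw [integral_gaussianReal_eq v (by fun_prop), ← integral_abs_gaussianReal_one, mul_comm,
    ← integral_const_mul]
  congr 1 with z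
  rw [abs_mul, abs_of_nonneg (Real.sqrt_nonneg _)]

/-- The Gaussian is symmetric, so `z` may be averaged with `-z`, and `|u + z| + |u - z| ≥ 2 |z|`.
Hence no shift lowers the mean absolute deviation. -/
theorem le_integral_smoothAbs_add {δ : ℝ} (hδ : 0 ≤ δ) (u : ℝ) (v : ℝ≥0) :
    √(2 / Real.pi) * √(v : ℝ) ≤ ∫ z, smoothAbs δ (u + z) ∂gaussianReal 0 v := by
  have i1 : Integrable (fun z : ℝ => |z|) (gaussianReal 0 v) := by
    simpa using integrable_abs_pow_gaussianReal v 1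
  have hneg : ∫ z, smoothAbs δ (u + -z) ∂gaussianReal 0 v =
      ∫ z, smoothAbs δ (u + z) ∂gaussianReal 0 v := by
    have := gaussianReal_map_neg (μ := 0) (v := v)
    rw [neg_zero] at this
    conv_rhs => rw [← this]
    have hc : Continuous fun z => smoothAbs δ (u + z) :=
      (continuous_smoothAbs δ).comp (continuous_const.add continuous_id)
    rw [integral_map measurable_neg.aemeasurable hc.aestronglyMeasurable]
  have i2 := integrable_smoothAbs_add hδ u v
  have i3 : Integrable (fun z => smoothAbs δ (u + -z)) (gaussianReal 0 v) := by
    refine (integrable_smoothAbs_add hδ (-u) v).congr (.of_forall fun z => ?_)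
    simp only [smoothAbs]
    congr 2
    ring
  have : ∫ z, |z| ∂gaussianReal 0 v ≤
      ∫ z, (smoothAbs δ (u + z) + smoothAbs δ (u + -z)) / 2 ∂gaussianReal 0 v := by
    refine integral_mono i1 ((i2.add i3).div_const 2) fun z => ?_
    have h1 := abs_le_smoothAbs δ (u + z)
    have h2 := abs_le_smoothAbs δ (u + -z)
    have h3 : |2 * z| ≤ |u + z| + |u + -z| := by
      have := abs_sub (u + z) (u + -z)
      rwa [show u + z - (u + -z) = 2 * z by ring] at this
    rw [abs_mul, abs_two] at h3
    simp only
    linarith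
  rw [integral_div, integral_add i2 i3, hneg, integral_abs_gaussianReal] at this
  linarith

theorem integral_smoothAbs_le {δ : ℝ} (hδ : 0 ≤ δ) (v : ℝ≥0) :
    ∫ z, smoothAbs δ (0 + z) ∂gaussianReal 0 v ≤ √(2 / Real.pi) * √(v : ℝ) + δ := by
  have i1 : Integrable (fun z : ℝ => |z|) (gaussianReal 0 v) := by
    simpa using integrable_abs_pow_gaussianReal v 1
  calc ∫ z, smoothAbs δ (0 + z) ∂gaussianReal 0 v ≤ ∫ z, (|z| + δ) ∂gaussianReal 0 v := by
        refine integral_mono (integrable_smoothAbs_add hδ 0 v) (i1.add (integrable_const δ))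
          fun z => ?_
        simpa using smoothAbs_le hδ z
    _ = √(2 / Real.pi) * √(v : ℝ) + δ := by
        rw [integral_add i1 (integrable_const _), integral_abs_gaussianReal]
        simp

/-- The error of the Gaussian approximation of the mean absolute deviation. -/
noncomputable def cltError (J : ℕ) (b δ : ℝ) : ℝ :=
  δ + J * (3 / δ ^ 2 * b ^ 3 * (1 + gaussThird))

/-- A sum of independent centred bounded variables deviates from any point at least as much, up to
a small error, as the Gaussian variable of the same variance deviates from its mean. -/
theorem le_prodExp_abs_sum {J : ℕ} {w ξ : Fin J → α → ℝ} {b δ : ℝ} (hb0 : 0 ≤ b) (hδ : 0 < δ)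
    (hw : ∀ j o, 0 ≤ w j o) (hw1 : ∀ j, ∑ o, w j o = 1) (hξ : ∀ j, ∑ o, w j o * ξ j o = 0)
    (hb : ∀ j o, |ξ j o| ≤ b) (u : ℝ) :
    √(2 / Real.pi) * √(∑ j, ∑ o, w j o * ξ j o ^ 2) - cltError J b δ ≤
      prodExp w (fun r => |u + ∑ j, ξ j (r j)|) := by
  let v : Fin J → ℝ≥0 := fun j => ⟨∑ o, w j o * ξ j o ^ 2,
    Finset.sum_nonneg fun o _ => mul_nonneg (hw j o) (sq_nonneg _)⟩
  have h := abs_prodExp_sub_integral_gaussianReal_le (hasDerivAt_smoothAbs hδ)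
    (hasDerivAt_smoothAbs₂ hδ) (hasDerivAt_smoothAbs₃ hδ) (abs_smoothAbs₃_le hδ)
    (integrable_smoothAbs_add hδ.le) hb0 J w ξ hw hw1 hξ hb v (fun j => rfl) u
  have h2 := le_integral_smoothAbs_add hδ.le u (∑ j, v j)
  have e : ((∑ j, v j : ℝ≥0) : ℝ) = ∑ j, ∑ o, w j o * ξ j o ^ 2 := by
    rw [NNReal.coe_sum]; rfl
  rw [e] at h2
  have h3 : prodExp w (fun r => smoothAbs δ (u + ∑ j, ξ j (r j))) ≤
      prodExp w (fun r => |u + ∑ j, ξ j (r j)| + δ) :=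
    prodExp_mono hw fun r => smoothAbs_le hδ.le _
  rw [prodExp_add, prodExp_const hw1] at h3
  have := (abs_le.1 h).1
  rw [cltError]
  linarith

/-- The mean absolute deviation of a sum of independent centred bounded variables is at most, up
to a small error, that of the Gaussian variable of the same variance. -/
theorem prodExp_abs_sum_le {J : ℕ} {w ξ : Fin J → α → ℝ} {b δ : ℝ} (hb0 : 0 ≤ b) (hδ : 0 < δ)
    (hw : ∀ j o, 0 ≤ w j o) (hw1 : ∀ j, ∑ o, w j o = 1) (hξ : ∀ j, ∑ o, w j o * ξ j o = 0)
    (hb : ∀ j o, |ξ j o| ≤ b) :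
    prodExp w (fun r => |∑ j, ξ j (r j)|) ≤
      √(2 / Real.pi) * √(∑ j, ∑ o, w j o * ξ j o ^ 2) + cltError J b δ := by
  let v : Fin J → ℝ≥0 := fun j => ⟨∑ o, w j o * ξ j o ^ 2,
    Finset.sum_nonneg fun o _ => mul_nonneg (hw j o) (sq_nonneg _)⟩
  have h := abs_prodExp_sub_integral_gaussianReal_le (hasDerivAt_smoothAbs hδ)
    (hasDerivAt_smoothAbs₂ hδ) (hasDerivAt_smoothAbs₃ hδ) (abs_smoothAbs₃_le hδ)
    (integrable_smoothAbs_add hδ.le) hb0 J w ξ hw hw1 hξ hb v (fun j => rfl) 0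
  have h2 := integral_smoothAbs_le hδ.le (∑ j, v j)
  have e : ((∑ j, v j : ℝ≥0) : ℝ) = ∑ j, ∑ o, w j o * ξ j o ^ 2 := by
    rw [NNReal.coe_sum]; rfl
  rw [e] at h2
  have h3 : prodExp w (fun r => |∑ j, ξ j (r j)|) ≤
      prodExp w (fun r => smoothAbs δ (0 + ∑ j, ξ j (r j))) :=
    prodExp_mono hw fun r => by simpa using abs_le_smoothAbs δ (∑ j, ξ j (r j))
  have := (abs_le.1 h).2
  rw [cltError]
  linarith

end Lindeberg

/-! ### The information of a private mechanism at the uniform distribution. -/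

namespace Mechanism

variable {d m : ℕ} {ε : ℝ}

/-- The sum of a row of the perturbation matrix. -/
def rowSum (M : Mechanism d m ε) (o : Fin m) : ℝ := ∑ x, M.P o x

/-- The information (per user, suitably normalised) that the mechanism carries at the uniform
distribution about the frequency of the value `x`. -/
noncomputable def info (M : Mechanism d m ε) (x : Fin d) : ℝ :=
  ∑ o, M.P o x ^ 2 / M.rowSum o - 1 / d

variable (M : Mechanism d m ε)

theorem rowSum_nonneg (o : Fin m) : 0 ≤ M.rowSum o := Finset.sum_nonneg fun x _ => M.nonneg o x

theorem le_rowSum (o : Fin m) (x : Fin d) : M.P o x ≤ M.rowSum o :=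
  Finset.single_le_sum (f := fun x => M.P o x) (fun y _ => M.nonneg o y) (Finset.mem_univ x)

theorem eq_zero_of_rowSum_eq_zero {o : Fin m} (h : M.rowSum o = 0) (x : Fin d) : M.P o x = 0 :=
  le_antisymm (h ▸ M.le_rowSum o x) (M.nonneg o x)

theorem sum_rowSum : ∑ o, M.rowSum o = d := by
  refine Finset.sum_comm.trans ?_
  simp [M.sum_eq_one]

/-- With `b` the least entry of the row, privacy gives `(P - b) (e^ε b - P) ≥ 0` for each entry `P`.
Summing bounds the left side by a concave quadratic in `b`, whose maximum over `b` is the right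
side. -/
theorem sum_sq_le (hd : 0 < d) (o : Fin m) :
    4 * d * Real.exp ε * ∑ x, M.P o x ^ 2 ≤ (Real.exp ε + 1) ^ 2 * M.rowSum o ^ 2 := by
  have : NeZero d := ⟨hd.ne'⟩
  obtain ⟨x₀, -, hx₀⟩ := Finset.exists_min_image univ (fun x => M.P o x) ⟨0, Finset.mem_univ 0⟩
  set b := M.P o x₀
  set e := Real.exp ε
  have h : ∑ x, M.P o x ^ 2 ≤ (e + 1) * b * M.rowSum o - d * (e * b ^ 2) := by
    have h1 : ∀ x, M.P o x ^ 2 ≤ (e + 1) * b * M.P o x - e * b ^ 2 := fun x => by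
      have h2 := hx₀ x (Finset.mem_univ x)
      have h3 : M.P o x ≤ e * b := M.ldp o x x₀
      nlinarith [mul_nonneg (sub_nonneg.2 h2) (sub_nonneg.2 h3)]
    refine (Finset.sum_le_sum fun x _ => h1 x).trans (le_of_eq ?_)
    rw [Finset.sum_sub_distrib, ← Finset.mul_sum, rowSum]
    simp
  have := mul_le_mul_of_nonneg_left h (by positivity : 0 ≤ 4 * d * e)
  nlinarith [sq_nonneg ((e + 1) * M.rowSum o - 2 * d * e * b)]

/-- The row bounds add up because the row sums total `d`. This is all that privacy contributes to
the `L₂` lower bounds. -/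
theorem sum_info_le (hd : 0 < d) :
    ∑ x, M.info x ≤ (Real.exp ε - 1) ^ 2 / (4 * Real.exp ε) := by
  have h1 : ∑ x, ∑ o, M.P o x ^ 2 / M.rowSum o ≤ (Real.exp ε + 1) ^ 2 / (4 * Real.exp ε) := by
    rw [Finset.sum_comm]
    calc ∑ o, ∑ x, M.P o x ^ 2 / M.rowSum o
        ≤ ∑ o, (Real.exp ε + 1) ^ 2 / (4 * d * Real.exp ε) * M.rowSum o := by
          refine Finset.sum_le_sum fun o _ => ?_
          rw [← Finset.sum_div]
          rcases (M.rowSum_nonneg o).eq_or_lt with h | h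
          · rw [← h]; simp
          · rw [div_le_iff₀ h, div_mul_eq_mul_div, div_mul_eq_mul_div, le_div_iff₀ (by positivity)]
            nlinarith [M.sum_sq_le hd o]
      _ = (Real.exp ε + 1) ^ 2 / (4 * Real.exp ε) := by
          rw [← Finset.mul_sum, M.sum_rowSum]
          field_simp
  have h2 : (d : ℝ) * (1 / d) = 1 := by field_simp
  simp only [info, Finset.sum_sub_distrib, Finset.sum_const, Finset.card_univ, Fintype.card_fin,
    nsmul_eq_mul, h2]
  have h3 : (Real.exp ε + 1) ^ 2 / (4 * Real.exp ε) - 1 =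
      (Real.exp ε - 1) ^ 2 / (4 * Real.exp ε) := by
    field_simp
    ring
  linarith

/-- Clears the denominator of the score. A row with sum `0` vanishes, so division by zero does no
harm there. -/
theorem rowSum_div_mul_score (hd : 0 < d) (o : Fin m) (x : Fin d) :
    M.rowSum o / d * (d * M.P o x / M.rowSum o - 1) = M.P o x - M.rowSum o / d := by
  rcases eq_or_ne (M.rowSum o) 0 with h | h
  · simp [h, M.eq_zero_of_rowSum_eq_zero h]
  · field_simp

theorem sum_rowSum_div (hd : 0 < d) : ∑ o, M.rowSum o / d = 1 := by
  have hd' : (d : ℝ) ≠ 0 := by exact_mod_cast hd.ne'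
  rw [← Finset.sum_div, M.sum_rowSum, div_self hd']

theorem sum_score (hd : 0 < d) (x : Fin d) :
    ∑ o, M.rowSum o / d * (d * M.P o x / M.rowSum o - 1) = 0 := by
  simp only [M.rowSum_div_mul_score hd, Finset.sum_sub_distrib, M.sum_eq_one,
    M.sum_rowSum_div hd, sub_self]

theorem sum_score_sq (hd : 0 < d) (x : Fin d) :
    ∑ o, M.rowSum o / d * (d * M.P o x / M.rowSum o - 1) ^ 2 = d * M.info x := by
  have h : ∀ o, M.rowSum o / d * (d * M.P o x / M.rowSum o - 1) ^ 2 =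
      d * (M.P o x ^ 2 / M.rowSum o) - 2 * M.P o x + M.rowSum o / d := fun o => by
    rcases eq_or_ne (M.rowSum o) 0 with h | h
    · simp [h, M.eq_zero_of_rowSum_eq_zero h]
    · field_simp
      ring
  simp only [h, Finset.sum_add_distrib, Finset.sum_sub_distrib, ← Finset.mul_sum, M.sum_eq_one,
    M.sum_rowSum_div hd, info]
  field_simp
  ring

end Mechanism

/-! ### The Cramér–Rao bound for unbiased distribution estimators. -/

namespace Estimator

variable {d n : ℕ} {ε : ℝ} (A : Estimator d n ε)

theorem expect_eq_prodExp (X : Fin n → Fin d) (g : (Fin n → Fin A.m) → ℝ) :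
    A.expect X g = prodExp (fun i o => A.mech.P o (X i)) g := rfl

theorem expectIID_eq_prodExp_expect (θ : Fin d → ℝ) (g : (Fin n → Fin A.m) → ℝ) :
    A.expectIID θ g = prodExp (fun _ : Fin n => θ) (fun X => A.expect X g) := rfl

theorem expectIID_eq_prodExp (θ : Fin d → ℝ) (g : (Fin n → Fin A.m) → ℝ) :
    A.expectIID θ g = prodExp (fun _ o => ∑ x, θ x * A.mech.P o x) g :=
  sum_prod_mul_prodExp (fun _ => θ) A.mech.P g

theorem uniform_mem_stdSimplex (hd : 0 < d) :
    (fun _ => 1 / (d : ℝ)) ∈ stdSimplex ℝ (Fin d) := by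
  have hd' : (d : ℝ) ≠ 0 := by exact_mod_cast hd.ne'
  exact ⟨fun _ => by positivity, by simp [hd']⟩

variable {A}

/-- Differentiating the unbiasedness relation at the uniform distribution. -/
theorem UnbiasedDist.prodExp_mul_score (hA : A.UnbiasedDist) (hd : 0 < d) (x : Fin d) :
    prodExp (fun (_ : Fin n) o => A.mech.rowSum o / d)
      (fun r => A.recon r x * ∑ i, (d * A.mech.P (r i) x / A.mech.rowSum (r i) - 1)) =
      1 - 1 / d := by
  have hd' : (0 : ℝ) < d := by exact_mod_cast hd
  set w : Fin A.m → ℝ := fun o => d * A.mech.P o x / A.mech.rowSum o - 1 with hw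
  -- `F t` is the mean estimate when the data come from the mixture of the uniform distribution and
  -- the point mass at `x`, the latter with weight `t`. The response law then has density `1 + t *
  -- w` relative to the uniform case.
  set F : ℝ → ℝ := fun t => ∑ r : Fin n → Fin A.m,
    (∏ i, A.mech.rowSum (r i) / d) * (A.recon r x * ∏ i, (1 + t * w (r i))) with hF
  have h1 : ∀ t ∈ Set.Icc (0 : ℝ) 1, F t = 1 / d + t * (1 - 1 / d) := by
    intro t ht
    set θ : Fin d → ℝ := fun y => (1 - t) / d + if y = x then t else 0 with hθ
    have hθm : θ ∈ stdSimplex ℝ (Fin d) := by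
      refine ⟨fun y => ?_, ?_⟩
      · have : 0 ≤ (1 - t) / d := div_nonneg (by linarith [ht.2]) hd'.le
        simp only [hθ]
        split_ifs <;> linarith [ht.1]
      · simp only [hθ, Finset.sum_add_distrib, Finset.sum_ite_eq', Finset.mem_univ, if_true]
        simp
        field_simp
        ring
    have h2 := hA θ hθm x
    rw [expectIID_eq_prodExp] at h2
    have h3 : ∀ o, ∑ y, θ y * A.mech.P o y = A.mech.rowSum o / d * (1 + t * w o) := fun o => by
      have e1 := A.mech.rowSum_div_mul_score hd o x
      have e2 : ∑ y, θ y * A.mech.P o y = (1 - t) / d * A.mech.rowSum o + t * A.mech.P o x := by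
        simp only [hθ, add_mul, Finset.sum_add_distrib, ← Finset.mul_sum, ite_mul, zero_mul,
          Finset.sum_ite_eq', Finset.mem_univ, if_true, Mechanism.rowSum]
      rw [e2]
      calc (1 - t) / d * A.mech.rowSum o + t * A.mech.P o x
          = A.mech.rowSum o / d + t * (A.mech.P o x - A.mech.rowSum o / d) := by ring
        _ = _ := by rw [← e1]; ring
    simp only [h3] at h2
    have h4 : θ x = 1 / d + t * (1 - 1 / d) := by
      simp only [hθ, if_true]
      ring
    rw [← h4, ← h2]
    simp only [hF, prodExp, Finset.prod_mul_distrib]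
    exact Finset.sum_congr rfl fun r _ => by ring
  have h2 : HasDerivAt F (∑ r : Fin n → Fin A.m,
      (∏ i, A.mech.rowSum (r i) / d) * (A.recon r x * ∑ i, w (r i))) 0 := by
    refine HasDerivAt.fun_sum fun r _ => (HasDerivAt.const_mul _ ?_).const_mul _
    have h3 : ∀ i ∈ (univ : Finset (Fin n)),
        HasDerivAt (fun t : ℝ => 1 + t * w (r i)) (w (r i)) 0 := fun i _ => by
      simpa using ((hasDerivAt_id (0 : ℝ)).mul_const (w (r i))).const_add 1
    refine (HasDerivAt.fun_finsetProd h3).congr_deriv ?_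
    simp
  have h3 : HasDerivWithinAt F (1 - 1 / d) (Set.Icc 0 1) 0 := by
    have : HasDerivAt (fun t : ℝ => 1 / (d : ℝ) + t * (1 - 1 / d)) (1 - 1 / d) 0 := by
      simpa using ((hasDerivAt_id (0 : ℝ)).mul_const (1 - 1 / (d : ℝ))).const_add (1 / (d : ℝ))
    exact this.hasDerivWithinAt.congr h1 (h1 0 (by simp))
  -- Unbiasedness is available only for `t` in `[0, 1]`, so the two derivatives are compared within
  -- this interval, at its endpoint `0`.
  exact (uniqueDiffOn_Icc zero_lt_one 0 (by simp)).eq_deriv _ h2.hasDerivWithinAt h3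

/-- The Cramér–Rao bound at the uniform distribution, summed over the values. -/
theorem UnbiasedDist.le_expectIID_uniform (hA : A.UnbiasedDist) (hε : 0 < ε)
    (hd : Real.exp ε + 1 ≤ d) (hn : 0 < n) :
    optL2 d n ε + (1 - 1 / (d : ℝ)) / n ≤
      A.expectIID (fun _ => 1 / d) (fun r => ∑ x, (A.recon r x - 1 / d) ^ 2) := by
  have he : 1 < Real.exp ε := Real.one_lt_exp_iff.2 hε
  have hd' : (0 : ℝ) < d := by linarith
  have hd0 : 0 < d := by exact_mod_cast hd'
  rw [expectIID_eq_prodExp]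
  have e1 : ∀ o, ∑ x, 1 / (d : ℝ) * A.mech.P o x = A.mech.rowSum o / d := fun o => by
    rw [← Finset.mul_sum, Mechanism.rowSum]
    ring
  simp only [e1]
  rw [prodExp_sum]
  set e := Real.exp ε
  set T := (e - 1) ^ 2 / (4 * e) with hT
  -- This `l` maximises `2 l (d - 1) - l ^ 2 n d T`, the sum of the bounds `h1` when the total
  -- information is `T`. Being common to all `x`, it lets only the total enter.
  set l : ℝ := (d - 1) / (n * d * T) with hl
  have hβ0 : ∀ (i : Fin n) o, 0 ≤ A.mech.rowSum o / d := fun _ o =>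
    div_nonneg (A.mech.rowSum_nonneg o) hd'.le
  have hβ1 : ∀ i : Fin n, ∑ o, A.mech.rowSum o / d = 1 := fun _ => A.mech.sum_rowSum_div hd0
  have h1 : ∀ x, 2 * l * (1 - 1 / d) - l ^ 2 * (n * d * A.mech.info x) ≤
      prodExp (fun (_ : Fin n) o => A.mech.rowSum o / d) (fun r => (A.recon r x - 1 / d) ^ 2) := by
    intro x
    set w : Fin A.m → ℝ := fun o => d * A.mech.P o x / A.mech.rowSum o - 1 with hw
    have h2 : prodExp (fun (_ : Fin n) o => A.mech.rowSum o / d)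
        (fun r => A.recon r x * ∑ i, w (r i)) = 1 - 1 / d := hA.prodExp_mul_score hd0 x
    have h3 : prodExp (fun (_ : Fin n) o => A.mech.rowSum o / d) (fun r => ∑ i, w (r i)) = 0 := by
      rw [prodExp_sum_eval hβ1 (fun _ => w)]
      simp [hw, A.mech.sum_score hd0]
    have h4 : prodExp (fun (_ : Fin n) o => A.mech.rowSum o / d) (fun r => (∑ i, w (r i)) ^ 2) =
        n * d * A.mech.info x := by
      rw [prodExp_sum_sq hβ1 (fun _ => w) fun _ => A.mech.sum_score hd0 x]
      simp [hw, A.mech.sum_score_sq hd0, mul_assoc]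
    -- Obtained by expanding `0 ≤ (recon - 1/d - l * score) ^ 2`.
    have h5 : prodExp (fun (_ : Fin n) o => A.mech.rowSum o / d) (fun r =>
        2 * l * (A.recon r x * ∑ i, w (r i)) - 2 * l / d * (∑ i, w (r i)) -
          l ^ 2 * (∑ i, w (r i)) ^ 2) ≤
        prodExp (fun (_ : Fin n) o => A.mech.rowSum o / d) (fun r => (A.recon r x - 1 / d) ^ 2) := by
      refine prodExp_mono hβ0 fun r => ?_
      have : 2 * l / d * (∑ i, w (r i)) = 2 * l * (1 / d * ∑ i, w (r i)) := by ring
      rw [this]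
      nlinarith [sq_nonneg (A.recon r x - 1 / d - l * ∑ i, w (r i))]
    rw [prodExp_sub, prodExp_sub, prodExp_const_mul, prodExp_const_mul, prodExp_const_mul, h2, h3,
      h4] at h5
    linarith
  refine le_trans ?_ (Finset.sum_le_sum fun x _ => h1 x)
  rw [Finset.sum_sub_distrib, ← Finset.mul_sum, ← Finset.mul_sum, Finset.sum_const,
    Finset.card_univ, Fintype.card_fin, nsmul_eq_mul, ← Finset.mul_sum]
  have h6 : l ^ 2 * (n * d * ∑ x, A.mech.info x) ≤ l ^ 2 * (n * d * T) := by
    have := A.mech.sum_info_le hd0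
    gcongr
  refine le_trans (le_of_eq ?_) (sub_le_sub_left h6 _)
  rw [hl, optL2, hT]
  change ((d : ℝ) - 1) * (4 * d * e - (e + 1) ^ 2) / (n * d * (e - 1) ^ 2) + _ = _
  have : e - 1 ≠ 0 := by linarith
  have : e ≠ 0 := by positivity
  field_simp
  ring

variable (A)

/-- The real supremum of an unbounded family is `0` by default, so boundedness must be known before
the supremum can be used as an upper bound. -/
theorem bddAbove_distL2 : BddAbove (Set.range fun θ : stdSimplex ℝ (Fin d) =>
    A.expectIID θ.1 (fun r => ∑ x, (A.recon r x - θ.1 x) ^ 2)) := by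
  refine (isCompact_range ?_).bddAbove
  simp only [expectIID, expect]
  have h : ∀ y : Fin d, Continuous fun θ : stdSimplex ℝ (Fin d) => θ.1 y := fun y =>
    (continuous_apply y).comp continuous_subtype_val
  refine continuous_finsetSum _ fun X _ => (continuous_finsetProd _ fun i _ => h (X i)).mul ?_
  refine continuous_finsetSum _ fun r _ => continuous_const.mul ?_
  exact continuous_finsetSum _ fun x _ => (continuous_const.sub (h x)).pow 2

theorem le_distL2 {θ : Fin d → ℝ} (hθ : θ ∈ stdSimplex ℝ (Fin d)) :
    A.expectIID θ (fun r => ∑ x, (A.recon r x - θ x) ^ 2) ≤ A.distL2 :=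
  le_ciSup A.bddAbove_distL2 ⟨θ, hθ⟩

theorem le_freqL2 (X : Fin n → Fin d) :
    A.expect X (fun r => ∑ x, (A.recon r x - freq X x) ^ 2) ≤ A.freqL2 :=
  le_ciSup (f := fun X : Fin n → Fin d => A.expect X (fun r => ∑ x, (A.recon r x - freq X x) ^ 2))
    (Set.finite_range _).bddAbove X

theorem le_freqL1 (X : Fin n → Fin d) :
    A.expect X (fun r => ∑ x, |A.recon r x - freq X x|) ≤ A.freqL1 :=
  le_ciSup (f := fun X : Fin n → Fin d => A.expect X (fun r => ∑ x, |A.recon r x - freq X x|))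
    (Set.finite_range _).bddAbove X

end Estimator

/-! ### From distribution estimation to frequency estimation. -/

theorem freq_eq_sum {d n : ℕ} (X : Fin n → Fin d) (x : Fin d) :
    freq X x = (∑ i, if X i = x then 1 else 0) / n := by
  simp [freq]

theorem prodExp_freq {d n : ℕ} (hn : 0 < n) {θ : Fin d → ℝ} (hθ : θ ∈ stdSimplex ℝ (Fin d))
    (x : Fin d) : prodExp (fun _ : Fin n => θ) (fun X => freq X x) = θ x := by
  have h := prodExp_sum_eval (w := fun _ : Fin n => θ) (fun _ => hθ.2)
    (fun _ y => if y = x then 1 else 0)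
  have h2 := prodExp_const_mul (fun _ : Fin n => θ) (1 / (n : ℝ))
    (fun X => ∑ i, if X i = x then 1 else 0)
  simp only [freq_eq_sum, div_eq_inv_mul, mul_one] at h2 ⊢
  rw [h2, h]
  simp
  field_simp

theorem prodExp_freq_sub_sq {d n : ℕ} (hn : 0 < n) {θ : Fin d → ℝ}
    (hθ : θ ∈ stdSimplex ℝ (Fin d)) (x : Fin d) :
    prodExp (fun _ : Fin n => θ) (fun X => (freq X x - θ x) ^ 2) = θ x * (1 - θ x) / n := by
  have hs : ∑ y, θ y * ((if y = x then 1 else 0) - θ x) = 0 := by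
    simp [mul_sub, Finset.sum_sub_distrib, ← Finset.sum_mul, hθ.2]
  have h := prodExp_sum_sq (w := fun _ : Fin n => θ) (fun _ => hθ.2)
    (fun _ y => (if y = x then 1 else 0) - θ x) (fun _ => hs)
  have e : ∀ X : Fin n → Fin d, (freq X x - θ x) ^ 2 =
      1 / (n : ℝ) ^ 2 * (∑ i, ((if X i = x then 1 else 0) - θ x)) ^ 2 := fun X => by
    rw [freq_eq_sum, Finset.sum_sub_distrib]
    simp
    field_simp
  simp only [e]
  rw [prodExp_const_mul, h]
  have e2 : ∑ y, θ y * ((if y = x then 1 else 0) - θ x) ^ 2 = θ x * (1 - θ x) := by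
    have : ∀ y, θ y * ((if y = x then 1 else 0) - θ x) ^ 2 =
        (if y = x then θ y * (1 - 2 * θ x) else 0) + θ y * θ x ^ 2 := fun y => by
      split_ifs <;> ring
    simp only [this, Finset.sum_add_distrib, ← Finset.sum_mul, hθ.2, Finset.sum_ite_eq',
      Finset.mem_univ, if_true]
    ring
  simp only [e2, Finset.sum_const, Finset.card_univ, Fintype.card_fin, nsmul_eq_mul]
  field_simp

namespace Estimator

variable {d n : ℕ} {ε : ℝ} {A : Estimator d n ε}

theorem UnbiasedFreq.unbiasedDist (hA : A.UnbiasedFreq) (hn : 0 < n) : A.UnbiasedDist := by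
  intro θ hθ x
  rw [expectIID_eq_prodExp_expect]
  simp only [hA _ x]
  exact prodExp_freq hn hθ x

/-- For an unbiased frequency estimator, the `L₂` risk for distribution estimation is the mean
`L₂` risk for frequency estimation plus the sampling variance. -/
theorem UnbiasedFreq.expectIID_sq (hA : A.UnbiasedFreq) (hn : 0 < n) {θ : Fin d → ℝ}
    (hθ : θ ∈ stdSimplex ℝ (Fin d)) :
    A.expectIID θ (fun r => ∑ x, (A.recon r x - θ x) ^ 2) =
      prodExp (fun _ : Fin n => θ)
        (fun X => A.expect X (fun r => ∑ x, (A.recon r x - freq X x) ^ 2)) +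
      (1 - ∑ x, θ x ^ 2) / n := by
  rw [expectIID_eq_prodExp_expect]
  have h : ∀ X : Fin n → Fin d, A.expect X (fun r => ∑ x, (A.recon r x - θ x) ^ 2) =
      A.expect X (fun r => ∑ x, (A.recon r x - freq X x) ^ 2) + ∑ x, (freq X x - θ x) ^ 2 := by
    intro X
    simp only [expect_eq_prodExp]
    rw [prodExp_sum, prodExp_sum, ← Finset.sum_add_distrib]
    refine Finset.sum_congr rfl fun x _ => ?_
    -- The cross term has mean zero for each fixed dataset, by unbiasedness as a frequency
    -- estimator.
    have e : ∀ r, (A.recon r x - θ x) ^ 2 = (A.recon r x - freq X x) ^ 2 +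
        2 * (freq X x - θ x) * (A.recon r x - freq X x) + (freq X x - θ x) ^ 2 := fun r => by ring
    have hw : ∀ i, ∑ o, A.mech.P o (X i) = 1 := fun i => A.mech.sum_eq_one _
    simp only [e]
    rw [prodExp_add, prodExp_add, prodExp_const_mul, prodExp_sub, prodExp_const hw,
      prodExp_const hw, ← expect_eq_prodExp, ← expect_eq_prodExp, hA X x]
    ring
  simp only [h]
  rw [prodExp_add, prodExp_sum]
  congr 1
  simp only [prodExp_freq_sub_sq hn hθ]
  rw [← Finset.sum_div]
  congr 1
  simp only [mul_sub, mul_one, Finset.sum_sub_distrib, hθ.2, pow_two]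

theorem UnbiasedDist.le_distL2 (hA : A.UnbiasedDist) (hε : 0 < ε) (hd : Real.exp ε + 1 ≤ d)
    (hn : 0 < n) : optL2 d n ε + (1 - 1 / (d : ℝ)) / n ≤ A.distL2 := by
  have hd0 : 0 < d := by
    have : (0 : ℝ) < d := by linarith [Real.exp_pos ε]
    exact_mod_cast this
  exact (hA.le_expectIID_uniform hε hd hn).trans (A.le_distL2 (uniform_mem_stdSimplex hd0))

/-- The worst dataset is at least as bad as the average over uniform i.i.d. datasets, and at the
uniform distribution the sampling variance is exactly the extra term `(1 - 1/d)/n`. -/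
theorem UnbiasedFreq.le_freqL2 (hA : A.UnbiasedFreq) (hε : 0 < ε) (hd : Real.exp ε + 1 ≤ d)
    (hn : 0 < n) : optL2 d n ε ≤ A.freqL2 := by
  have hd' : (0 : ℝ) < d := by linarith [Real.exp_pos ε]
  have hd0 : 0 < d := by exact_mod_cast hd'
  have h := (hA.unbiasedDist hn).le_expectIID_uniform hε hd hn
  have hu := uniform_mem_stdSimplex hd0
  rw [hA.expectIID_sq hn hu] at h
  have h2 : prodExp (fun (_ : Fin n) (_ : Fin d) => 1 / (d : ℝ))
        (fun X => A.expect X (fun r => ∑ x, (A.recon r x - freq X x) ^ 2)) ≤ A.freqL2 := by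
    rw [← prodExp_const (w := fun (_ : Fin n) (_ : Fin d) => 1 / (d : ℝ)) (fun _ => hu.2) A.freqL2]
    exact prodExp_mono (fun _ _ => by positivity) fun X => A.le_freqL2 X
  have h3 : ∑ x : Fin d, (1 / (d : ℝ)) ^ 2 = 1 / (d : ℝ) := by
    simp
    field_simp
  rw [h3] at h
  linarith

end Estimator

/-! ### Unbiasedness and losses of optimal symmetric configurations. -/

/-- The cross-support probability of an optimal symmetric configuration of support size `k`. -/
noncomputable def crossSupport (d k : ℕ) : ℝ := ((k : ℝ) - 1 / 2) / (d - 1)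

section Parameters

variable {d k : ℕ} {ε : ℝ}

theorem eq_mul_of_eq_div (hk : (k : ℝ) = d / (Real.exp ε + 1)) :
    (d : ℝ) = k * (Real.exp ε + 1) := by
  have := Real.exp_pos ε
  rw [hk]
  field_simp

theorem one_le_of_eq_div (hd : Real.exp ε + 1 ≤ d) (hk : (k : ℝ) = d / (Real.exp ε + 1)) :
    (1 : ℝ) ≤ k := by
  have := Real.exp_pos ε
  rw [hk, le_div_iff₀ (by positivity)]
  linarith

theorem half_sub_crossSupport_pos (hε : 0 < ε) (hd : Real.exp ε + 1 ≤ d)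
    (hk : (k : ℝ) = d / (Real.exp ε + 1)) : 0 < 1 / 2 - crossSupport d k := by
  have he : 1 < Real.exp ε := Real.one_lt_exp_iff.2 hε
  have hdk := eq_mul_of_eq_div hk
  have hd1 : (0 : ℝ) < d - 1 := by linarith
  rw [crossSupport, sub_pos, div_lt_iff₀ hd1]
  nlinarith

theorem crossSupport_nonneg (hε : 0 < ε) (hd : Real.exp ε + 1 ≤ d)
    (hk : (k : ℝ) = d / (Real.exp ε + 1)) : 0 ≤ crossSupport d k := by
  have he : 1 < Real.exp ε := Real.one_lt_exp_iff.2 hε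
  have hk1 := one_le_of_eq_div hd hk
  exact div_nonneg (by linarith) (by linarith)

/-- The left side is the total variance of the `n`-user support counts; the squared factor undoes
the normalisation of the estimator. The relation `d = k (e^ε + 1)` turns the result into the closed
form. -/
theorem support_variance_eq (hε : 0 < ε) (hd : Real.exp ε + 1 ≤ d)
    (hk : (k : ℝ) = d / (Real.exp ε + 1)) {n : ℕ} (hn : 0 < n) :
    n * (1 / 4 + (d - 1) * (crossSupport d k * (1 - crossSupport d k))) =
      (n * (1 / 2 - crossSupport d k)) ^ 2 * optL2 d n ε := by
  have he : 1 < Real.exp ε := Real.one_lt_exp_iff.2 hε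
  have hk1 := one_le_of_eq_div hd hk
  have hdk := eq_mul_of_eq_div hk
  have he1 : Real.exp ε - 1 ≠ 0 := by linarith
  have hd1 : (k : ℝ) * (Real.exp ε + 1) - 1 ≠ 0 := by rw [← hdk]; linarith
  rw [optL2, crossSupport, hdk]
  generalize Real.exp ε = e at *
  field_simp
  ring

end Parameters

/-- The indicator that the value `x` lies in the support set `T`. -/
noncomputable def supp {d : ℕ} (T : Finset (Fin d)) (x : Fin d) : ℝ := if x ∈ T then 1 else 0

/-- The probability that the value `x` is supported by the response to the input `y`. -/
noncomputable def suppProb (d k : ℕ) (x y : Fin d) : ℝ := if x = y then 1 / 2 else crossSupport d k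

theorem sum_suppProb_variance (d k : ℕ) (y : Fin d) :
    ∑ x, suppProb d k x y * (1 - suppProb d k x y) =
      1 / 4 + (d - 1) * (crossSupport d k * (1 - crossSupport d k)) := by
  have : ∀ x, suppProb d k x y * (1 - suppProb d k x y) =
      (if x = y then 1 / 4 - crossSupport d k * (1 - crossSupport d k) else 0) +
        crossSupport d k * (1 - crossSupport d k) := fun x => by
    rw [suppProb]
    split_ifs <;> ring
  simp only [this, Finset.sum_add_distrib, Finset.sum_ite_eq', Finset.mem_univ, if_true,
    Finset.sum_const, Finset.card_univ, Fintype.card_fin, nsmul_eq_mul]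
  ring

namespace Estimator

variable {d n k : ℕ} {ε : ℝ} {A : Estimator d n ε}

/-- Double counting determines the parameters. Adding all entries of `P` gives `2 k e^ε ∑ b = d`;
adding the self-support probabilities gives `d p = k e^ε ∑ b`, so `p = 1/2`; and the expected size
of the support of one response gives `p + (d - 1) q = k`. -/
theorem IsOSC.exists_support (hA : A.IsOSC k) (hε : 0 < ε) (hd : Real.exp ε + 1 ≤ d)
    (hk : (k : ℝ) = d / (Real.exp ε + 1)) :
    ∃ S : Fin A.m → Finset (Fin d),
      (∀ x y, ∑ o, A.mech.P o y * supp (S o) x = suppProb d k x y) ∧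
      ∀ r x, A.recon r x =
        ((∑ i, supp (S (r i)) x) / n - crossSupport d k) / (1 / 2 - crossSupport d k) := by
  obtain ⟨b, S, p, q, -, hP, hS, hp, hq, hr⟩ := hA
  have he : 1 < Real.exp ε := Real.one_lt_exp_iff.2 hε
  have hdk := eq_mul_of_eq_div hk
  have hd0 : (0 : ℝ) < d := by linarith
  have hd1 : (d : ℝ) - 1 ≠ 0 := by linarith
  have hdn : 0 < d := by exact_mod_cast hd0
  have hp' : ∀ x, ∑ o, A.mech.P o x * supp (S o) x = p := fun x => by
    rw [← hp x, Finset.sum_filter]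
    exact Finset.sum_congr rfl fun o _ => by simp [supp]
  have hq' : ∀ x y, x ≠ y → ∑ o, A.mech.P o y * supp (S o) x = q := fun x y hxy => by
    rw [← hq x y hxy, Finset.sum_filter]
    exact Finset.sum_congr rfl fun o _ => by simp [supp]
  have hcard : ∀ o, ∑ x, supp (S o) x = k := fun o => by
    simp [supp, hS]
  have hPb : ∀ o x, A.mech.P o x = b o + (Real.exp ε - 1) * b o * supp (S o) x := fun o x => by
    rw [hP, supp]
    split_ifs <;> ring
  have hb : 2 * k * Real.exp ε * ∑ o, b o = d := by
    rw [← A.mech.sum_rowSum, Finset.mul_sum]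
    refine Finset.sum_congr rfl fun o _ => ?_
    rw [Mechanism.rowSum, Finset.sum_congr rfl fun x _ => hPb o x, Finset.sum_add_distrib,
      ← Finset.mul_sum, hcard, Finset.sum_const, Finset.card_univ, Fintype.card_fin, nsmul_eq_mul,
      hdk]
    ring
  have hp2 : p = 1 / 2 := by
    have h1 : ∑ x : Fin d, ∑ o, A.mech.P o x * supp (S o) x = k * Real.exp ε * ∑ o, b o := by
      rw [Finset.sum_comm, Finset.mul_sum]
      refine Finset.sum_congr rfl fun o _ => ?_
      have : ∀ x, A.mech.P o x * supp (S o) x = Real.exp ε * b o * supp (S o) x := fun x => by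
        rw [hP, supp]
        split_ifs <;> ring
      rw [Finset.sum_congr rfl fun x _ => this x, ← Finset.mul_sum, hcard]
      ring
    rw [Finset.sum_congr rfl fun x _ => hp' x, Finset.sum_const, Finset.card_univ,
      Fintype.card_fin, nsmul_eq_mul] at h1
    have : (d : ℝ) * p = d * (1 / 2) := by linarith
    exact mul_left_cancel₀ hd0.ne' this
  have hq2 : q = crossSupport d k := by
    let y : Fin d := ⟨0, hdn⟩
    have h1 : ∑ x : Fin d, ∑ o, A.mech.P o y * supp (S o) x = k := by
      rw [Finset.sum_comm]
      simp only [← Finset.mul_sum, hcard, ← Finset.sum_mul, A.mech.sum_eq_one, one_mul]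
    have h2 : ∀ x, ∑ o, A.mech.P o y * supp (S o) x = (if x = y then p - q else 0) + q :=
      fun x => by
        split_ifs with h
        · rw [h, hp']; ring
        · rw [hq' x y h]; ring
    rw [Finset.sum_congr rfl fun x _ => h2 x, Finset.sum_add_distrib, Finset.sum_ite_eq',
      if_pos (Finset.mem_univ _), Finset.sum_const, Finset.card_univ, Fintype.card_fin,
      nsmul_eq_mul] at h1
    rw [crossSupport, eq_div_iff hd1]
    linarith
  refine ⟨S, fun x y => ?_, fun r x => ?_⟩
  · rw [suppProb]
    split_ifs with h
    · rw [← h, hp', hp2]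
    · rw [hq' x y h, hq2]
  · rw [hr, hp2, hq2]
    simp [supp]

/-- The error of an optimal symmetric configuration is a sum of independent centred terms. -/
theorem recon_sub_freq_eq {S : Fin A.m → Finset (Fin d)} (hn : 0 < n)
    (hc : 0 < 1 / 2 - crossSupport d k)
    (hS : ∀ r x, A.recon r x =
      ((∑ i, supp (S (r i)) x) / n - crossSupport d k) / (1 / 2 - crossSupport d k))
    (X : Fin n → Fin d) (r : Fin n → Fin A.m) (x : Fin d) :
    A.recon r x - freq X x = 1 / (n * (1 / 2 - crossSupport d k)) *
      ∑ i, (supp (S (r i)) x - suppProb d k x (X i)) := by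
  have h : ∀ i, suppProb d k x (X i) =
      crossSupport d k + (1 / 2 - crossSupport d k) * (if X i = x then 1 else 0) := fun i => by
    rw [suppProb]
    by_cases hx : X i = x
    · simp [hx]
    · simp [hx, Ne.symm hx]
  rw [hS, freq_eq_sum, Finset.sum_sub_distrib, Finset.sum_congr rfl fun i _ => h i,
    Finset.sum_add_distrib, ← Finset.mul_sum, Finset.sum_const, Finset.card_univ,
    Fintype.card_fin, nsmul_eq_mul]
  generalize 1 / 2 - crossSupport d k = c at *
  field_simp
  ring

theorem sum_mul_supp_sub {S : Fin A.m → Finset (Fin d)}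
    (hS : ∀ x y, ∑ o, A.mech.P o y * supp (S o) x = suppProb d k x y) (x y : Fin d) :
    ∑ o, A.mech.P o y * (supp (S o) x - suppProb d k x y) = 0 := by
  simp only [mul_sub, Finset.sum_sub_distrib, ← Finset.sum_mul, hS, A.mech.sum_eq_one, one_mul,
    sub_self]

theorem sum_mul_supp_sub_sq {S : Fin A.m → Finset (Fin d)}
    (hS : ∀ x y, ∑ o, A.mech.P o y * supp (S o) x = suppProb d k x y) (x y : Fin d) :
    ∑ o, A.mech.P o y * (supp (S o) x - suppProb d k x y) ^ 2 =
      suppProb d k x y * (1 - suppProb d k x y) := by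
  have : ∀ o, A.mech.P o y * (supp (S o) x - suppProb d k x y) ^ 2 =
      (1 - 2 * suppProb d k x y) * (A.mech.P o y * supp (S o) x) +
        suppProb d k x y ^ 2 * A.mech.P o y := fun o => by
    rw [supp]
    split_ifs <;> ring
  rw [Finset.sum_congr rfl fun o _ => this o, Finset.sum_add_distrib, ← Finset.mul_sum,
    ← Finset.mul_sum, hS, A.mech.sum_eq_one]
  ring

theorem IsOSC.unbiasedFreq (hA : A.IsOSC k) (hε : 0 < ε) (hd : Real.exp ε + 1 ≤ d)
    (hk : (k : ℝ) = d / (Real.exp ε + 1)) (hn : 0 < n) : A.UnbiasedFreq := by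
  obtain ⟨S, hS, hr⟩ := hA.exists_support hε hd hk
  intro X x
  have hw : ∀ i, ∑ o, A.mech.P o (X i) = 1 := fun i => A.mech.sum_eq_one _
  have h : ∀ r, A.recon r x = 1 / (n * (1 / 2 - crossSupport d k)) *
      ∑ i, (supp (S (r i)) x - suppProb d k x (X i)) + freq X x := fun r => by
    rw [← recon_sub_freq_eq hn (half_sub_crossSupport_pos hε hd hk) hr X r x]
    ring
  simp only [expect_eq_prodExp, h]
  rw [prodExp_add, prodExp_const hw, prodExp_const_mul,
    prodExp_sum_eval hw (fun i o => supp (S o) x - suppProb d k x (X i))]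
  simp only [sum_mul_supp_sub hS, Finset.sum_const_zero, mul_zero, zero_add]

/-- A user contributes the same variance, summed over `x`, whatever value he holds. Hence the risk
is constant over datasets. -/
theorem IsOSC.expect_sq (hA : A.IsOSC k) (hε : 0 < ε) (hd : Real.exp ε + 1 ≤ d)
    (hk : (k : ℝ) = d / (Real.exp ε + 1)) (hn : 0 < n) (X : Fin n → Fin d) :
    A.expect X (fun r => ∑ x, (A.recon r x - freq X x) ^ 2) = optL2 d n ε := by
  obtain ⟨S, hS, hr⟩ := hA.exists_support hε hd hk
  have hc := half_sub_crossSupport_pos hε hd hk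
  have hw : ∀ i, ∑ o, A.mech.P o (X i) = 1 := fun i => A.mech.sum_eq_one _
  simp only [expect_eq_prodExp, recon_sub_freq_eq hn hc hr X, mul_pow]
  rw [prodExp_sum]
  have h : ∀ x, prodExp (fun i o => A.mech.P o (X i)) (fun r =>
      (1 / (n * (1 / 2 - crossSupport d k))) ^ 2 *
        (∑ i, (supp (S (r i)) x - suppProb d k x (X i))) ^ 2) =
      (1 / (n * (1 / 2 - crossSupport d k))) ^ 2 *
        ∑ i, suppProb d k x (X i) * (1 - suppProb d k x (X i)) := fun x => by
    rw [prodExp_const_mul, prodExp_sum_sq hw (fun i o => supp (S o) x - suppProb d k x (X i))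
      fun i => sum_mul_supp_sub hS x (X i)]
    simp only [sum_mul_supp_sub_sq hS]
  rw [Finset.sum_congr rfl fun x _ => h x, ← Finset.mul_sum, Finset.sum_comm]
  simp only [sum_suppProb_variance, Finset.sum_const, Finset.card_univ, Fintype.card_fin,
    nsmul_eq_mul]
  rw [support_variance_eq hε hd hk hn, ← mul_assoc, ← mul_pow, one_div,
    inv_mul_cancel₀ (by positivity), one_pow, one_mul]

theorem IsOSC.freqL2_eq (hA : A.IsOSC k) (hε : 0 < ε) (hd : Real.exp ε + 1 ≤ d)
    (hk : (k : ℝ) = d / (Real.exp ε + 1)) (hn : 0 < n) : A.freqL2 = optL2 d n ε := by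
  have hd0 : 0 < d := by
    have : (0 : ℝ) < d := by linarith [Real.exp_pos ε]
    exact_mod_cast this
  have : NeZero d := ⟨hd0.ne'⟩
  rw [freqL2]
  simp only [hA.expect_sq hε hd hk hn, ciSup_const]

theorem IsOSC.distL2_eq (hA : A.IsOSC k) (hε : 0 < ε) (hd : Real.exp ε + 1 ≤ d)
    (hk : (k : ℝ) = d / (Real.exp ε + 1)) (hn : 0 < n) :
    A.distL2 = optL2 d n ε + (1 - 1 / (d : ℝ)) / n := by
  have hd' : (0 : ℝ) < d := by linarith [Real.exp_pos ε]
  have hd0 : 0 < d := by exact_mod_cast hd'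
  have hu := hA.unbiasedFreq hε hd hk hn
  refine le_antisymm ?_ ((hu.unbiasedDist hn).le_distL2 hε hd hn)
  have : Nonempty (stdSimplex ℝ (Fin d)) := ⟨⟨_, uniform_mem_stdSimplex hd0⟩⟩
  refine ciSup_le fun θ => ?_
  rw [hu.expectIID_sq hn θ.2]
  simp only [hA.expect_sq hε hd hk hn]
  rw [prodExp_const fun _ => θ.2.2]
  -- The risk depends on `θ` only through the sampling variance, which is largest at the uniform
  -- distribution.
  have h1 : 1 / (d : ℝ) ≤ ∑ x, θ.1 x ^ 2 := by
    have h := Finset.sum_nonneg fun (x : Fin d) (_ : x ∈ univ) => sq_nonneg (θ.1 x - 1 / d)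
    have e : ∀ x, (θ.1 x - 1 / (d : ℝ)) ^ 2 = θ.1 x ^ 2 - 2 / d * θ.1 x + (1 / d) ^ 2 :=
      fun x => by ring
    simp only [e, Finset.sum_add_distrib, Finset.sum_sub_distrib, ← Finset.mul_sum,
      Finset.sum_const, Finset.card_univ, Fintype.card_fin, nsmul_eq_mul] at h
    have h2 : ∑ x, θ.1 x = 1 := θ.2.2
    rw [h2] at h
    have h3 : (d : ℝ) * (1 / d) ^ 2 = 1 / d := by field_simp
    have h4 : 2 / (d : ℝ) * 1 = 1 / d + 1 / d := by ring
    linarith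
  gcongr

/-- The worst-case `L₁` loss of an optimal symmetric configuration, by the Gaussian approximation
and the Cauchy–Schwarz inequality over the values. -/
theorem IsOSC.freqL1_le (hA : A.IsOSC k) (hε : 0 < ε) (hd : Real.exp ε + 1 ≤ d)
    (hk : (k : ℝ) = d / (Real.exp ε + 1)) (hn : 0 < n) {δ : ℝ} (hδ : 0 < δ) :
    A.freqL1 ≤ √(2 / Real.pi) * √(d * optL2 d n ε) +
      d / (n * (1 / 2 - crossSupport d k)) * cltError n 1 δ := by
  have hd' : (0 : ℝ) < d := by linarith [Real.exp_pos ε]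
  have hd0 : 0 < d := by exact_mod_cast hd'
  have : NeZero d := ⟨hd0.ne'⟩
  obtain ⟨S, hS, hr⟩ := hA.exists_support hε hd hk
  have hc := half_sub_crossSupport_pos hε hd hk
  have hq := crossSupport_nonneg hε hd hk
  refine ciSup_le fun X => ?_
  have hw : ∀ i, ∑ o, A.mech.P o (X i) = 1 := fun i => A.mech.sum_eq_one _
  have hw0 : ∀ i o, 0 ≤ A.mech.P o (X i) := fun i o => A.mech.nonneg _ _
  set a := n * (1 / 2 - crossSupport d k) with ha
  have ha0 : 0 < a := by positivity
  simp only [expect_eq_prodExp, recon_sub_freq_eq hn hc hr X, abs_mul,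
    abs_of_pos (by positivity : 0 < 1 / a), ← ha]
  rw [prodExp_sum]
  set v : Fin d → ℝ := fun x => ∑ i, suppProb d k x (X i) * (1 - suppProb d k x (X i)) with hv
  have h1 : ∀ x, prodExp (fun i o => A.mech.P o (X i)) (fun r =>
      1 / a * |∑ i, (supp (S (r i)) x - suppProb d k x (X i))|) ≤
      1 / a * (√(2 / Real.pi) * √(v x) + cltError n 1 δ) := fun x => by
    rw [prodExp_const_mul]
    refine mul_le_mul_of_nonneg_left ?_ (by positivity)
    refine (prodExp_abs_sum_le (w := fun i o => A.mech.P o (X i))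
      (ξ := fun i o => supp (S o) x - suppProb d k x (X i)) zero_le_one hδ hw0 hw
      (fun i => sum_mul_supp_sub hS x (X i)) fun i o => ?_).trans
      (le_of_eq (by simp only [sum_mul_supp_sub_sq hS, hv]))
    have h2 : 0 ≤ suppProb d k x (X i) ∧ suppProb d k x (X i) ≤ 1 := by
      rw [suppProb]
      split_ifs <;> constructor <;> linarith
    rw [supp, abs_le]
    split_ifs <;> constructor <;> linarith [h2.1, h2.2]
  refine (Finset.sum_le_sum fun x _ => h1 x).trans ?_
  rw [← Finset.mul_sum, Finset.sum_add_distrib, ← Finset.mul_sum, Finset.sum_const,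
    Finset.card_univ, Fintype.card_fin, nsmul_eq_mul]
  have hv0 : ∀ x, 0 ≤ v x := fun x => Finset.sum_nonneg fun i _ => by
    rw [suppProb]
    split_ifs
    · norm_num
    · exact mul_nonneg hq (by linarith)
  have hvs : ∑ x, v x = a ^ 2 * optL2 d n ε := by
    simp only [hv]
    rw [Finset.sum_comm]
    simp only [sum_suppProb_variance, Finset.sum_const, Finset.card_univ, Fintype.card_fin,
      nsmul_eq_mul]
    rw [support_variance_eq hε hd hk hn]
  have h3 : ∑ x, √(v x) ≤ a * √(d * optL2 d n ε) := by
    have h4 : (∑ x, √(v x)) ^ 2 ≤ a ^ 2 * (d * optL2 d n ε) := by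
      have := sq_sum_le_card_mul_sum_sq (s := (univ : Finset (Fin d))) (f := fun x => √(v x))
      simp only [Real.sq_sqrt (hv0 _), hvs, Finset.card_univ, Fintype.card_fin] at this
      linarith
    calc ∑ x, √(v x) ≤ √(a ^ 2 * (d * optL2 d n ε)) := Real.le_sqrt_of_sq_le h4
      _ = a * √(d * optL2 d n ε) := by rw [Real.sqrt_mul (by positivity), Real.sqrt_sq ha0.le]
  calc 1 / a * (√(2 / Real.pi) * ∑ x, √(v x) + d * cltError n 1 δ)
      ≤ 1 / a * (√(2 / Real.pi) * (a * √(d * optL2 d n ε)) + d * cltError n 1 δ) := by gcongr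
    _ = _ := by field_simp

end Estimator

/-! ### Existence of optimal symmetric configurations. -/

section Existence

variable {d : ℕ}

/-- The support set of a permutation: the images of the first `k` values. -/
def permSupport (k : ℕ) (σ : Equiv.Perm (Fin d)) : Finset (Fin d) :=
  univ.filter fun x => (σ⁻¹ x).val < k

theorem card_permSupport {k : ℕ} (hk : k ≤ d) (σ : Equiv.Perm (Fin d)) :
    (permSupport k σ).card = k := by
  have : permSupport k σ = (univ.filter fun x : Fin d => x.val < k).map σ.toEmbedding := by
    ext x
    simp only [permSupport, Finset.mem_filter, Finset.mem_univ, true_and, Finset.mem_map,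
      Equiv.coe_toEmbedding]
    constructor
    · intro h
      exact ⟨σ⁻¹ x, h, by simp⟩
    · rintro ⟨y, hy, rfl⟩
      simpa using hy
  rw [this, Finset.card_map, Fin.card_filter_val_lt, min_eq_right hk]

theorem supp_permSupport_mul (k : ℕ) (π σ : Equiv.Perm (Fin d)) (x : Fin d) :
    supp (permSupport k (π * σ)) (π x) = supp (permSupport k σ) x := by
  simp [supp, permSupport]

/-- Double transitivity: one swap takes `x` to `x'`, and a second takes the image of `y` to `y'`
without moving `x'`. -/
theorem exists_perm_pair {x y x' y' : Fin d} (h : x ≠ y) (h' : x' ≠ y') :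
    ∃ π : Equiv.Perm (Fin d), π x = x' ∧ π y = y' := by
  refine ⟨Equiv.swap (Equiv.swap x x' y) y' * Equiv.swap x x', ?_, ?_⟩
  · rw [Equiv.Perm.mul_apply, Equiv.swap_apply_left, Equiv.swap_apply_of_ne_of_ne _ h']
    intro h2
    apply h
    have : Equiv.swap x x' x = Equiv.swap x x' y := by rw [Equiv.swap_apply_left]; exact h2
    exact (Equiv.swap x x').injective this
  · rw [Equiv.Perm.mul_apply, Equiv.swap_apply_left]

/-- Left multiplication by `π` permutes the summation range and carries the pair `(x, y)` to `(x',
y')`. -/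
theorem sum_perm_supp_mul_supp (k : ℕ) {x y x' y' : Fin d} (h : x ≠ y) (h' : x' ≠ y') :
    ∑ σ : Equiv.Perm (Fin d), supp (permSupport k σ) x * supp (permSupport k σ) y =
      ∑ σ : Equiv.Perm (Fin d), supp (permSupport k σ) x' * supp (permSupport k σ) y' := by
  obtain ⟨π, rfl, rfl⟩ := exists_perm_pair h h'
  rw [← Equiv.sum_comp (Equiv.mulLeft π) fun σ => supp (permSupport k σ) (π x) *
    supp (permSupport k σ) (π y)]
  simp only [Equiv.coe_mulLeft, supp_permSupport_mul]

theorem sum_perm_supp (k : ℕ) (x x' : Fin d) :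
    ∑ σ : Equiv.Perm (Fin d), supp (permSupport k σ) x =
      ∑ σ : Equiv.Perm (Fin d), supp (permSupport k σ) x' := by
  rw [← Equiv.sum_comp (Equiv.mulLeft (Equiv.swap x x')) fun σ => supp (permSupport k σ) x']
  refine Finset.sum_congr rfl fun σ _ => ?_
  have h := supp_permSupport_mul k (Equiv.swap x x') σ x
  rw [Equiv.swap_apply_left] at h
  exact h.symm

theorem supp_nonneg (T : Finset (Fin d)) (x : Fin d) : 0 ≤ supp T x := by
  rw [supp]
  split_ifs <;> norm_num

theorem supp_mul_self (T : Finset (Fin d)) (x : Fin d) : supp T x * supp T x = supp T x := by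
  rw [supp]
  split_ifs <;> norm_num

/-- Optimal symmetric configurations exist: all images of a fixed set of `k` values under
permutations serve as support sets. -/
theorem exists_isOSC (n : ℕ) {k : ℕ} {ε : ℝ} (hε : 0 < ε) (hd : 1 < d) (hk : k ≤ d) :
    ∃ A : Estimator d n ε, A.IsOSC k := by
  have he : 1 < Real.exp ε := Real.one_lt_exp_iff.2 hε
  set e := Real.exp ε with hee
  let x₀ : Fin d := ⟨0, by omega⟩
  let x₁ : Fin d := ⟨1, hd⟩
  have h01 : x₀ ≠ x₁ := by simp [x₀, x₁]
  set c := ∑ σ : Equiv.Perm (Fin d), supp (permSupport k σ) x₀ with hc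
  set c₂ := ∑ σ : Equiv.Perm (Fin d), supp (permSupport k σ) x₀ * supp (permSupport k σ) x₁ with hc₂
  have hc0 : 0 ≤ c := Finset.sum_nonneg fun σ _ => supp_nonneg _ _
  set N : ℝ := (Fintype.card (Equiv.Perm (Fin d)) : ℝ) with hN
  have hN0 : 0 < N := by
    rw [hN]
    exact_mod_cast (Fintype.card_pos : 0 < Fintype.card (Equiv.Perm (Fin d)))
  -- The normalisation: every value lies in `c` of the `N` support sets, so each column sums to `b *
  -- (N + (e - 1) * c)`.
  set b : ℝ := 1 / (N + (e - 1) * c) with hb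
  have hbd : 0 < N + (e - 1) * c := by
    have := mul_nonneg (sub_nonneg.2 he.le) hc0
    linarith
  have hb0 : 0 < b := by positivity
  let φ := (Fintype.equivFin (Equiv.Perm (Fin d))).symm
  let S : Fin (Fintype.card (Equiv.Perm (Fin d))) → Finset (Fin d) := fun o => permSupport k (φ o)
  let P : Matrix (Fin (Fintype.card (Equiv.Perm (Fin d)))) (Fin d) ℝ :=
    fun o x => if x ∈ S o then e * b else b
  have hP : ∀ o x, P o x = b + (e - 1) * b * supp (S o) x := fun o x => by
    simp only [P, supp]
    split_ifs <;> ring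
  have hsum : ∀ f : Finset (Fin d) → ℝ, ∑ o, f (S o) = ∑ σ, f (permSupport k σ) := fun f =>
    φ.sum_comp fun σ => f (permSupport k σ)
  have hs1 : ∀ x, ∑ o, supp (S o) x = c := fun x => by
    rw [hsum fun T => supp T x]
    exact sum_perm_supp k x x₀
  have hs2 : ∀ x y, x ≠ y → ∑ o, supp (S o) x * supp (S o) y = c₂ := fun x y hxy => by
    rw [hsum fun T => supp T x * supp T y]
    exact sum_perm_supp_mul_supp k hxy h01
  have hPle : ∀ o x, b ≤ P o x ∧ P o x ≤ e * b := fun o x => by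
    have : b ≤ e * b := by nlinarith
    simp only [P]
    split_ifs <;> constructor <;> linarith
  let M : Mechanism d (Fintype.card (Equiv.Perm (Fin d))) ε :=
    { P := P
      nonneg := fun o x => hb0.le.trans (hPle o x).1
      sum_eq_one := fun x => by
        rw [Finset.sum_congr rfl fun o _ => hP o x, Finset.sum_add_distrib, ← Finset.mul_sum, hs1]
        simp only [Finset.sum_const, Finset.card_univ, Fintype.card_fin, nsmul_eq_mul]
        rw [← hN, hb]
        field_simp
      ldp := fun o x x' => (hPle o x).2.trans (by
        have := (hPle o x').1
        gcongr) }
  have hfil : ∀ x y, ∑ o ∈ univ.filter (fun o => x ∈ S o), P o y =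
      b * ∑ o, supp (S o) x + (e - 1) * b * ∑ o, supp (S o) x * supp (S o) y := fun x y => by
    rw [Finset.sum_filter, Finset.mul_sum, Finset.mul_sum, ← Finset.sum_add_distrib]
    refine Finset.sum_congr rfl fun o _ => ?_
    rw [hP]
    by_cases h : x ∈ S o
    · simp [supp, h]
    · simp [supp, h]
  refine ⟨⟨_, M, fun r x => (((univ.filter (fun i => x ∈ S (r i))).card : ℝ) / n -
    (b * c + (e - 1) * b * c₂)) / (b * c + (e - 1) * b * c - (b * c + (e - 1) * b * c₂))⟩,
    fun _ => b, S, b * c + (e - 1) * b * c, b * c + (e - 1) * b * c₂, fun _ => hb0,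
    fun o x => rfl, fun o => card_permSupport hk _, fun x => ?_, fun x x' h => ?_,
    fun r x => rfl⟩
  · refine (hfil x x).trans ?_
    simp only [supp_mul_self, hs1]
  · refine (hfil x x').trans ?_
    rw [hs1, hs2 x x' h]

end Existence

/-! ### Bayesian lower bounds for estimating counts, for a fixed distribution. -/

/-- The number of occurrences of the value `x` in a list, as a real number. -/
noncomputable def count {ι : Type*} [Fintype ι] {d : ℕ} (X : ι → Fin d) (x : Fin d) : ℝ :=
  ∑ i, if X i = x then 1 else 0

/-- Separates a list of independent pairs into its two lists, so that one list can be summed out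
with the other held fixed. -/
theorem prodExp_pair {ι α β : Type*} [Fintype ι] [DecidableEq ι] [Fintype α] [Fintype β]
    (w : β × α → ℝ) (f : (ι → β) → (ι → α) → ℝ) :
    prodExp (fun _ : ι => w) (fun a => f (fun i => (a i).1) (fun i => (a i).2)) =
      ∑ r : ι → α, ∑ X : ι → β, (∏ i, w (X i, r i)) * f X r := by
  rw [Finset.sum_comm, ← Fintype.sum_prod_type' (fun X r => (∏ i, w (X i, r i)) * f X r),
    ← (Equiv.arrowProdEquivProdArrow ι (fun _ => β) (fun _ => α)).sum_comp]
  rfl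

/-- Terms with vanishing conditional mean given the second components are orthogonal to functions
of the second components. -/
theorem prodExp_mul_sum_eq_zero {ι α β : Type*} [Fintype ι] [DecidableEq ι] [Fintype α]
    [Fintype β] (w h : β × α → ℝ) (hh : ∀ o, ∑ y, w (y, o) * h (y, o) = 0) (g : (ι → α) → ℝ) :
    prodExp (fun _ : ι => w) (fun a => g (fun i => (a i).2) * ∑ i, h (a i)) = 0 := by
  have := prodExp_pair (ι := ι) w fun X r => g r * ∑ i, h (X i, r i)
  refine this.trans (Finset.sum_eq_zero fun r _ => ?_)
  have e : ∀ X : ι → β, (∏ i, w (X i, r i)) * (g r * ∑ i, h (X i, r i)) =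
      ∑ i, g r * ((∏ j, w (X j, r j)) * h (X i, r i)) := fun X => by
    rw [Finset.mul_sum, Finset.mul_sum]
    exact Finset.sum_congr rfl fun i _ => by ring
  simp only [e]
  rw [Finset.sum_comm]
  refine Finset.sum_eq_zero fun i _ => ?_
  rw [← Finset.mul_sum]
  -- For fixed second components the sum over the first ones factorises, and factor `i` vanishes by
  -- `hh`.
  have h2 := prodExp_prod (fun j y => w (y, r j)) (fun j y => if j = i then h (y, r j) else 1)
  simp only [prodExp, Finset.prod_ite_eq', Finset.mem_univ, if_true] at h2
  rw [h2, Finset.prod_eq_zero (Finset.mem_univ i) (by simpa using hh (r i)), mul_zero]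

namespace Mechanism

variable {d m : ℕ} {ε : ℝ} (M : Mechanism d m ε)

/-- The probability of the response `o` on a random input. -/
noncomputable def mix (θ : Fin d → ℝ) (o : Fin m) : ℝ := ∑ y, θ y * M.P o y

/-- The variance of the posterior probability of the value `x`, for the prior `θ`. -/
noncomputable def postVar (θ : Fin d → ℝ) (x : Fin d) : ℝ :=
  ∑ o, (M.P o x * θ x) ^ 2 / M.mix θ o - θ x ^ 2

variable {θ : Fin d → ℝ}

theorem mul_le_mix (hθ : θ ∈ stdSimplex ℝ (Fin d)) (o : Fin m) (x : Fin d) :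
    θ x * M.P o x ≤ M.mix θ o :=
  Finset.single_le_sum (f := fun y => θ y * M.P o y)
    (fun y _ => mul_nonneg (hθ.1 y) (M.nonneg o y)) (Finset.mem_univ x)

theorem le_exp_mul_mix (hθ : θ ∈ stdSimplex ℝ (Fin d)) (o : Fin m) (x : Fin d) :
    M.P o x ≤ Real.exp ε * M.mix θ o := by
  calc M.P o x = ∑ y, θ y * M.P o x := by rw [← Finset.sum_mul, hθ.2, one_mul]
    _ ≤ ∑ y, θ y * (Real.exp ε * M.P o y) := Finset.sum_le_sum fun y _ =>
        mul_le_mul_of_nonneg_left (M.ldp o x y) (hθ.1 y)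
    _ = Real.exp ε * M.mix θ o := by
        rw [mix, Finset.mul_sum]
        exact Finset.sum_congr rfl fun y _ => by ring

theorem sum_mix (hθ : θ ∈ stdSimplex ℝ (Fin d)) : ∑ o, M.mix θ o = 1 := by
  refine Finset.sum_comm.trans ?_
  rw [← hθ.2]
  exact Finset.sum_congr rfl fun y _ => by rw [← Finset.mul_sum, M.sum_eq_one, mul_one]

theorem mix_mul_post (hθ : θ ∈ stdSimplex ℝ (Fin d)) (o : Fin m) (x : Fin d) :
    M.mix θ o * (M.P o x * θ x / M.mix θ o) = M.P o x * θ x := by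
  rcases eq_or_ne (M.mix θ o) 0 with h | h
  · have h1 := M.mul_le_mix hθ o x
    have h2 := mul_nonneg (hθ.1 x) (M.nonneg o x)
    rw [h] at h1 ⊢
    linarith
  · field_simp

/-- A variational lower bound for the mean square error of an arbitrary estimator `g` of the number
of occurrences of `x` in a random list. The quantities `l` and `σ` are free. -/
theorem le_prodExp_count_sub_sq (hθ : θ ∈ stdSimplex ℝ (Fin d)) (B : ℕ) (x : Fin d)
    (g : (Fin B → Fin m) → ℝ) (σ l : ℝ) :
    2 * (1 - l) * prodExp (fun _ : Fin B => θ) (fun X => prodExp (fun i o => M.P o (X i))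
        (fun r => (count X x - g r) * (count X x - B * θ x - σ))) +
      (2 * l - 1) * (B * (θ x * (1 - θ x))) - l ^ 2 * (B * M.postVar θ x) -
        (1 - l) ^ 2 * σ ^ 2 ≤
      prodExp (fun _ : Fin B => θ) (fun X => prodExp (fun i o => M.P o (X i))
        (fun r => (count X x - g r) ^ 2)) := by
  let w : Fin d × Fin m → ℝ := fun a => θ a.1 * M.P a.2 a.1
  have hw0 : ∀ (i : Fin B) a, 0 ≤ w a := fun _ a => mul_nonneg (hθ.1 _) (M.nonneg _ _)
  have hsum : ∀ f : Fin d × Fin m → ℝ, ∑ a, f a = ∑ o, ∑ y, f (y, o) := fun f => by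
    rw [Fintype.sum_prod_type, Finset.sum_comm]
  have hw1 : ∀ i : Fin B, ∑ a, w a = 1 := fun _ => by
    rw [hsum]
    exact M.sum_mix hθ
  have key : ∀ f : (Fin B → Fin d) → (Fin B → Fin m) → ℝ,
      prodExp (fun _ : Fin B => θ) (fun X => prodExp (fun i o => M.P o (X i)) (f X)) =
        prodExp (fun _ : Fin B => w) (fun a => f (fun i => (a i).1) (fun i => (a i).2)) := by
    intro f
    rw [prodExp_pair w f]
    simp only [prodExp, Finset.mul_sum, w, Finset.prod_mul_distrib]
    rw [Finset.sum_comm]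
    exact Finset.sum_congr rfl fun r _ => Finset.sum_congr rfl fun X _ => by ring
  -- `ρ o` is the posterior probability of `x` after response `o`. Hence `k₂` is the conditional
  -- mean of the centred indicator `k₁` given the response, which is the content of `hfib`.
  let ρ : Fin m → ℝ := fun o => M.P o x * θ x / M.mix θ o
  have hρ : ∀ o, M.mix θ o * ρ o = M.P o x * θ x := fun o => M.mix_mul_post hθ o x
  let k₁ : Fin d × Fin m → ℝ := fun a => (if a.1 = x then 1 else 0) - θ x
  let k₂ : Fin d × Fin m → ℝ := fun a => ρ a.2 - θ x
  have hfib : ∀ o, ∑ y, w (y, o) * (k₁ (y, o) - k₂ (y, o)) = 0 := fun o => by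
    have : ∀ y, w (y, o) * (k₁ (y, o) - k₂ (y, o)) =
        (if y = x then θ y * M.P o y else 0) - θ y * M.P o y * ρ o := fun y => by
      simp only [w, k₁, k₂]
      split_ifs <;> ring
    simp only [this, Finset.sum_sub_distrib, ← Finset.sum_mul, Finset.sum_ite_eq',
      Finset.mem_univ, if_true]
    rw [show ∑ y, θ y * M.P o y = M.mix θ o from rfl, hρ]
    ring
  have m₂ : ∑ a, w a * k₂ a = 0 := by
    rw [hsum]
    have : ∀ o, ∑ y, w (y, o) * k₂ (y, o) = M.P o x * θ x - θ x * M.mix θ o := fun o => by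
      simp only [w, k₂, ← Finset.sum_mul]
      rw [show ∑ y, θ y * M.P o y = M.mix θ o from rfl, mul_sub, hρ]
      ring
    simp only [this, Finset.sum_sub_distrib, ← Finset.mul_sum, ← Finset.sum_mul, M.sum_eq_one,
      M.sum_mix hθ]
    ring
  have m₂₂ : ∑ a, w a * (k₂ a * k₂ a) = M.postVar θ x := by
    rw [hsum]
    have : ∀ o, ∑ y, w (y, o) * (k₂ (y, o) * k₂ (y, o)) =
        (M.P o x * θ x) ^ 2 / M.mix θ o - 2 * θ x * (M.P o x * θ x) +
          θ x ^ 2 * M.mix θ o := fun o => by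
      simp only [w, k₂, ← Finset.sum_mul]
      rw [show ∑ y, θ y * M.P o y = M.mix θ o from rfl]
      have e : (M.P o x * θ x) ^ 2 / M.mix θ o = M.mix θ o * ρ o * ρ o := by
        rw [hρ]
        simp only [ρ]
        ring
      rw [e, ← hρ]
      ring
    simp only [this, Finset.sum_add_distrib, Finset.sum_sub_distrib, ← Finset.mul_sum,
      ← Finset.sum_mul, M.sum_eq_one, M.sum_mix hθ, postVar]
    ring
  -- The covariance with a conditional mean is the variance of that conditional mean.
  have m₁₂ : ∑ a, w a * (k₁ a * k₂ a) = M.postVar θ x := by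
    rw [← m₂₂, ← sub_eq_zero, ← Finset.sum_sub_distrib, hsum]
    refine Finset.sum_eq_zero fun o _ => ?_
    have : ∀ y, w (y, o) * (k₁ (y, o) * k₂ (y, o)) - w (y, o) * (k₂ (y, o) * k₂ (y, o)) =
        w (y, o) * (k₁ (y, o) - k₂ (y, o)) * (ρ o - θ x) := fun y => by
      simp only [k₂]
      ring
    simp only [this, ← Finset.sum_mul, hfib, zero_mul]
  have m₁ : ∑ a, w a * k₁ a = 0 := by
    have h : ∑ a, w a * k₁ a - ∑ a, w a * k₂ a = 0 := by
      rw [← Finset.sum_sub_distrib, hsum]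
      refine Finset.sum_eq_zero fun o _ => ?_
      simp only [← mul_sub, hfib]
    rwa [m₂, sub_zero] at h
  have m₁₁ : ∑ a, w a * (k₁ a * k₁ a) = θ x * (1 - θ x) := by
    rw [Fintype.sum_prod_type]
    have : ∀ y, ∑ o, w (y, o) * (k₁ (y, o) * k₁ (y, o)) =
        (if y = x then θ y * (1 - 2 * θ x) else 0) + θ y * θ x ^ 2 := fun y => by
      have e : ∀ o, w (y, o) * (k₁ (y, o) * k₁ (y, o)) =
          θ y * ((if y = x then 1 else 0) - θ x) ^ 2 * M.P o y := fun o => by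
        simp only [w, k₁]
        ring
      rw [Finset.sum_congr rfl fun o _ => e o, ← Finset.mul_sum, M.sum_eq_one]
      split_ifs <;> ring
    simp only [this, Finset.sum_add_distrib, ← Finset.sum_mul, Finset.sum_ite_eq',
      Finset.mem_univ, if_true, hθ.2]
    ring
  rw [key, key]
  let R : (Fin B → Fin d × Fin m) → ℝ := fun a => ∑ i, k₁ (a i)
  let Ψ : (Fin B → Fin d × Fin m) → ℝ := fun a => ∑ i, k₂ (a i)
  let G : (Fin B → Fin d × Fin m) → ℝ := fun a => g (fun i => (a i).2)
  have hcount : ∀ a : Fin B → Fin d × Fin m,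
      count (fun i => (a i).1) x = R a + B * θ x := fun a => by
    simp [R, k₁, count, Finset.sum_sub_distrib]
  simp only [hcount]
  have eR : prodExp (fun _ : Fin B => w) R = 0 := by
    rw [show R = fun a => ∑ i, (fun (_ : Fin B) => k₁) i (a i) from rfl, prodExp_sum_eval hw1]
    simp [m₁]
  have eΨ : prodExp (fun _ : Fin B => w) Ψ = 0 := by
    rw [show Ψ = fun a => ∑ i, (fun (_ : Fin B) => k₂) i (a i) from rfl, prodExp_sum_eval hw1]
    simp [m₂]
  have eRR : prodExp (fun _ : Fin B => w) (fun a => R a * R a) = B * (θ x * (1 - θ x)) := by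
    have := prodExp_sum_mul_sum hw1 (fun _ => k₁) (fun _ => k₁) fun _ => m₁
    refine this.trans ?_
    simp [m₁₁]
  have eRΨ : prodExp (fun _ : Fin B => w) (fun a => R a * Ψ a) = B * M.postVar θ x := by
    have := prodExp_sum_mul_sum hw1 (fun _ => k₁) (fun _ => k₂) fun _ => m₁
    refine this.trans ?_
    simp [m₁₂]
  have eΨΨ : prodExp (fun _ : Fin B => w) (fun a => Ψ a * Ψ a) = B * M.postVar θ x := by
    have := prodExp_sum_mul_sum hw1 (fun _ => k₂) (fun _ => k₂) fun _ => m₂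
    refine this.trans ?_
    simp [m₂₂]
  have eG : prodExp (fun _ : Fin B => w) (fun a => G a * (R a - Ψ a)) = 0 := by
    have := prodExp_mul_sum_eq_zero (ι := Fin B) w (fun a => k₁ a - k₂ a) hfib g
    simpa only [Finset.sum_sub_distrib] using this
  -- `R` is the complete-data score and `Ψ` its projection on the responses. Expanding this square
  -- gives the bound: `G` is orthogonal to `R - Ψ`, and what remains of the estimation error appears
  -- only against `R - σ`, a term that integrates to zero once `σ` is the score of the prior.
  have h0 : 0 ≤ prodExp (fun _ : Fin B => w) (fun a =>
      (R a + B * θ x - G a - (R a - l * Ψ a - (1 - l) * σ)) ^ 2) :=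
    prodExp_nonneg hw0 fun a => sq_nonneg _
  have e : ∀ a, (R a + B * θ x - G a - (R a - l * Ψ a - (1 - l) * σ)) ^ 2 =
      (R a + B * θ x - G a) ^ 2 -
      2 * (1 - l) * ((R a + B * θ x - G a) * (R a + B * θ x - B * θ x - σ)) -
      2 * l * (R a * R a) + 2 * l * (R a * Ψ a) - 2 * l * (B * θ x) * R a +
      2 * l * (B * θ x) * Ψ a + 2 * l * (G a * (R a - Ψ a)) +
      R a * R a - 2 * l * (R a * Ψ a) + l ^ 2 * (Ψ a * Ψ a) -
      2 * (1 - l) * σ * R a + 2 * l * (1 - l) * σ * Ψ a + (1 - l) ^ 2 * σ ^ 2 := fun a => by ring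
  simp only [e] at h0
  have hR' : prodExp (fun _ : Fin B => w) (fun a => R a) = 0 := eR
  have hΨ' : prodExp (fun _ : Fin B => w) (fun a => Ψ a) = 0 := eΨ
  simp only [prodExp_add, prodExp_sub, prodExp_const_mul, hR', hΨ', eRR, eRΨ, eΨΨ, eG,
    prodExp_const hw1] at h0 ⊢
  linarith

/-- Near the uniform distribution, the posterior variance is close to the information. -/
theorem postVar_le (hd : 0 < d) (hε : 0 ≤ ε) (hθ : θ ∈ stdSimplex ℝ (Fin d)) (x : Fin d) :
    M.postVar θ x ≤ M.info x / d + 5 * Real.exp ε * ∑ y, |θ y - 1 / d| := by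
  have he : 1 ≤ Real.exp ε := Real.one_le_exp hε
  have hd' : (0 : ℝ) < d := by exact_mod_cast hd
  have hd1 : (1 : ℝ) ≤ d := by exact_mod_cast hd
  set Δ := ∑ y, |θ y - 1 / (d : ℝ)| with hΔ
  have hΔ0 : 0 ≤ Δ := Finset.sum_nonneg fun _ _ => abs_nonneg _
  have hxΔ : |θ x - 1 / d| ≤ Δ := Finset.single_le_sum (f := fun y => |θ y - 1 / (d : ℝ)|)
    (fun _ _ => abs_nonneg _) (Finset.mem_univ x)
  have hx1 : θ x ≤ 1 := hθ.2 ▸ Finset.single_le_sum (f := θ) (fun y _ => hθ.1 y)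
    (Finset.mem_univ x)
  have hx0 := hθ.1 x
  have hinv : 1 / (d : ℝ) ≤ 1 := by rw [div_le_one hd']; exact hd1
  have hsq : |θ x ^ 2 - (1 / d) ^ 2| ≤ 2 * Δ := by
    rw [sq_sub_sq, abs_mul, abs_of_nonneg (by positivity : 0 ≤ θ x + 1 / d)]
    exact mul_le_mul (by linarith) hxΔ (abs_nonneg _) (by norm_num)
  set e := Real.exp ε
  have h : ∀ o, (M.P o x * θ x) ^ 2 / M.mix θ o ≤
      M.P o x ^ 2 / M.rowSum o / d + 3 * e * Δ * M.P o x := by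
    intro o
    set q := M.mix θ o with hq
    set D := M.rowSum o with hD
    have hP := M.nonneg o x
    set p := M.P o x
    rcases hP.eq_or_lt with h0 | h0
    · rw [← h0]; simp
    have hpq : p ≤ e * q := M.le_exp_mul_mix hθ o x
    have hq0 : 0 < q := by
      by_contra hneg
      nlinarith
    have hD0 : 0 < D := h0.trans_le (M.le_rowSum o x)
    have hDq : D / d - q ≤ D * Δ := by
      have : D / d - q = ∑ y, (1 / d - θ y) * M.P o y := by
        simp only [sub_mul, Finset.sum_sub_distrib, ← Finset.mul_sum]
        rw [hq, hD, mix, rowSum]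
        ring
      rw [this, hΔ, Finset.mul_sum]
      refine Finset.sum_le_sum fun y _ => ?_
      calc (1 / d - θ y) * M.P o y ≤ |θ y - 1 / d| * M.P o y :=
            mul_le_mul_of_nonneg_right (by rw [abs_sub_comm]; exact le_abs_self _) (M.nonneg o y)
        _ ≤ |θ y - 1 / d| * D := mul_le_mul_of_nonneg_left (M.le_rowSum o y) (abs_nonneg _)
        _ = D * |θ y - 1 / d| := mul_comm _ _
    -- Here privacy bounds the likelihood ratio `p / q` by `e^ε`, which makes the error uniform over
    -- all mechanisms.
    have hA : p ^ 2 / q ≤ e * p := by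
      rw [div_le_iff₀ hq0]
      nlinarith
    have hA0 : 0 ≤ p ^ 2 / q := by positivity
    -- Replaces the mixture `q` by its uniform value `D / d`, and `θ x` by `1 / d`. The two
    -- corrections cost `1` and `2` times `e^ε Δ p`; the term `-θ x ^ 2` accounts for the remaining
    -- `2` of the constant `5`.
    have e1 : (p * θ x) ^ 2 / q = p ^ 2 / D / d + p ^ 2 / q * (1 / (d * D)) * (D / d - q) +
        p ^ 2 / q * (θ x ^ 2 - (1 / d) ^ 2) := by
      field_simp
      ring
    have t1 : p ^ 2 / q * (θ x ^ 2 - (1 / d) ^ 2) ≤ e * p * (2 * Δ) :=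
      (mul_le_mul_of_nonneg_left ((le_abs_self _).trans hsq) hA0).trans
        (mul_le_mul_of_nonneg_right hA (by positivity))
    have t2 : p ^ 2 / q * (1 / (d * D)) * (D / d - q) ≤ e * p * Δ := by
      calc p ^ 2 / q * (1 / (d * D)) * (D / d - q) ≤ p ^ 2 / q * (1 / (d * D)) * (D * Δ) :=
            mul_le_mul_of_nonneg_left hDq (by positivity)
        _ = p ^ 2 / q * Δ * (1 / d) := by field_simp
        _ ≤ p ^ 2 / q * Δ * 1 := mul_le_mul_of_nonneg_left hinv (by positivity)
        _ ≤ e * p * Δ := by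
            rw [mul_one]
            exact mul_le_mul_of_nonneg_right hA hΔ0
    rw [e1]
    linarith
  have h2 := Finset.sum_le_sum fun o (_ : o ∈ (univ : Finset (Fin m))) => h o
  rw [Finset.sum_add_distrib, ← Finset.mul_sum, M.sum_eq_one, ← Finset.sum_div] at h2
  have h3 : M.info x / d = (∑ o, M.P o x ^ 2 / M.rowSum o) / d - (1 / d) ^ 2 := by
    rw [info]
    ring
  have h4 : -(θ x ^ 2 - (1 / d) ^ 2) ≤ 2 * Δ := (neg_le_abs _).trans hsq
  rw [postVar, h3]
  nlinarith

end Mechanism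

/-! ### Stein's identity for the standard Gaussian vector. -/

section Stein

open MeasureTheory ProbabilityTheory

theorem hasDerivAt_gaussianPDFReal (t : ℝ) :
    HasDerivAt (gaussianPDFReal 0 1) (-t * gaussianPDFReal 0 1 t) t := by
  have h : HasDerivAt (fun t : ℝ => -t ^ 2 / 2) (-t) t := by
    refine (((hasDerivAt_pow 2 t).neg).div_const 2).congr_deriv ?_
    simp
    ring
  have e : gaussianPDFReal 0 1 = fun t => (√(2 * Real.pi))⁻¹ * Real.exp (-t ^ 2 / 2) := by
    ext t
    simp [gaussianPDFReal]
  rw [e]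
  refine (h.exp.const_mul _).congr_deriv ?_
  ring

theorem integrable_gaussianPDFReal_mul {f : ℝ → ℝ} (hf : Integrable f (gaussianReal 0 1)) :
    Integrable (fun t => gaussianPDFReal 0 1 t * f t) := by
  rw [gaussianReal_of_var_ne_zero _ one_ne_zero,
    integrable_withDensity_iff_integrable_smul' (measurable_gaussianPDF _ _)
      (.of_forall fun _ => gaussianPDF_lt_top)] at hf
  simpa using hf

/-- Stein's identity for a bounded function with bounded derivative. -/
theorem integral_deriv_gaussianReal {f f' : ℝ → ℝ} {C : ℝ} (hf : ∀ t, HasDerivAt f (f' t) t)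
    (hf' : Continuous f') (hC : ∀ t, |f t| ≤ C) (hC' : ∀ t, |f' t| ≤ C) :
    ∫ t, f' t ∂gaussianReal 0 1 = ∫ t, t * f t ∂gaussianReal 0 1 := by
  have hfc : Continuous f := continuous_iff_continuousAt.2 fun t => (hf t).continuousAt
  have i1 : Integrable f (gaussianReal 0 1) :=
    Integrable.of_bound hfc.aestronglyMeasurable C (.of_forall hC)
  have i2 : Integrable f' (gaussianReal 0 1) :=
    Integrable.of_bound hf'.aestronglyMeasurable C (.of_forall hC')
  have i3 : Integrable (fun t => t * f t) (gaussianReal 0 1) :=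
    (integrable_id_gaussianReal 1).mul_bdd hfc.aestronglyMeasurable (.of_forall hC)
  have h := integral_eq_zero_of_hasDerivAt_of_integrable
    (f := fun t => gaussianPDFReal 0 1 t * f t)
    (f' := fun t => gaussianPDFReal 0 1 t * f' t - gaussianPDFReal 0 1 t * (t * f t))
    (fun t => ((hasDerivAt_gaussianPDFReal t).mul (hf t)).congr_deriv (by ring))
    ((integrable_gaussianPDFReal_mul i2).sub (integrable_gaussianPDFReal_mul i3))
    (integrable_gaussianPDFReal_mul i1)
  rw [integral_sub (integrable_gaussianPDFReal_mul i2) (integrable_gaussianPDFReal_mul i3)] at h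
  rw [integral_gaussianReal_eq_integral_smul one_ne_zero,
    integral_gaussianReal_eq_integral_smul one_ne_zero]
  simp only [smul_eq_mul]
  linarith

/-- The standard Gaussian measure on `Fin d → ℝ`. -/
noncomputable def stdNormal (d : ℕ) : Measure (Fin d → ℝ) :=
  Measure.pi fun _ => gaussianReal 0 1

instance (d : ℕ) : IsProbabilityMeasure (stdNormal d) := by
  unfold stdNormal
  infer_instance

theorem integrable_eval_stdNormal {d : ℕ} (x : Fin d) :
    Integrable (fun z : Fin d → ℝ => z x) (stdNormal d) :=
  (measurePreserving_eval (fun _ : Fin d => gaussianReal 0 1) x).integrable_comp_of_integrable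
    (integrable_id_gaussianReal 1)

theorem integrable_eval_sq_stdNormal {d : ℕ} (x : Fin d) :
    Integrable (fun z : Fin d → ℝ => z x ^ 2) (stdNormal d) :=
  (measurePreserving_eval (fun _ : Fin d => gaussianReal 0 1) x).integrable_comp_of_integrable
    (integrable_sq_gaussianReal 1)

theorem integral_eval_sq_stdNormal {d : ℕ} (x : Fin d) : ∫ z, z x ^ 2 ∂stdNormal d = 1 := by
  have h := (measurePreserving_eval (fun _ : Fin d => gaussianReal 0 1) x).map_eq
  have h2 := integral_sq_gaussianReal 1
  rw [← h, integral_map (measurable_pi_apply x).aemeasurable (by fun_prop)] at h2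
  simpa [stdNormal] using h2

/-- Fubini's theorem with coordinate `x` integrated first, so that Stein's identity on the line
applies to it. -/
theorem integral_stdNormal_eq {d : ℕ} (x : Fin (d + 1)) {G : (Fin (d + 1) → ℝ) → ℝ}
    (hG : Integrable G (stdNormal (d + 1))) :
    ∫ z, G z ∂stdNormal (d + 1) =
      ∫ z', ∫ t, G (x.insertNth t z') ∂gaussianReal 0 1 ∂stdNormal d := by
  have mp := (measurePreserving_piFinSuccAbove (fun _ : Fin (d + 1) => gaussianReal 0 1) x).symm
  have e := mp.integral_comp' G
  have i := (mp.integrable_comp_emb (MeasurableEquiv.measurableEmbedding _)).2 hG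
  rw [stdNormal, ← e]
  exact integral_prod_symm _ i

/-- Stein's identity in one coordinate. -/
theorem integral_partial_stdNormal {d : ℕ} (x : Fin d) {F F' : (Fin d → ℝ) → ℝ} {C : ℝ}
    (hF : ∀ z, HasDerivAt (fun t => F (Function.update z x t)) (F' z) (z x))
    (hFc : Continuous F) (hFc' : Continuous F') (hC : ∀ z, |F z| ≤ C) (hC' : ∀ z, |F' z| ≤ C) :
    ∫ z, F' z ∂stdNormal d = ∫ z, z x * F z ∂stdNormal d := by
  obtain _ | d := d
  · exact x.elim0
  have i1 : Integrable F' (stdNormal (d + 1)) :=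
    Integrable.of_bound hFc'.aestronglyMeasurable C (.of_forall hC')
  have i2 : Integrable (fun z => z x * F z) (stdNormal (d + 1)) :=
    (integrable_eval_stdNormal x).mul_bdd hFc.aestronglyMeasurable (.of_forall hC)
  rw [integral_stdNormal_eq x i1, integral_stdNormal_eq x i2]
  congr 1 with z'
  have hins : Continuous fun t : ℝ => (x.insertNth t z' : Fin (d + 1) → ℝ) :=
    Continuous.finInsertNth x continuous_id continuous_const
  refine (integral_deriv_gaussianReal (f := fun t => F (x.insertNth t z'))
    (f' := fun t => F' (x.insertNth t z')) (C := C) (fun t => ?_) (hFc'.comp hins)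
    (fun t => hC _) (fun t => hC' _)).trans (by simp)
  simpa using hF (x.insertNth t z')

end Stein

/-! ### The softmax family of distributions and its score. -/

section Softmax

open MeasureTheory ProbabilityTheory

variable {d : ℕ}

/-- The softmax parametrisation of the simplex. -/
noncomputable def softmax (η : ℝ) (z : Fin d → ℝ) (y : Fin d) : ℝ :=
  Real.exp (η * z y) / ∑ y', Real.exp (η * z y')

theorem sum_exp_pos (hd : 0 < d) (η : ℝ) (z : Fin d → ℝ) : 0 < ∑ y, Real.exp (η * z y) := by
  have : NeZero d := ⟨hd.ne'⟩
  exact Finset.sum_pos (fun y _ => Real.exp_pos _) ⟨0, Finset.mem_univ _⟩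

theorem softmax_mem (hd : 0 < d) (η : ℝ) (z : Fin d → ℝ) :
    softmax η z ∈ stdSimplex ℝ (Fin d) := by
  have h := sum_exp_pos hd η z
  refine ⟨fun y => div_nonneg (Real.exp_pos _).le h.le, ?_⟩
  simp only [softmax]
  rw [← Finset.sum_div, div_self h.ne']

theorem le_one_of_mem_stdSimplex {θ : Fin d → ℝ} (hθ : θ ∈ stdSimplex ℝ (Fin d)) (y : Fin d) :
    θ y ≤ 1 :=
  hθ.2 ▸ Finset.single_le_sum (f := θ) (fun y _ => hθ.1 y) (Finset.mem_univ y)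

theorem continuous_softmax (hd : 0 < d) (η : ℝ) (y : Fin d) :
    Continuous fun z : Fin d → ℝ => softmax η z y := by
  unfold softmax
  exact Continuous.div (by fun_prop) (by fun_prop) fun z => (sum_exp_pos hd η z).ne'

theorem hasDerivAt_softmax (hd : 0 < d) (η : ℝ) (z : Fin d → ℝ) (x y : Fin d) :
    HasDerivAt (fun t => softmax η (Function.update z x t) y)
      (softmax η z y * (η * ((if y = x then 1 else 0) - softmax η z x))) (z x) := by
  have h1 : ∀ y, HasDerivAt (fun t => Real.exp (η * Function.update z x t y))
      (Real.exp (η * z y) * (η * if y = x then 1 else 0)) (z x) := fun y => by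
    by_cases h : y = x
    · subst h
      simpa using ((hasDerivAt_id (z y)).const_mul η).exp
    · simpa [h] using hasDerivAt_const (z x) (Real.exp (η * z y))
  have hs := sum_exp_pos hd η z
  have h2 := HasDerivAt.fun_sum fun y (_ : y ∈ (univ : Finset (Fin d))) => h1 y
  refine ((h1 y).div h2 (by simpa using hs.ne')).congr_deriv ?_
  simp only [Function.update_eq_self, softmax, mul_ite, mul_one, mul_zero, Finset.sum_ite_eq',
    Finset.mem_univ, if_true]
  by_cases h : y = x
  · subst h
    simp only [if_true]
    field_simp
  · simp only [h, if_false]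
    field_simp
    ring

theorem hasDerivAt_prod_softmax (hd : 0 < d) (η : ℝ) {B : ℕ} (X : Fin B → Fin d)
    (z : Fin d → ℝ) (x : Fin d) :
    HasDerivAt (fun t => ∏ i, softmax η (Function.update z x t) (X i))
      (η * ((∏ i, softmax η z (X i)) * (count X x - B * softmax η z x))) (z x) := by
  have h := HasDerivAt.fun_finsetProd fun i (_ : i ∈ (univ : Finset (Fin B))) =>
    hasDerivAt_softmax hd η z x (X i)
  refine h.congr_deriv ?_
  have e : ∀ i, (∏ j ∈ univ.erase i, softmax η z (X j)) •
      (softmax η z (X i) * (η * ((if X i = x then 1 else 0) - softmax η z x))) =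
      η * (∏ j, softmax η z (X j)) * ((if X i = x then 1 else 0) - softmax η z x) := fun i => by
    rw [← Finset.mul_prod_erase univ _ (Finset.mem_univ i), smul_eq_mul]
    ring
  simp only [Function.update_eq_self, e]
  rw [← Finset.mul_sum, Finset.sum_sub_distrib, count]
  simp
  ring

theorem abs_prod_softmax_le (hd : 0 < d) (η : ℝ) {B : ℕ} (X : Fin B → Fin d) (z : Fin d → ℝ) :
    |∏ i, softmax η z (X i)| ≤ 1 := by
  have h := softmax_mem hd η z
  rw [abs_of_nonneg (Finset.prod_nonneg fun i _ => h.1 _)]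
  exact Finset.prod_le_one (fun i _ => h.1 _) fun i _ => le_one_of_mem_stdSimplex h _

theorem continuous_prod_softmax (hd : 0 < d) (η : ℝ) {B : ℕ} (X : Fin B → Fin d) :
    Continuous fun z : Fin d → ℝ => ∏ i, softmax η z (X i) :=
  continuous_finsetProd _ fun i _ => continuous_softmax hd η (X i)

theorem abs_count_sub_le {B : ℕ} (X : Fin B → Fin d) (x : Fin d) {s : ℝ} (h0 : 0 ≤ s)
    (h1 : s ≤ 1) : |count X x - B * s| ≤ B := by
  have e : count X x - B * s = ∑ i, ((if X i = x then 1 else 0) - s) := by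
    rw [count, Finset.sum_sub_distrib]
    simp
  rw [e]
  refine (Finset.abs_sum_le_sum_abs _ _).trans ?_
  calc ∑ i, |(if X i = x then 1 else 0) - s| ≤ ∑ i : Fin B, (1 : ℝ) :=
        Finset.sum_le_sum fun i _ => by
          rw [abs_le]
          split_ifs <;> constructor <;> linarith
    _ = B := by simp

theorem integrable_prod_softmax_mul_score (hd : 0 < d) {η : ℝ} {B : ℕ} (X : Fin B → Fin d)
    (x : Fin d) : Integrable (fun z => (∏ i, softmax η z (X i)) *
      (count X x - B * softmax η z x - z x / η)) (stdNormal d) := by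
  have hb := abs_prod_softmax_le hd η X
  have hc := continuous_prod_softmax hd η X
  have i1 : Integrable (fun z : Fin d → ℝ => count X x - B * softmax η z x) (stdNormal d) :=
    Integrable.of_bound
      (continuous_const.sub (continuous_const.mul (continuous_softmax hd η x))).aestronglyMeasurable
      B (.of_forall fun z => abs_count_sub_le X x ((softmax_mem hd η z).1 x)
        (le_one_of_mem_stdSimplex (softmax_mem hd η z) x))
  exact (i1.sub ((integrable_eval_stdNormal x).div_const η)).bdd_mul hc.aestronglyMeasurable
    (.of_forall hb)

/-- The score of the complete data integrates to zero against the prior. -/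
theorem integral_prod_softmax_mul_score (hd : 0 < d) {η : ℝ} (hη : 0 < η) {B : ℕ}
    (X : Fin B → Fin d) (x : Fin d) :
    ∫ z, (∏ i, softmax η z (X i)) * (count X x - B * softmax η z x - z x / η) ∂stdNormal d = 0 := by
  have hb := abs_prod_softmax_le hd η X
  have hc := continuous_prod_softmax hd η X
  have hcx : Continuous fun z : Fin d → ℝ => count X x - B * softmax η z x :=
    continuous_const.sub (continuous_const.mul (continuous_softmax hd η x))
  have hB : ∀ z : Fin d → ℝ, |count X x - B * softmax η z x| ≤ B := fun z =>
    abs_count_sub_le X x ((softmax_mem hd η z).1 x) (le_one_of_mem_stdSimplex (softmax_mem hd η z) x)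
  have hB2 : ∀ z : Fin d → ℝ,
      |(∏ i, softmax η z (X i)) * (count X x - B * softmax η z x)| ≤ B := fun z => by
    rw [abs_mul]
    calc _ ≤ 1 * (B : ℝ) := mul_le_mul (hb z) (hB z) (abs_nonneg _) zero_le_one
      _ = B := one_mul _
  have h := integral_partial_stdNormal x (C := 1 + η * B)
    (F' := fun z => η * ((∏ i, softmax η z (X i)) * (count X x - B * softmax η z x)))
    (fun z => hasDerivAt_prod_softmax hd η X z x) hc (continuous_const.mul (hc.mul hcx))
    (fun z => (hb z).trans (le_add_of_nonneg_right (by positivity)))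
    (fun z => by
      rw [abs_mul, abs_of_pos hη]
      have := mul_le_mul_of_nonneg_left (hB2 z) hη.le
      linarith)
  have i1 : Integrable (fun z : Fin d → ℝ =>
      (∏ i, softmax η z (X i)) * (count X x - B * softmax η z x)) (stdNormal d) :=
    Integrable.of_bound (hc.mul hcx).aestronglyMeasurable B (.of_forall hB2)
  have i2 : Integrable (fun z : Fin d → ℝ => z x * ∏ i, softmax η z (X i)) (stdNormal d) :=
    (integrable_eval_stdNormal x).mul_bdd hc.aestronglyMeasurable (.of_forall hb)
  have e : ∀ z : Fin d → ℝ, (∏ i, softmax η z (X i)) *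
      (count X x - B * softmax η z x - z x / η) =
      (∏ i, softmax η z (X i)) * (count X x - B * softmax η z x) -
        η⁻¹ * (z x * ∏ i, softmax η z (X i)) := fun z => by ring
  simp only [e]
  rw [integral_sub i1 (i2.const_mul _), integral_const_mul, ← h, integral_const_mul]
  field_simp
  ring

/-- The distance of the softmax parameter from the uniform distribution. -/
noncomputable def softmaxDist (η : ℝ) (z : Fin d → ℝ) : ℝ := ∑ y, |softmax η z y - 1 / d|

theorem continuous_softmaxDist (hd : 0 < d) (η : ℝ) :
    Continuous (softmaxDist η : (Fin d → ℝ) → ℝ) :=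
  continuous_finsetSum _ fun y _ => ((continuous_softmax hd η y).sub continuous_const).abs

theorem softmaxDist_nonneg (η : ℝ) (z : Fin d → ℝ) : 0 ≤ softmaxDist η z :=
  Finset.sum_nonneg fun _ _ => abs_nonneg _

theorem abs_softmaxDist_le (hd : 0 < d) (η : ℝ) (z : Fin d → ℝ) : |softmaxDist η z| ≤ d := by
  have h := softmax_mem hd η z
  have hd1 : (1 : ℝ) ≤ d := by exact_mod_cast hd
  have hinv : 1 / (d : ℝ) ≤ 1 := by rw [div_le_one (by linarith)]; exact hd1
  have hinv0 : 0 ≤ 1 / (d : ℝ) := by positivity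
  rw [abs_of_nonneg (softmaxDist_nonneg η z)]
  calc softmaxDist η z ≤ ∑ y : Fin d, (1 : ℝ) := Finset.sum_le_sum fun y _ => by
        have h1 := h.1 y
        have h2 := le_one_of_mem_stdSimplex h y
        rw [abs_le]
        constructor <;> linarith
    _ = d := by simp

theorem integrable_softmaxDist (hd : 0 < d) (η : ℝ) :
    Integrable (softmaxDist η) (stdNormal d) :=
  Integrable.of_bound (continuous_softmaxDist hd η).aestronglyMeasurable d
    (.of_forall (abs_softmaxDist_le hd η))

/-- At `η = 0` the softmax is uniform, so dominated convergence along `η = 1 / (j + 1)` suffices. -/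
theorem exists_integral_softmaxDist_lt (hd : 0 < d) {κ : ℝ} (hκ : 0 < κ) :
    ∃ η : ℝ, 0 < η ∧ ∫ z, softmaxDist η z ∂stdNormal d < κ := by
  have h : Filter.Tendsto (fun j : ℕ => ∫ z, softmaxDist (1 / ((j : ℝ) + 1)) z ∂stdNormal d)
      Filter.atTop (nhds (∫ _ : Fin d → ℝ, (0 : ℝ) ∂stdNormal d)) := by
    refine tendsto_integral_of_dominated_convergence (fun _ => (d : ℝ))
      (fun j => (continuous_softmaxDist hd _).aestronglyMeasurable) (integrable_const _)
      (fun j => .of_forall fun z => abs_softmaxDist_le hd _ z) (.of_forall fun z => ?_)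
    have hc : Continuous fun η : ℝ => softmaxDist η z := by
      unfold softmaxDist softmax
      exact continuous_finsetSum _ fun y _ => ((Continuous.div (by fun_prop) (by fun_prop)
        fun η => (sum_exp_pos hd η z).ne').sub continuous_const).abs
    have h0 : softmaxDist 0 z = 0 := by simp [softmaxDist, softmax]
    rw [← h0]
    exact (hc.tendsto 0).comp tendsto_one_div_add_atTop_nhds_zero_nat
  rw [integral_zero] at h
  obtain ⟨j, hj⟩ := (h.eventually (gt_mem_nhds hκ)).exists
  exact ⟨1 / ((j : ℝ) + 1), by positivity, hj⟩

end Softmax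

/-! ### The van Trees inequality for the softmax prior. -/

section Prior

open MeasureTheory ProbabilityTheory

variable {d m : ℕ} {ε : ℝ}

/-- The law of a list of `B` values drawn independently from a random distribution near the uniform
one. -/
noncomputable def mixedPrior (η : ℝ) {B : ℕ} (X : Fin B → Fin d) : ℝ :=
  ∫ z, ∏ i, softmax η z (X i) ∂stdNormal d

theorem mixedPrior_nonneg (hd : 0 < d) (η : ℝ) {B : ℕ} (X : Fin B → Fin d) : 0 ≤ mixedPrior η X :=
  integral_nonneg fun z => Finset.prod_nonneg fun _ _ => (softmax_mem hd η z).1 _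

theorem integrable_prod_softmax (hd : 0 < d) (η : ℝ) {B : ℕ} (X : Fin B → Fin d) :
    Integrable (fun z => ∏ i, softmax η z (X i)) (stdNormal d) :=
  Integrable.of_bound (continuous_prod_softmax hd η X).aestronglyMeasurable 1
    (.of_forall (abs_prod_softmax_le hd η X))

theorem sum_mixedPrior_mul (hd : 0 < d) (η : ℝ) {B : ℕ} (f : (Fin B → Fin d) → ℝ) :
    ∑ X, mixedPrior η X * f X = ∫ z, prodExp (fun _ : Fin B => softmax η z) f ∂stdNormal d := by
  simp only [prodExp]
  rw [integral_finsetSum _ fun X _ => (integrable_prod_softmax hd η X).mul_const _]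
  simp only [mixedPrior, integral_mul_const]

theorem sum_mixedPrior (hd : 0 < d) (η : ℝ) (B : ℕ) :
    ∑ X : Fin B → Fin d, mixedPrior η X = 1 := by
  have h := sum_mixedPrior_mul hd η (B := B) fun _ => 1
  simp only [mul_one, prodExp_const fun _ => (softmax_mem hd η _).2] at h
  simpa using h

/-- A van Trees type inequality for the number of occurrences of a value in the list. -/
theorem Mechanism.le_mixedPrior_mse (M : Mechanism d m ε) (hd : 0 < d) (hε : 0 ≤ ε) {η : ℝ}
    (hη : 0 < η) {B : ℕ} (x : Fin d) (g : (Fin B → Fin m) → ℝ) {l : ℝ} (hl : 0 ≤ l) :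
    B * (2 * l * (((d : ℝ) - 1) / d ^ 2 - ∫ z, softmaxDist η z ∂stdNormal d) -
        (((d : ℝ) - 1) / d ^ 2 + ∫ z, softmaxDist η z ∂stdNormal d) -
        l ^ 2 * (M.info x / d + 5 * Real.exp ε * ∫ z, softmaxDist η z ∂stdNormal d)) -
      (1 - l) ^ 2 * (1 / η ^ 2) ≤
      ∑ X, mixedPrior η X * prodExp (fun i o => M.P o (X i)) (fun r => (count X x - g r) ^ 2) := by
  have hd' : (0 : ℝ) < d := by exact_mod_cast hd
  have hd1 : (1 : ℝ) ≤ d := by exact_mod_cast hd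
  have hinv : 1 / (d : ℝ) ≤ 1 := by rw [div_le_one hd']; exact hd1
  have hinv0 : 0 < 1 / (d : ℝ) := by positivity
  rw [sum_mixedPrior_mul hd]
  set c : ℝ := ((d : ℝ) - 1) / d ^ 2 with hc
  set H : (Fin d → ℝ) → ℝ := fun z => prodExp (fun _ : Fin B => softmax η z)
    (fun X => prodExp (fun i o => M.P o (X i))
      (fun r => (count X x - g r) * (count X x - B * softmax η z x - z x / η))) with hH
  -- Given the list `X`, the law of the responses does not involve `z`. The mean error is therefore
  -- a constant factor, and only the score has to be integrated.
  have hHeq : ∀ z, H z = ∑ X : Fin B → Fin d,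
      prodExp (fun i o => M.P o (X i)) (fun r => count X x - g r) *
        ((∏ i, softmax η z (X i)) * (count X x - B * softmax η z x - z x / η)) := fun z => by
    simp only [hH]
    rw [prodExp]
    refine Finset.sum_congr rfl fun X _ => ?_
    simp only [mul_comm (count X x - g _)]
    rw [prodExp_const_mul]
    ring
  have hHint : Integrable H (stdNormal d) := by
    rw [funext hHeq]
    exact integrable_finsetSum _ fun X _ =>
      (integrable_prod_softmax_mul_score hd X x).const_mul _
  have hH0 : ∫ z, H z ∂stdNormal d = 0 := by
    rw [funext hHeq, integral_finsetSum _ fun X _ =>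
      (integrable_prod_softmax_mul_score hd X x).const_mul _]
    refine Finset.sum_eq_zero fun X _ => ?_
    rw [integral_const_mul, integral_prod_softmax_mul_score hd hη, mul_zero]
  -- The variational bound at fixed `z`, with `σ = z x / η` from the prior score and the uniform
  -- values `c` and `info / d` in place of the exact variances.
  have hpt : ∀ z, 2 * (1 - l) * H z + B * (2 * l * c - c - l ^ 2 * (M.info x / d)) -
      B * (2 * l + 1 + l ^ 2 * (5 * Real.exp ε)) * softmaxDist η z -
        (1 - l) ^ 2 / η ^ 2 * z x ^ 2 ≤
      prodExp (fun _ : Fin B => softmax η z) (fun X => prodExp (fun i o => M.P o (X i))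
        (fun r => (count X x - g r) ^ 2)) := fun z => by
    have hθ := softmax_mem hd η z
    refine le_trans ?_ (M.le_prodExp_count_sub_sq hθ B x g (z x / η) l)
    have h1 := M.postVar_le hd hε hθ x
    have h2 : |softmax η z x - 1 / d| ≤ softmaxDist η z :=
      Finset.single_le_sum (f := fun y => |softmax η z y - 1 / (d : ℝ)|)
        (fun _ _ => abs_nonneg _) (Finset.mem_univ x)
    have h3 : |softmax η z x * (1 - softmax η z x) - c| ≤ softmaxDist η z := by
      have e : softmax η z x * (1 - softmax η z x) - c =
          (softmax η z x - 1 / d) * (1 - softmax η z x - 1 / d) := by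
        rw [hc]
        field_simp
        ring
      have h4 := hθ.1 x
      have h5 := le_one_of_mem_stdSimplex hθ x
      rw [e, abs_mul]
      calc _ ≤ |softmax η z x - 1 / d| * 1 := by
            refine mul_le_mul_of_nonneg_left ?_ (abs_nonneg _)
            rw [abs_le]
            constructor <;> linarith
        _ ≤ _ := by rwa [mul_one]
    set V := softmax η z x * (1 - softmax η z x)
    set Δ := softmaxDist η z with hΔ
    have hΔ' : ∑ y, |softmax η z y - 1 / (d : ℝ)| = Δ := rfl
    rw [hΔ'] at h1
    have hB : (0 : ℝ) ≤ B := Nat.cast_nonneg B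
    have h6 : 2 * l * (c - Δ) - (c + Δ) ≤ (2 * l - 1) * V := by
      have := abs_le.1 h3
      nlinarith [this.1, this.2]
    have h7 : l ^ 2 * M.postVar (softmax η z) x ≤
        l ^ 2 * (M.info x / d + 5 * Real.exp ε * Δ) :=
      mul_le_mul_of_nonneg_left h1 (sq_nonneg l)
    have h8 := mul_le_mul_of_nonneg_left (sub_le_sub h6 h7) hB
    have e2 : (1 - l) ^ 2 * (z x / η) ^ 2 = (1 - l) ^ 2 / η ^ 2 * z x ^ 2 := by ring
    rw [e2]
    have e3 : H z = prodExp (fun _ : Fin B => softmax η z) (fun X => prodExp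
      (fun i o => M.P o (X i)) (fun r => (count X x - g r) *
        (count X x - B * softmax η z x - z x / η))) := rfl
    rw [← e3]
    linarith
  have i1 := hHint.const_mul (2 * (1 - l))
  have i2 : Integrable (fun _ : Fin d → ℝ => B * (2 * l * c - c - l ^ 2 * (M.info x / d)))
    (stdNormal d) := integrable_const _
  have i3 := (integrable_softmaxDist hd η).const_mul
    (B * (2 * l + 1 + l ^ 2 * (5 * Real.exp ε)))
  have i4 := (integrable_eval_sq_stdNormal x).const_mul ((1 - l) ^ 2 / η ^ 2)
  have i5 : Integrable (fun z => prodExp (fun _ : Fin B => softmax η z) (fun X => prodExp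
      (fun i o => M.P o (X i)) (fun r => (count X x - g r) ^ 2))) (stdNormal d) :=
    integrable_finsetSum _ fun X _ => (integrable_prod_softmax hd η X).mul_const _
  refine le_trans (le_of_eq ?_) (integral_mono (((i1.add i2).sub i3).sub i4) i5 hpt)
  rw [integral_sub' ((i1.add i2).sub i3) i4, integral_sub' (i1.add i2) i3, integral_add' i1 i2,
    integral_const_mul, hH0]
  have e3 : ∫ z, B * (2 * l + 1 + l ^ 2 * (5 * Real.exp ε)) * softmaxDist η z ∂stdNormal d =
      B * (2 * l + 1 + l ^ 2 * (5 * Real.exp ε)) * ∫ z, softmaxDist η z ∂stdNormal d :=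
    integral_const_mul _ _
  have e4 : ∫ z, (1 - l) ^ 2 / η ^ 2 * z x ^ 2 ∂stdNormal d = (1 - l) ^ 2 / η ^ 2 := by
    rw [integral_const_mul, integral_eval_sq_stdNormal, mul_one]
  rw [e3, e4]
  simp
  ring

theorem Mechanism.info_nonneg (M : Mechanism d m ε) (hd : 0 < d) (x : Fin d) : 0 ≤ M.info x := by
  have hd' : (0 : ℝ) < d := by exact_mod_cast hd
  have h := M.sum_score_sq hd x
  have h2 : 0 ≤ (d : ℝ) * M.info x := h ▸ Finset.sum_nonneg fun o _ =>
    mul_nonneg (div_nonneg (M.rowSum_nonneg o) hd'.le) (sq_nonneg _)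
  exact nonneg_of_mul_nonneg_right h2 (by exact_mod_cast hd)

/-- There is a prior on lists of `B` values for which the mean square error per value of every
estimator of the counts is essentially at least that of an efficient unbiased estimator. -/
theorem exists_prior (hd : 0 < d) (hε : 0 ≤ ε) {κ : ℝ} (hκ : 0 < κ)
    (hκc : κ < ((d : ℝ) - 1) / d ^ 2) :
    ∃ B : ℕ, 0 < B ∧ ∃ π : (Fin B → Fin d) → ℝ, (∀ X, 0 ≤ π X) ∧ ∑ X, π X = 1 ∧
      ∀ (m : ℕ) (M : Mechanism d m ε) (x : Fin d) (g : (Fin B → Fin m) → ℝ),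
        (((d : ℝ) - 1) / d ^ 2 - κ) ^ 2 ≤
          ((∑ X, π X * prodExp (fun i o => M.P o (X i)) (fun r => (count X x - g r) ^ 2)) / B +
            (((d : ℝ) - 1) / d ^ 2 + κ)) * (M.info x / d + κ) := by
  have he : 1 ≤ Real.exp ε := Real.one_le_exp hε
  -- `η` is small enough for the distance from uniform to cost at most `κ / 2`; then `B` is large
  -- enough for the prior term `1 / η ^ 2`, divided by `B`, to cost at most `κ / 2`. Neither depends
  -- on the mechanism.
  obtain ⟨η, hη, hηκ⟩ := exists_integral_softmaxDist_lt hd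
    (by positivity : 0 < κ / (2 * (5 * Real.exp ε)))
  obtain ⟨B, hB⟩ := exists_nat_gt (1 / η ^ 2 * (2 / κ))
  have hB0 : (0 : ℝ) < B := lt_trans (by positivity) hB
  refine ⟨B, by exact_mod_cast hB0, mixedPrior η, mixedPrior_nonneg hd η, sum_mixedPrior hd η B,
    fun m M x g => ?_⟩
  have hd' : (0 : ℝ) < d := by exact_mod_cast hd
  set c : ℝ := ((d : ℝ) - 1) / d ^ 2 with hc
  set D := ∫ z, softmaxDist η z ∂stdNormal d with hD
  set s := M.info x / d with hs
  have hs0 : 0 ≤ s := div_nonneg (M.info_nonneg hd x) hd'.le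
  -- The maximiser of `2 l (c - κ) - (c + κ) - l ^ 2 (s + κ)`.
  set l := (c - κ) / (s + κ) with hl
  have hl0 : 0 ≤ l := div_nonneg (by linarith) (by linarith)
  have h := M.le_mixedPrior_mse hd hε hη x g hl0
  rw [← hc, ← hD, ← hs] at h
  set μ := ∑ X, mixedPrior η X * prodExp (fun i o => M.P o (X i)) (fun r => (count X x - g r) ^ 2)
  have h1 : 5 * Real.exp ε * D ≤ κ / 2 := by
    have := mul_le_mul_of_nonneg_left hηκ.le (by positivity : 0 ≤ 5 * Real.exp ε)
    refine this.trans (le_of_eq ?_)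
    field_simp
  have h2 : D ≤ κ / 2 := by nlinarith
  have h3 : 1 / η ^ 2 / B ≤ κ / 2 := by
    rw [div_le_iff₀ hB0]
    have := mul_le_mul_of_nonneg_right hB.le (by positivity : 0 ≤ κ / 2)
    have e : 1 / η ^ 2 * (2 / κ) * (κ / 2) = 1 / η ^ 2 := by field_simp
    linarith
  have h4 : 2 * l * (c - D) - (c + D) - l ^ 2 * (s + 5 * Real.exp ε * D) -
      (1 - l) ^ 2 * (1 / η ^ 2 / B) ≤ μ / B := by
    rw [le_div_iff₀ hB0]
    refine le_trans (le_of_eq ?_) h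
    field_simp
  have h5 : 2 * l * (c - κ) - (c + κ) - l ^ 2 * (s + κ) ≤ μ / B := by
    refine le_trans ?_ h4
    have t1 : (1 - l) ^ 2 * (1 / η ^ 2 / B) ≤ (1 + l ^ 2) * (κ / 2) :=
      mul_le_mul (by nlinarith) h3 (by positivity) (by positivity)
    have t2 : l ^ 2 * (5 * Real.exp ε * D) ≤ l ^ 2 * (κ / 2) :=
      mul_le_mul_of_nonneg_left h1 (sq_nonneg l)
    have t3 : l * D ≤ l * (κ / 2) := mul_le_mul_of_nonneg_left h2 hl0
    have t4 : 0 ≤ l * κ := mul_nonneg hl0 hκ.le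
    linarith
  have hsκ : 0 < s + κ := by linarith
  have h6 : l * (s + κ) = c - κ := by rw [hl]; field_simp
  have h7 := mul_le_mul_of_nonneg_right h5 hsκ.le
  have e : (2 * l * (c - κ) - (c + κ) - l ^ 2 * (s + κ)) * (s + κ) =
      2 * (l * (s + κ)) * (c - κ) - (c + κ) * (s + κ) - (l * (s + κ)) ^ 2 := by ring
  rw [e, h6] at h7
  nlinarith

end Prior

/-! ### Prediction of sums over independent blocks in mean absolute deviation. -/

section Blocks

variable {𝒳 ℛ : Type*} [Fintype 𝒳] [Fintype ℛ]

/-- The error term of the Gaussian approximation for `J` blocks. -/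
noncomputable def blockError (J : ℕ) (b δ : ℝ) : ℝ :=
  δ + J * (4 * b ^ 2) ^ 2 / δ ^ 3 + cltError J (2 * b) δ

theorem blockError_mono {J J' : ℕ} (h : J ≤ J') {b δ : ℝ} (hb : 0 ≤ b) (hδ : 0 < δ) :
    blockError J b δ ≤ blockError J' b δ := by
  have := gaussThird_nonneg
  unfold blockError cltError
  gcongr

/-- With `w = √|u|`, either `w ≤ s` or `w ≤ w ^ 4 / s ^ 3`. It lets a second moment control a mean
square root. -/
theorem sqrt_abs_le (u : ℝ) {s : ℝ} (hs : 0 < s) : √|u| ≤ s + u ^ 2 / s ^ 3 := by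
  set w := √|u| with hw
  have hu : u ^ 2 = w ^ 4 := by
    rw [← sq_abs, show w ^ 4 = (w ^ 2) ^ 2 by ring, hw, Real.sq_sqrt (abs_nonneg _)]
  rw [hu]
  rcases le_total w s with h | h
  · have : 0 ≤ w ^ 4 / s ^ 3 := by positivity
    linarith
  · have : w ≤ w ^ 4 / s ^ 3 := by
      rw [le_div_iff₀ (by positivity)]
      calc w * s ^ 3 ≤ w * w ^ 3 := by gcongr
        _ = w ^ 4 := by ring
    linarith

theorem sqrt_sub_le_sqrt (T a : ℝ) {s : ℝ} (hs : 0 < s) :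
    √a - (s + (T - a) ^ 2 / s ^ 3) ≤ √T := by
  have h1 : √a ≤ √T + √|T - a| := by
    refine Real.sqrt_le_iff.2 ⟨by positivity, ?_⟩
    have h2 : T ≤ √T ^ 2 := by
      rcases le_total 0 T with h | h
      · rw [Real.sq_sqrt h]
      · exact h.trans (sq_nonneg _)
    have h3 : √|T - a| ^ 2 = |T - a| := Real.sq_sqrt (abs_nonneg _)
    have h4 := neg_abs_le (T - a)
    nlinarith [mul_nonneg (Real.sqrt_nonneg T) (Real.sqrt_nonneg |T - a|)]
  linarith [sqrt_abs_le (T - a) hs]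

/-- The mean square root of a sum of i.i.d. bounded variables. -/
theorem sqrt_mul_sub_le_prodExp_sqrt {w : ℛ → ℝ} (hw : ∀ r, 0 ≤ w r) (hw1 : ∑ r, w r = 1)
    {V : ℛ → ℝ} {b : ℝ} (hV0 : ∀ r, 0 ≤ V r) (hVb : ∀ r, V r ≤ b) (J : ℕ) {s : ℝ} (hs : 0 < s) :
    √(J * ∑ r, w r * V r) - (s + J * b ^ 2 / s ^ 3) ≤
      prodExp (fun _ : Fin J => w) (fun R => √(∑ j, V (R j))) := by
  set v := ∑ r, w r * V r with hv
  have hv0 : 0 ≤ v := Finset.sum_nonneg fun r _ => mul_nonneg (hw r) (hV0 r)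
  have hvb : v ≤ b := by
    calc v ≤ ∑ r, w r * b := Finset.sum_le_sum fun r _ => mul_le_mul_of_nonneg_left (hVb r) (hw r)
      _ = b := by rw [← Finset.sum_mul, hw1, one_mul]
  have h1 : prodExp (fun _ : Fin J => w) (fun R => (∑ j, V (R j) - J * v) ^ 2) ≤ J * b ^ 2 := by
    have h2 := prodExp_sum_sq (w := fun _ : Fin J => w) (fun _ => hw1) (fun _ r => V r - v)
      (fun _ => by
        simp only [mul_sub, Finset.sum_sub_distrib, ← Finset.sum_mul, hw1]
        simp [hv])
    have e : ∀ R : Fin J → ℛ, ∑ j, (V (R j) - v) = ∑ j, V (R j) - J * v := fun R => by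
      simp [Finset.sum_sub_distrib]
    simp only [e] at h2
    rw [h2]
    calc ∑ _j : Fin J, ∑ r, w r * (V r - v) ^ 2 ≤ ∑ _j : Fin J, ∑ r, w r * b ^ 2 :=
          Finset.sum_le_sum fun j _ => Finset.sum_le_sum fun r _ =>
            mul_le_mul_of_nonneg_left (sq_le_sq' (by linarith [hV0 r]) (by linarith [hVb r])) (hw r)
      _ = J * b ^ 2 := by simp [← Finset.sum_mul, hw1]
  have h2 : prodExp (fun _ : Fin J => w)
      (fun R => √(J * v) - (s + 1 / s ^ 3 * (∑ j, V (R j) - J * v) ^ 2)) ≤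
      prodExp (fun _ : Fin J => w) (fun R => √(∑ j, V (R j))) :=
    prodExp_mono (fun _ => hw) fun R => by
      have := sqrt_sub_le_sqrt (∑ j, V (R j)) (J * v) hs
      rwa [div_eq_inv_mul, ← one_div] at this
  rw [prodExp_sub, prodExp_add, prodExp_const (fun _ => hw1), prodExp_const (fun _ => hw1),
    prodExp_const_mul] at h2
  have h3 : 1 / s ^ 3 * prodExp (fun _ : Fin J => w) (fun R => (∑ j, V (R j) - J * v) ^ 2) ≤
      1 / s ^ 3 * (J * b ^ 2) := mul_le_mul_of_nonneg_left h1 (by positivity)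
  have h4 : 1 / s ^ 3 * (J * b ^ 2) = J * b ^ 2 / s ^ 3 := by ring
  linarith

/-- For `J` independent copies of a pair `(X, R)`, no function of the observations `R` predicts the
sum of the `N (X j)` in mean absolute deviation better than a Gaussian computation suggests. -/
theorem exists_predictor_le {π : 𝒳 → ℝ} {K : ℛ → 𝒳 → ℝ} (hπ : ∀ X, 0 ≤ π X) (hπ1 : ∑ X, π X = 1)
    (hK : ∀ R X, 0 ≤ K R X) (hK1 : ∀ X, ∑ R, K R X = 1) {N : 𝒳 → ℝ} {b : ℝ}
    (hN0 : ∀ X, 0 ≤ N X) (hNb : ∀ X, N X ≤ b) :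
    ∃ f : ℛ → ℝ, ∀ (J : ℕ) (g : (Fin J → ℛ) → ℝ) (δ : ℝ), 0 < δ →
      √(2 / Real.pi) * √(J * ∑ X, π X * ∑ R, K R X * (N X - f R) ^ 2) - blockError J b δ ≤
        prodExp (fun _ : Fin J => π) (fun X => prodExp (fun j R => K R (X j))
          (fun R => |∑ j, N (X j) - g R|)) := by
  have hne : Nonempty 𝒳 := by
    by_contra h
    rw [not_nonempty_iff] at h
    simp at hπ1
  obtain ⟨X₀⟩ := hne
  have hb0 : 0 ≤ b := (hN0 X₀).trans (hNb X₀)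
  set pR : ℛ → ℝ := fun R => ∑ X, π X * K R X with hpR
  have hpR0 : ∀ R, 0 ≤ pR R := fun R => Finset.sum_nonneg fun X _ => mul_nonneg (hπ X) (hK R X)
  have hpR1 : ∑ R, pR R = 1 := by
    simp only [hpR]
    rw [Finset.sum_comm]
    simp [← Finset.mul_sum, hK1, hπ1]
  -- The posterior given `R`. For `R` of probability `0` the prior is used, so that `q R` is always
  -- a probability vector.
  set q : ℛ → 𝒳 → ℝ := fun R X => if pR R = 0 then π X else π X * K R X / pR R with hq
  have hq0 : ∀ R X, 0 ≤ q R X := fun R X => by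
    simp only [hq]
    split_ifs
    · exact hπ X
    · exact div_nonneg (mul_nonneg (hπ X) (hK R X)) (hpR0 R)
  have hq1 : ∀ R, ∑ X, q R X = 1 := fun R => by
    by_cases h : pR R = 0
    · simp [hq, h, hπ1]
    · simp only [hq, h, if_false]
      rw [← Finset.sum_div]
      exact div_self h
  have hpq : ∀ R X, π X * K R X = pR R * q R X := fun R X => by
    by_cases h : pR R = 0
    · have h1 : π X * K R X ≤ pR R := Finset.single_le_sum (f := fun X => π X * K R X)
        (fun X _ => mul_nonneg (hπ X) (hK R X)) (Finset.mem_univ X)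
      have h2 := mul_nonneg (hπ X) (hK R X)
      rw [h] at h1 ⊢
      linarith
    · simp only [hq, h, if_false]
      field_simp
  -- The posterior mean centres the summands, and its mean square error is the mean posterior
  -- variance (`hmse`).
  set f : ℛ → ℝ := fun R => ∑ X, q R X * N X with hf
  have hf0 : ∀ R, 0 ≤ f R := fun R => Finset.sum_nonneg fun X _ => mul_nonneg (hq0 R X) (hN0 X)
  have hfb : ∀ R, f R ≤ b := fun R => by
    calc f R ≤ ∑ X, q R X * b := Finset.sum_le_sum fun X _ =>
          mul_le_mul_of_nonneg_left (hNb X) (hq0 R X)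
      _ = b := by rw [← Finset.sum_mul, hq1, one_mul]
  have hξb : ∀ R X, |N X - f R| ≤ 2 * b := fun R X => by
    rw [abs_le]
    constructor <;> linarith [hN0 X, hNb X, hf0 R, hfb R]
  have hξ0 : ∀ R, ∑ X, q R X * (N X - f R) = 0 := fun R => by
    simp only [mul_sub, Finset.sum_sub_distrib, ← Finset.sum_mul, hq1]
    simp [hf]
  set V : ℛ → ℝ := fun R => ∑ X, q R X * (N X - f R) ^ 2 with hV
  have hV0 : ∀ R, 0 ≤ V R := fun R => Finset.sum_nonneg fun X _ =>
    mul_nonneg (hq0 R X) (sq_nonneg _)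
  have hVb : ∀ R, V R ≤ 4 * b ^ 2 := fun R => by
    calc V R ≤ ∑ X, q R X * (4 * b ^ 2) := Finset.sum_le_sum fun X _ => by
          refine mul_le_mul_of_nonneg_left ?_ (hq0 R X)
          have := sq_le_sq.2 ((hξb R X).trans (le_abs_self _))
          linarith
      _ = 4 * b ^ 2 := by rw [← Finset.sum_mul, hq1, one_mul]
  have hmse : ∑ X, π X * ∑ R, K R X * (N X - f R) ^ 2 = ∑ R, pR R * V R := by
    simp only [hV, Finset.mul_sum]
    rw [Finset.sum_comm]
    refine Finset.sum_congr rfl fun R _ => Finset.sum_congr rfl fun X _ => ?_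
    rw [← mul_assoc, hpq]
    ring
  refine ⟨f, fun J g δ hδ => ?_⟩
  rw [hmse]
  -- Bayes' rule, block by block: given the responses, the blocks are still independent, each with
  -- its posterior.
  have hswap : prodExp (fun _ : Fin J => π) (fun X => prodExp (fun j R => K R (X j))
      (fun R => |∑ j, N (X j) - g R|)) =
      prodExp (fun _ : Fin J => pR) (fun R => prodExp (fun j => q (R j))
        (fun X => |∑ j, N (X j) - g R|)) := by
    simp only [prodExp, Finset.mul_sum]
    rw [Finset.sum_comm]
    refine Finset.sum_congr rfl fun R _ => Finset.sum_congr rfl fun X _ => ?_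
    rw [← mul_assoc, ← mul_assoc, ← Finset.prod_mul_distrib, ← Finset.prod_mul_distrib]
    simp only [hpq]
  rw [hswap]
  have hin : ∀ R : Fin J → ℛ, √(2 / Real.pi) * √(∑ j, V (R j)) - cltError J (2 * b) δ ≤
      prodExp (fun j => q (R j)) (fun X => |∑ j, N (X j) - g R|) := fun R => by
    -- For fixed `R` the predictor is a constant, so it only shifts the centre, and the Gaussian
    -- bound holds for every shift.
    have h := le_prodExp_abs_sum (w := fun j => q (R j)) (ξ := fun j X => N X - f (R j))
      (b := 2 * b) (by positivity) hδ (fun j X => hq0 _ X) (fun j => hq1 _) (fun j => hξ0 _)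
      (fun j X => hξb _ X) (∑ j, f (R j) - g R)
    refine h.trans (le_of_eq ?_)
    congr 1
    ext X
    rw [Finset.sum_sub_distrib]
    congr 1
    ring
  have hout := sqrt_mul_sub_le_prodExp_sqrt hpR0 hpR1 hV0 hVb J hδ
  have h2π : √(2 / Real.pi) ≤ 1 := by
    refine Real.sqrt_le_one.2 ?_
    rw [div_le_one Real.pi_pos]
    exact Real.two_le_pi
  have h2π0 : 0 ≤ √(2 / Real.pi) := Real.sqrt_nonneg _
  have h3 := prodExp_mono (w := fun _ : Fin J => pR) (fun _ => hpR0) hin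
  rw [prodExp_sub, prodExp_const_mul, prodExp_const fun _ => hpR1] at h3
  refine le_trans ?_ h3
  have h5 : 0 ≤ δ + J * (4 * b ^ 2) ^ 2 / δ ^ 3 := by positivity
  rw [blockError]
  nlinarith

end Blocks

/-! ### Regrouping the users of a product expectation. -/

section Reindexing

variable {ι κ α : Type*} [Fintype ι] [DecidableEq ι] [Fintype κ] [DecidableEq κ] [Fintype α]

theorem prodExp_equiv (e : ι ≃ κ) (w : ι → α → ℝ) (f : (ι → α) → ℝ) :
    prodExp w f = prodExp (fun k => w (e.symm k)) (fun a => f (fun i => a (e i))) := by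
  simp only [prodExp]
  rw [← (Equiv.arrowCongr e (Equiv.refl α)).sum_comp]
  refine Finset.sum_congr rfl fun a _ => ?_
  congr 1
  · rw [← e.symm.prod_comp]
    simp [Equiv.arrowCongr]
  · congr 1
    ext i
    simp [Equiv.arrowCongr]

theorem prodExp_sumType (w : ι ⊕ κ → α → ℝ) (f : (ι ⊕ κ → α) → ℝ) :
    prodExp w f = prodExp (fun i => w (.inl i)) (fun a =>
      prodExp (fun k => w (.inr k)) (fun c => f (Sum.elim a c))) := by
  simp only [prodExp, Finset.mul_sum]
  rw [← (Equiv.sumArrowEquivProdArrow ι κ α).symm.sum_comp, Fintype.sum_prod_type]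
  refine Finset.sum_congr rfl fun a _ => Finset.sum_congr rfl fun c _ => ?_
  rw [Fintype.prod_sum_type, ← mul_assoc]
  rfl

theorem prodExp_prodType (w : ι × κ → α → ℝ) (f : (ι × κ → α) → ℝ) :
    prodExp w f = prodExp (fun i (a : κ → α) => ∏ k, w (i, k) (a k))
      (fun a => f (fun p => a p.1 p.2)) := by
  simp only [prodExp]
  rw [← (Equiv.curry ι κ α).symm.sum_comp]
  refine Finset.sum_congr rfl fun a _ => ?_
  rw [Fintype.prod_prod_type]
  rfl

theorem prodExp_comm {β : Type*} [Fintype β] (w : ι → α → ℝ) (v : κ → β → ℝ)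
    (f : (ι → α) → (κ → β) → ℝ) :
    prodExp w (fun a => prodExp v (f a)) = prodExp v (fun c => prodExp w (fun a => f a c)) := by
  simp only [prodExp, Finset.mul_sum]
  rw [Finset.sum_comm]
  exact Finset.sum_congr rfl fun a _ => Finset.sum_congr rfl fun c _ => by ring

end Reindexing

/-! ### Reduction of the worst-case `L₁` loss to one block. -/

namespace Estimator

variable {d n : ℕ} {ε : ℝ}

/-- A lower bound for the worst-case `L₁` loss of an arbitrary estimator, from a prior under which
the users fall into `J` independent blocks of `B` users and a remainder. -/
theorem exists_mse_le_freqL1 (A : Estimator d n ε) (hd : 0 < d) (hn : 0 < n) {B : ℕ}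
    {π : (Fin B → Fin d) → ℝ} (hπ : ∀ X, 0 ≤ π X) (hπ1 : ∑ X, π X = 1) :
    ∃ f : Fin d → (Fin B → Fin A.m) → ℝ, ∀ δ > 0,
      ∑ x, (√(2 / Real.pi) * √((n / B : ℕ) * ∑ X, π X *
        prodExp (fun i o => A.mech.P o (X i)) (fun r => (count X x - f x r) ^ 2)) -
          blockError (n / B) B δ) ≤ n * A.freqL1 := by
  set J := n / B with hJ
  set ρ := n % B with hρ
  have hnJ : n = J * B + ρ := (Nat.div_add_mod' n B).symm
  have hn' : (0 : ℝ) < n := by exact_mod_cast hn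
  let e : Fin n ≃ (Fin J × Fin B) ⊕ Fin ρ :=
    (finCongr hnJ).trans (finSumFinEquiv.symm.trans
      (Equiv.sumCongr finProdFinEquiv.symm (Equiv.refl _)))
  let x₀ : Fin d := ⟨0, hd⟩
  let K : (Fin B → Fin A.m) → (Fin B → Fin d) → ℝ := fun R X => ∏ i, A.mech.P (R i) (X i)
  have hK : ∀ R X, 0 ≤ K R X := fun R X => Finset.prod_nonneg fun i _ => A.mech.nonneg _ _
  have hKexp : ∀ X (h : (Fin B → Fin A.m) → ℝ), ∑ R, K R X * h R =
      prodExp (fun i o => A.mech.P o (X i)) h := fun X h => rfl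
  have hK1 : ∀ X, ∑ R, K R X = 1 := fun X => by
    have := prodExp_const (w := fun i o => A.mech.P o (X i)) (fun i => A.mech.sum_eq_one _) 1
    rw [← hKexp] at this
    simpa using this
  have hc0 : ∀ x (X : Fin B → Fin d), 0 ≤ count X x := fun x X =>
    Finset.sum_nonneg fun i _ => by split_ifs <;> norm_num
  have hcB : ∀ x (X : Fin B → Fin d), count X x ≤ B := fun x X => by
    calc count X x ≤ ∑ i : Fin B, (1 : ℝ) :=
          Finset.sum_le_sum fun i _ => by split_ifs <;> norm_num
      _ = B := by simp
  choose f hf using fun x => exists_predictor_le (N := fun X => count X x) hπ hπ1 hK hK1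
    (hc0 x) (hcB x)
  refine ⟨f, fun δ hδ => ?_⟩
  -- The `ρ` users left over after `J` full blocks all hold `x₀`.
  let D : (Fin J → Fin B → Fin d) → Fin n → Fin d := fun Y i =>
    Sum.elim (fun p : Fin J × Fin B => Y p.1 p.2) (fun _ => x₀) (e i)
  let G : (Fin J → Fin B → Fin A.m) → (Fin ρ → Fin A.m) → Fin n → Fin A.m := fun R c i =>
    Sum.elim (fun p : Fin J × Fin B => R p.1 p.2) c (e i)
  have hexp : ∀ Y (h : (Fin n → Fin A.m) → ℝ), A.expect (D Y) h =
      prodExp (fun j R => K R (Y j)) (fun R =>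
        prodExp (fun (_ : Fin ρ) o => A.mech.P o x₀) (fun c => h (G R c))) := fun Y h => by
    rw [expect_eq_prodExp, prodExp_equiv e, prodExp_sumType, prodExp_prodType]
    simp only [D, Equiv.apply_symm_apply, Sum.elim_inl, Sum.elim_inr]
    rfl
  have hfreq : ∀ Y x, (n : ℝ) * freq (D Y) x =
      ∑ j, count (Y j) x + ∑ _t : Fin ρ, (if x₀ = x then 1 else 0) := fun Y x => by
    rw [freq_eq_sum, mul_div_cancel₀ _ hn'.ne', ← e.symm.sum_comp]
    simp only [D, Equiv.apply_symm_apply, Fintype.sum_sum_type, Sum.elim_inl, Sum.elim_inr,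
      Fintype.sum_prod_type, count]
    rfl
  have hprior : prodExp (fun _ : Fin J => π) (fun Y =>
      A.expect (D Y) (fun r => ∑ x, |A.recon r x - freq (D Y) x|)) ≤ A.freqL1 := by
    rw [← prodExp_const (w := fun _ : Fin J => π) (fun _ => hπ1) A.freqL1]
    exact prodExp_mono (fun _ => hπ) fun Y => A.le_freqL1 _
  refine le_trans ?_ (mul_le_mul_of_nonneg_left hprior hn'.le)
  simp only [expect_eq_prodExp, prodExp_sum]
  rw [Finset.mul_sum]
  refine Finset.sum_le_sum fun x _ => ?_
  generalize hL : √(2 / Real.pi) * √((J : ℝ) * _) - blockError J B δ = L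
  simp only [← expect_eq_prodExp, hexp]
  rw [← prodExp_const_mul]
  simp only [← prodExp_const_mul]
  set const : ℝ := ∑ _t : Fin ρ, (if x₀ = x then 1 else 0) with hconst
  -- For fixed responses `c` of the remaining users, the estimate becomes a predictor of the sum of
  -- the block counts. The predictor bound is then averaged over `c`.
  have hterm : ∀ Y R c, (n : ℝ) * |A.recon (G R c) x - freq (D Y) x| =
      |∑ j, count (Y j) x - (n * A.recon (G R c) x - const)| := fun Y R c => by
    rw [← abs_of_pos hn', ← abs_mul, abs_of_pos hn', mul_sub, hfreq, ← hconst, abs_sub_comm]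
    congr 1
    ring
  simp only [hterm]
  have hcomm : ∀ Y : Fin J → Fin B → Fin d, prodExp (fun j R => K R (Y j)) (fun R =>
      prodExp (fun (_ : Fin ρ) o => A.mech.P o x₀)
        (fun c => |∑ j, count (Y j) x - (n * A.recon (G R c) x - const)|)) =
      prodExp (fun (_ : Fin ρ) o => A.mech.P o x₀) (fun c => prodExp (fun j R => K R (Y j))
        (fun R => |∑ j, count (Y j) x - (n * A.recon (G R c) x - const)|)) := fun Y =>
    prodExp_comm _ _ _
  simp only [hcomm]
  rw [prodExp_comm]
  have hlast := prodExp_mono (w := fun (_ : Fin ρ) o => A.mech.P o x₀)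
    (fun _ o => A.mech.nonneg _ _) fun c : Fin ρ → Fin A.m =>
      hf x J (fun R => n * A.recon (G R c) x - const) δ hδ
  rw [prodExp_const fun _ => A.mech.sum_eq_one _] at hlast
  rw [← hL]
  exact hlast

end Estimator

/-! ### Asymptotics of the optimal `L₁` loss. -/

section Asymptotics

open Filter Topology

/-- The optimal `L₂` loss for a single user. -/
noncomputable def optConst (d : ℕ) (ε : ℝ) : ℝ :=
  ((d : ℝ) - 1) * (4 * d * Real.exp ε - (Real.exp ε + 1) ^ 2) / (d * (Real.exp ε - 1) ^ 2)

theorem optL2_eq (d n : ℕ) (ε : ℝ) : optL2 d n ε = optConst d ε / n := by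
  rw [optL2, optConst, div_div]
  ring_nf

/-- The limit of the optimal `L₁` loss times the square root of the number of users. -/
noncomputable def limitL1 (d : ℕ) (ε : ℝ) : ℝ := √(2 / Real.pi) * √(d * optConst d ε)

/-- It ensures the condition `c ≤ y₁ ^ 2` of `tangent_le` at the optimal point, with room for a
small perturbation. -/
theorem lt_optConst_div {d : ℕ} {ε : ℝ} (hε : 0 < ε) (hd : Real.exp ε + 1 ≤ d) :
    ((d : ℝ) - 1) / d ^ 2 < optConst d ε / d := by
  have he : 1 < Real.exp ε := Real.one_lt_exp_iff.2 hε
  have hd0 : (0 : ℝ) < d := by linarith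
  have hd1 : (0 : ℝ) < d - 1 := by linarith
  rw [optConst]
  generalize Real.exp ε = e at *
  have h1 : 1 < (4 * d * e - (e + 1) ^ 2) / (e - 1) ^ 2 := by
    rw [one_lt_div (by positivity)]
    nlinarith
  have h2 : ((d : ℝ) - 1) * (4 * d * e - (e + 1) ^ 2) / (d * (e - 1) ^ 2) / d =
      (d - 1) / d ^ 2 * ((4 * d * e - (e + 1) ^ 2) / (e - 1) ^ 2) := by
    field_simp
  rw [h2]
  exact lt_mul_of_one_lt_right (by positivity) h1

theorem limitL1_pos {d : ℕ} {ε : ℝ} (hε : 0 < ε) (hd : Real.exp ε + 1 ≤ d) :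
    0 < limitL1 d ε := by
  have he : 1 < Real.exp ε := Real.one_lt_exp_iff.2 hε
  have hd0 : (0 : ℝ) < d := by linarith
  have h := lt_optConst_div hε hd
  have h2 : 0 < ((d : ℝ) - 1) / d ^ 2 := div_pos (by linarith) (by positivity)
  have h3 : 0 < optConst d ε := by
    have := h2.trans h
    rwa [div_pos_iff_of_pos_right hd0] at this
  have := Real.pi_pos
  rw [limitL1]
  positivity

theorem sqrt_two_mul_optL2 {d n : ℕ} {ε : ℝ} :
    √(2 * d / Real.pi * optL2 d n ε) = limitL1 d ε / √n := by
  rw [optL2_eq, limitL1, ← Real.sqrt_mul (by have := Real.pi_pos; positivity),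
    ← Real.sqrt_div' _ (Nat.cast_nonneg n)]
  congr 1
  ring

theorem isEquivalent_limitL1 {d : ℕ} {ε : ℝ} (hε : 0 < ε) (hd : Real.exp ε + 1 ≤ d) {a : ℕ → ℝ}
    (hlo : ∀ κ > 0, ∀ᶠ n : ℕ in atTop, limitL1 d ε - κ ≤ √n * a n)
    (hup : ∀ κ > 0, ∀ᶠ n : ℕ in atTop, √n * a n ≤ limitL1 d ε + κ) :
    Asymptotics.IsEquivalent atTop a
      (fun n : ℕ => √(2 * d / Real.pi * optL2 d n ε)) := by
  have hL := limitL1_pos hε hd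
  have ht : Tendsto (fun n : ℕ => √n * a n) atTop (𝓝 (limitL1 d ε)) := by
    rw [Metric.tendsto_nhds]
    intro κ hκ
    filter_upwards [hlo (κ / 2) (by positivity), hup (κ / 2) (by positivity)] with n h1 h2
    rw [Real.dist_eq, abs_lt]
    constructor <;> linarith
  have ht2 := ht.div_const (limitL1 d ε)
  rw [div_self hL.ne'] at ht2
  refine Asymptotics.isEquivalent_of_tendsto_one (ht2.congr fun n => ?_)
  rw [Pi.div_apply, sqrt_two_mul_optL2, div_div_eq_mul_div, mul_comm]

/-- The eighth root of the number of users, used as a scale for smoothing. -/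
noncomputable def scale (n : ℕ) : ℝ := (n : ℝ) ^ (1 / 8 : ℝ)

theorem scale_pow (n : ℕ) : scale n ^ 8 = n := by
  rw [scale, ← Real.rpow_natCast, ← Real.rpow_mul (Nat.cast_nonneg n)]
  norm_num

theorem scale_pos {n : ℕ} (hn : 0 < n) : 0 < scale n :=
  Real.rpow_pos_of_pos (by exact_mod_cast hn) _

theorem sqrt_eq_scale_pow (n : ℕ) : √(n : ℝ) = scale n ^ 4 := by
  rw [← scale_pow n, show scale n ^ 8 = (scale n ^ 4) ^ 2 by ring, Real.sqrt_sq (by positivity)]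

theorem tendsto_scale_inv : Tendsto (fun n : ℕ => (scale n)⁻¹) atTop (𝓝 0) :=
  tendsto_inv_atTop_zero.comp
    ((tendsto_rpow_atTop (by norm_num)).comp tendsto_natCast_atTop_atTop)

/-- With `δ = n^(3/8)` both the smoothing error `δ` and the exchange error of order `n / δ ^ 2` are
`o(√n)`; any exponent strictly between `1/4` and `1/2` would do. -/
theorem cltError_scale_div {n : ℕ} (hn : 0 < n) (b : ℝ) :
    cltError n b (scale n ^ 3) / √n =
      (scale n)⁻¹ + 3 * b ^ 3 * (1 + gaussThird) * (scale n)⁻¹ ^ 2 := by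
  have h := scale_pos hn
  rw [cltError, sqrt_eq_scale_pow, ← scale_pow n]
  field_simp

theorem blockError_scale_div {n : ℕ} (hn : 0 < n) (b : ℝ) :
    blockError n b (scale n ^ 3) / √n =
      (scale n)⁻¹ + (4 * b ^ 2) ^ 2 * (scale n)⁻¹ ^ 5 +
        ((scale n)⁻¹ + 3 * (2 * b) ^ 3 * (1 + gaussThird) * (scale n)⁻¹ ^ 2) := by
  rw [← cltError_scale_div hn, blockError, add_div]
  congr 1
  rw [sqrt_eq_scale_pow, ← scale_pow n]
  field_simp

theorem tendsto_cltError (b : ℝ) :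
    Tendsto (fun n : ℕ => cltError n b (scale n ^ 3) / √n) atTop (𝓝 0) := by
  have h := tendsto_scale_inv.add ((tendsto_scale_inv.pow 2).const_mul
    (3 * b ^ 3 * (1 + gaussThird)))
  simp only [ne_eq, OfNat.ofNat_ne_zero, not_false_eq_true, zero_pow, mul_zero, add_zero] at h
  refine h.congr' ?_
  filter_upwards [eventually_gt_atTop 0] with n hn
  exact (cltError_scale_div hn b).symm

theorem tendsto_blockError (b : ℝ) :
    Tendsto (fun n : ℕ => blockError n b (scale n ^ 3) / √n) atTop (𝓝 0) := by
  have h := (tendsto_scale_inv.add ((tendsto_scale_inv.pow 5).const_mul ((4 * b ^ 2) ^ 2))).add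
    (tendsto_scale_inv.add ((tendsto_scale_inv.pow 2).const_mul
      (3 * (2 * b) ^ 3 * (1 + gaussThird))))
  simp only [ne_eq, OfNat.ofNat_ne_zero, not_false_eq_true, zero_pow, mul_zero, add_zero] at h
  refine h.congr' ?_
  filter_upwards [eventually_gt_atTop 0] with n hn
  exact (blockError_scale_div hn b).symm

theorem eventually_sqrt_mul_freqL1_le {d k : ℕ} {ε : ℝ} (hε : 0 < ε) (hd : Real.exp ε + 1 ≤ d)
    (hk : (k : ℝ) = d / (Real.exp ε + 1)) {κ : ℝ} (hκ : 0 < κ) :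
    ∀ᶠ n : ℕ in atTop, ∀ A : Estimator d n ε, A.IsOSC k → √n * A.freqL1 ≤ limitL1 d ε + κ := by
  have h := (tendsto_cltError 1).const_mul (d / (1 / 2 - crossSupport d k))
  rw [mul_zero] at h
  filter_upwards [eventually_gt_atTop 0, h.eventually (gt_mem_nhds hκ)] with n hn hnκ A hA
  have hn' : (0 : ℝ) < n := by exact_mod_cast hn
  have hs : 0 < √(n : ℝ) := Real.sqrt_pos.2 hn'
  have h1 := hA.freqL1_le hε hd hk hn (pow_pos (scale_pos hn) 3)
  have h2 := mul_le_mul_of_nonneg_left h1 hs.le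
  refine h2.trans ?_
  have e1 : √(n : ℝ) * (√(2 / Real.pi) * √(d * optL2 d n ε)) = limitL1 d ε := by
    rw [optL2_eq, limitL1, ← mul_div_assoc, Real.sqrt_div' _ hn'.le]
    field_simp
  have e2 : √(n : ℝ) * (d / (n * (1 / 2 - crossSupport d k)) * cltError n 1 (scale n ^ 3)) =
      d / (1 / 2 - crossSupport d k) * (cltError n 1 (scale n ^ 3) / √n) := by
    have h3 : (n : ℝ) = √n * √n := (Real.mul_self_sqrt hn'.le).symm
    generalize cltError n 1 (scale n ^ 3) = E
    generalize 1 / 2 - crossSupport d k = c at *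
    rw [eq_comm, ← sub_eq_zero]
    have h4 : d / (n * c) = d / c / (√(n : ℝ) * √n) := by rw [← h3]; field_simp
    rw [h4]
    field_simp
    ring
  rw [mul_add, e1, e2]
  linarith

/-- A tangent line bound for the curve `(y ^ 2 + c) * s = a`. -/
theorem tangent_le {y s y₁ s₁ a c : ℝ} (hs₁ : 0 < s₁) (hy : 0 ≤ y) (hy₁ : 0 < y₁)
    (hc : 0 < c) (h : a ≤ (y ^ 2 + c) * s) (h₁ : (y₁ ^ 2 + c) * s₁ = a) (hyc : c ≤ y₁ ^ 2) :
    y₁ - (y₁ ^ 2 + c) / (2 * s₁ * y₁) * (s - s₁) ≤ y := by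
  have h2 : s₁ * (y₁ ^ 2 - y ^ 2) / (y ^ 2 + c) ≤ s - s₁ := by
    rw [div_le_iff₀ (by positivity)]
    nlinarith
  have h3 := mul_le_mul_of_nonneg_left h2
    (by positivity : 0 ≤ (y₁ ^ 2 + c) / (2 * s₁ * y₁))
  have h4 : y - y₁ + (y₁ ^ 2 + c) / (2 * s₁ * y₁) * (s₁ * (y₁ ^ 2 - y ^ 2) / (y ^ 2 + c)) =
      -- The exact gap to the tangent; `c ≤ y₁ ^ 2` makes it nonnegative for every `y ≥ 0`.
      (y₁ - y) ^ 2 * (y₁ ^ 2 + 2 * y₁ * y - c) / (2 * y₁ * (y ^ 2 + c)) := by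
    have : y ^ 2 + c ≠ 0 := by positivity
    field_simp
    ring
  have h5 : 0 ≤ (y₁ - y) ^ 2 * (y₁ ^ 2 + 2 * y₁ * y - c) / (2 * y₁ * (y ^ 2 + c)) := by
    have : 0 ≤ y₁ * y := by positivity
    exact div_nonneg (mul_nonneg (sq_nonneg _) (by linarith)) (by positivity)
  linarith

/-- The bound is Bayesian, hence free of unbiasedness, and one threshold for `n` serves all
estimators. -/
theorem eventually_le_sqrt_mul_freqL1 {d : ℕ} {ε : ℝ} (hε : 0 < ε) (hd : Real.exp ε + 1 ≤ d)
    {κ : ℝ} (hκ : 0 < κ) :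
    ∀ᶠ n : ℕ in atTop, ∀ A : Estimator d n ε, limitL1 d ε - κ ≤ √n * A.freqL1 := by
  have he : 1 < Real.exp ε := Real.one_lt_exp_iff.2 hε
  have hd' : (0 : ℝ) < d := by linarith
  have hd0 : 0 < d := by exact_mod_cast hd'
  have hd1 : (0 : ℝ) < d - 1 := by linarith
  set T := (Real.exp ε - 1) ^ 2 / (4 * Real.exp ε) with hT
  set c : ℝ := ((d : ℝ) - 1) / d ^ 2 with hc
  have hc0 : 0 < c := by positivity
  -- The bound of `exists_prior` on the mean square error per user, when the information is spread
  -- equally over the values and the slack is `t`. At `t = 0` it is the optimal constant divided by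
  -- `d`.
  set Y : ℝ → ℝ := fun t => (c - t) ^ 2 / (T / d ^ 2 + t) - (c + t) with hY
  have hY0 : Y 0 = optConst d ε / d := by
    simp only [hY, hc, hT, optConst, sub_zero, add_zero]
    have : Real.exp ε - 1 ≠ 0 := by linarith
    generalize Real.exp ε = e at *
    field_simp
    ring
  have hYc : ContinuousAt Y 0 := by
    have : T / (d : ℝ) ^ 2 + 0 ≠ 0 := by positivity
    simp only [hY]
    fun_prop (disch := assumption)
  have hL0 : √(2 / Real.pi) * (d * √(Y 0)) = limitL1 d ε := by
    rw [limitL1, hY0]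
    congr 1
    have : (d : ℝ) * optConst d ε = d ^ 2 * (optConst d ε / d) := by field_simp
    rw [this, Real.sqrt_mul (by positivity), Real.sqrt_sq hd'.le]
  obtain ⟨t, ht0, htc, htY, htL⟩ : ∃ t : ℝ, 0 < t ∧ t < c ∧ c + t < Y t ∧
      limitL1 d ε - κ / 2 < √(2 / Real.pi) * (d * √(Y t)) := by
    have h1 : ∀ᶠ t in 𝓝 (0 : ℝ), t < c := gt_mem_nhds hc0
    have h2 : ∀ᶠ t in 𝓝 (0 : ℝ), 0 < Y t - (c + t) := by
      refine ContinuousAt.eventually_lt (f := fun _ => (0 : ℝ)) continuousAt_const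
        (hYc.sub (continuousAt_const.add continuousAt_id)) ?_
      have := lt_optConst_div hε hd
      rw [hY0]
      simp only [add_zero]
      linarith
    have h3 : ∀ᶠ t in 𝓝 (0 : ℝ), limitL1 d ε - κ / 2 < √(2 / Real.pi) * (d * √(Y t)) := by
      refine ContinuousAt.eventually_lt continuousAt_const
        (continuousAt_const.mul (continuousAt_const.mul hYc.sqrt)) ?_
      rw [hL0]
      linarith
    obtain ⟨t, ht, ht1⟩ := (((h1.and (h2.and h3)).filter_mono nhdsWithin_le_nhds).and
      (self_mem_nhdsWithin : ∀ᶠ t in 𝓝[>] (0 : ℝ), t ∈ Set.Ioi 0)).exists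
    exact ⟨t, ht1, ht.1, by linarith [ht.2.1], ht.2.2⟩
  obtain ⟨B, hB, π, hπ, hπ1, hmse⟩ := exists_prior hd0 hε.le ht0 htc
  have hB' : (0 : ℝ) < B := by exact_mod_cast hB
  set y₁ := √(Y t) with hy₁
  have hYt0 : 0 < Y t := by linarith
  have hy₁0 : 0 < y₁ := Real.sqrt_pos.2 hYt0
  have hy₁sq : y₁ ^ 2 = Y t := Real.sq_sqrt hYt0.le
  set L₁ := √(2 / Real.pi) * (d * y₁) with hL₁
  have hL₁0 : 0 ≤ L₁ := by positivity
  have hlim : Tendsto (fun n : ℕ => L₁ * √B * (1 / √n) +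
      d * (blockError n B (scale n ^ 3) / √n)) atTop (𝓝 0) := by
    have h1 : Tendsto (fun n : ℕ => 1 / √(n : ℝ)) atTop (𝓝 0) := by
      simp only [one_div]
      exact tendsto_inv_atTop_zero.comp
        (Real.tendsto_sqrt_atTop.comp tendsto_natCast_atTop_atTop)
    have := (h1.const_mul (L₁ * √B)).add ((tendsto_blockError B).const_mul (d : ℝ))
    simpa using this
  filter_upwards [eventually_gt_atTop 0, hlim.eventually (gt_mem_nhds (half_pos hκ))]
    with n hn hnκ A
  have hn' : (0 : ℝ) < n := by exact_mod_cast hn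
  have hs : 0 < √(n : ℝ) := Real.sqrt_pos.2 hn'
  obtain ⟨f, hf⟩ := A.exists_mse_le_freqL1 hd0 hn hπ hπ1
  have hδ := pow_pos (scale_pos hn) 3
  set mse : Fin d → ℝ := fun x => ∑ X, π X *
    prodExp (fun i o => A.mech.P o (X i)) (fun r => (count X x - f x r) ^ 2) with hm
  have hmse0 : ∀ x, 0 ≤ mse x := fun x => Finset.sum_nonneg fun X _ => mul_nonneg (hπ X)
    (prodExp_nonneg (fun _ _ => A.mech.nonneg _ _) fun _ => sq_nonneg _)
  set y : Fin d → ℝ := fun x => √(mse x / B) with hy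
  have hysq : ∀ x, y x ^ 2 = mse x / B := fun x => Real.sq_sqrt (div_nonneg (hmse0 x) hB'.le)
  set J := n / B with hJ
  have hsqrt : ∀ x, √((J : ℝ) * mse x) = √((J : ℝ) * B) * y x := fun x => by
    rw [hy, ← Real.sqrt_mul (by positivity)]
    congr 1
    field_simp
  -- The tangent at the equal-information point bounds each `y x` by a decreasing affine function of
  -- the information, so the bound on the total information suffices.
  have hsum : d * y₁ ≤ ∑ x, y x := by
    set s : Fin d → ℝ := fun x => A.mech.info x / d + t with hsdef
    set s₁ : ℝ := T / d ^ 2 + t with hs₁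
    have hs₁0 : 0 < s₁ := by positivity
    set l := (y₁ ^ 2 + (c + t)) / (2 * s₁ * y₁) with hl
    have hl0 : 0 ≤ l := by positivity
    have h1 : ∀ x, y₁ - l * (s x - s₁) ≤ y x := fun x => by
      refine tangent_le (a := (c - t) ^ 2) hs₁0 (Real.sqrt_nonneg _) hy₁0
        (by linarith) ?_ ?_ (by rw [hy₁sq]; exact htY.le)
      · rw [hysq]
        exact hmse A.m A.mech x (f x)
      · rw [hy₁sq]
        simp only [hY]
        rw [← hs₁]
        field_simp
        ring
    have h2 : ∑ x, s x ≤ d * s₁ := by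
      have := A.mech.sum_info_le hd0
      simp only [hsdef, Finset.sum_add_distrib, ← Finset.sum_div, Finset.sum_const,
        Finset.card_univ, Fintype.card_fin, nsmul_eq_mul]
      have h3 : (∑ x, A.mech.info x) / d ≤ T / d := by gcongr
      have h4 : d * s₁ = T / d + d * t := by
        rw [hs₁]
        field_simp
      linarith
    have h3 := Finset.sum_le_sum fun x (_ : x ∈ (univ : Finset (Fin d))) => h1 x
    rw [Finset.sum_sub_distrib, ← Finset.mul_sum, Finset.sum_sub_distrib] at h3
    simp only [Finset.sum_const, Finset.card_univ, Fintype.card_fin, nsmul_eq_mul] at h3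
    have h4 := mul_le_mul_of_nonneg_left (sub_nonpos.2 h2) hl0
    linarith
  have h1 := hf _ hδ
  have h2 : √((J : ℝ) * B) * L₁ - d * blockError n B (scale n ^ 3) ≤ n * A.freqL1 := by
    refine le_trans ?_ h1
    have h3 : ∑ x, (√(2 / Real.pi) * √((J : ℝ) * mse x) - blockError J B (scale n ^ 3)) =
        √((J : ℝ) * B) * (√(2 / Real.pi) * ∑ x, y x) - d * blockError J B (scale n ^ 3) := by
      simp only [hsqrt, Finset.sum_sub_distrib, Finset.sum_const, Finset.card_univ,
        Fintype.card_fin, nsmul_eq_mul, Finset.mul_sum]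
      congr 1
      exact Finset.sum_congr rfl fun x _ => by ring
    refine le_trans ?_ (le_of_eq h3.symm)
    have h4 : blockError J B (scale n ^ 3) ≤ blockError n B (scale n ^ 3) :=
      blockError_mono (Nat.div_le_self n B) hB'.le hδ
    have h5 : L₁ ≤ √(2 / Real.pi) * ∑ x, y x := by
      rw [hL₁]
      gcongr
    gcongr
  -- Fewer than `B` users lie outside the full blocks, so `n ≤ J * B + B`.
  have h3 : √(n : ℝ) - √B ≤ √((J : ℝ) * B) := by
    have h4 : (n : ℝ) ≤ J * B + B := by
      have : n ≤ J * B + B := by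
        have h5 := Nat.div_add_mod' n B
        have h6 := Nat.mod_lt n hB
        rw [hJ]
        omega
      exact_mod_cast this
    have h5 : √(n : ℝ) ≤ √((J : ℝ) * B) + √B := by
      refine Real.sqrt_le_iff.2 ⟨by positivity, ?_⟩
      have e1 : √((J : ℝ) * B) ^ 2 = J * B := Real.sq_sqrt (by positivity)
      have e2 : √(B : ℝ) ^ 2 = B := Real.sq_sqrt hB'.le
      have e3 : 0 ≤ √((J : ℝ) * B) * √B := by positivity
      nlinarith
    linarith
  have h4 : (√(n : ℝ) - √B) * L₁ - d * blockError n B (scale n ^ 3) ≤ n * A.freqL1 :=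
    le_trans (sub_le_sub_right (mul_le_mul_of_nonneg_right h3 hL₁0) _) h2
  have h5 : L₁ - (L₁ * √B * (1 / √n) + d * (blockError n B (scale n ^ 3) / √n)) ≤
      √n * A.freqL1 := by
    have e1 : (n : ℝ) = √n * √n := (Real.mul_self_sqrt hn'.le).symm
    have e2 : (√(n : ℝ) - √B) * L₁ - d * blockError n B (scale n ^ 3) =
        √n * (L₁ - (L₁ * √B * (1 / √n) + d * (blockError n B (scale n ^ 3) / √n))) := by
      field_simp
      ring
    rw [e2] at h4
    have e3 : n * A.freqL1 = √n * (√n * A.freqL1) := by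
      rw [← mul_assoc, ← e1]
    rw [e3] at h4
    exact le_of_mul_le_mul_left h4 hs
  linarith

end Asymptotics

end LDP

/-! ### Assembly of the theorem. -/

theorem theorem3p7 (d : ℕ) (ε : ℝ) (hε : 0 < ε) (hd : Real.exp ε + 1 ≤ (d : ℝ)) :
    -- lower bounds, whether or not `d / (e^ε + 1)` is an integer
    (∀ n : ℕ, 0 < n →
      LDP.optL2 d n ε ∈ lowerBounds (LDP.freqL2Losses d n ε) ∧
      LDP.optL2 d n ε + (1 - 1 / (d : ℝ)) / n ∈ lowerBounds (LDP.distL2Losses d n ε)) ∧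
    ∀ k : ℕ, (k : ℝ) = (d : ℝ) / (Real.exp ε + 1) →
      -- the minimal `L₂` losses, for every `n`
      (∀ n : ℕ, 0 < n →
        IsLeast (LDP.freqL2Losses d n ε) (LDP.optL2 d n ε) ∧
        IsLeast (LDP.distL2Losses d n ε) (LDP.optL2 d n ε + (1 - 1 / (d : ℝ)) / n) ∧
        -- they are attained by the optimal symmetric configurations of support size `k`
        (∃ A : LDP.Estimator d n ε, A.IsOSC k) ∧
        (∀ A : LDP.Estimator d n ε, A.IsOSC k →
          A.UnbiasedFreq ∧ A.freqL2 = LDP.optL2 d n ε ∧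
          A.UnbiasedDist ∧ A.distL2 = LDP.optL2 d n ε + (1 - 1 / (d : ℝ)) / n)) ∧
      -- the minimal `L₁` loss, to first order as `n → ∞`, and its attainment
      Asymptotics.IsEquivalent Filter.atTop
        (fun n : ℕ => sInf (LDP.freqL1Losses d n ε))
        (fun n : ℕ => Real.sqrt (2 * d / Real.pi * LDP.optL2 d n ε)) ∧
      (∀ A : (n : ℕ) → LDP.Estimator d n ε, (∀ n, 0 < n → (A n).IsOSC k) →
        Asymptotics.IsEquivalent Filter.atTop
          (fun n : ℕ => (A n).freqL1)
          (fun n : ℕ => Real.sqrt (2 * d / Real.pi * LDP.optL2 d n ε))) := by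
  have he : 1 < Real.exp ε := Real.one_lt_exp_iff.2 hε
  have hd1 : 1 < d := by
    have : (1 : ℝ) < d := by linarith
    exact_mod_cast this
  have hlower : ∀ n : ℕ, 0 < n →
      LDP.optL2 d n ε ∈ lowerBounds (LDP.freqL2Losses d n ε) ∧
      LDP.optL2 d n ε + (1 - 1 / (d : ℝ)) / n ∈ lowerBounds (LDP.distL2Losses d n ε) := by
    refine fun n hn => ⟨?_, ?_⟩
    · rintro _ ⟨A, hA, rfl⟩
      exact hA.le_freqL2 hε hd hn
    · rintro _ ⟨A, hA, rfl⟩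
      exact hA.le_distL2 hε hd hn
  refine ⟨hlower, fun k hk => ?_⟩
  have hkd : k ≤ d := by
    have h1 := LDP.eq_mul_of_eq_div hk
    have h2 := LDP.one_le_of_eq_div hd hk
    have : (k : ℝ) ≤ d := by nlinarith
    exact_mod_cast this
  have hosc : ∀ n : ℕ, 0 < n → ∀ A : LDP.Estimator d n ε, A.IsOSC k →
      A.UnbiasedFreq ∧ A.freqL2 = LDP.optL2 d n ε ∧
      A.UnbiasedDist ∧ A.distL2 = LDP.optL2 d n ε + (1 - 1 / (d : ℝ)) / n := fun n hn A hA =>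
    have hu := hA.unbiasedFreq hε hd hk hn
    ⟨hu, hA.freqL2_eq hε hd hk hn, hu.unbiasedDist hn, hA.distL2_eq hε hd hk hn⟩
  refine ⟨fun n hn => ?_, ?_, fun A hA => ?_⟩
  · obtain ⟨A, hA⟩ := LDP.exists_isOSC n hε hd1 hkd
    obtain ⟨h1, h2, h3, h4⟩ := hosc n hn A hA
    exact ⟨⟨⟨A, h1, h2⟩, (hlower n hn).1⟩, ⟨⟨A, h3, h4⟩, (hlower n hn).2⟩, ⟨A, hA⟩, hosc n hn⟩
  · refine LDP.isEquivalent_limitL1 hε hd (fun κ hκ => ?_) fun κ hκ => ?_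
    · filter_upwards [LDP.eventually_le_sqrt_mul_freqL1 hε hd hκ, Filter.eventually_gt_atTop 0]
        with n h hn
      have hs : 0 < √(n : ℝ) := Real.sqrt_pos.2 (by exact_mod_cast hn)
      obtain ⟨A, hA⟩ := LDP.exists_isOSC n hε hd1 hkd
      rw [← div_le_iff₀' hs]
      -- The configuration shows that the set of losses is nonempty, without which the infimum would
      -- be the default value `0`.
      refine le_csInf ⟨_, A, (hosc n hn A hA).1, rfl⟩ ?_
      rintro _ ⟨A', -, rfl⟩
      rw [div_le_iff₀' hs]
      exact h A'
    · filter_upwards [LDP.eventually_sqrt_mul_freqL1_le hε hd hk hκ,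
        LDP.eventually_le_sqrt_mul_freqL1 hε hd hκ, Filter.eventually_gt_atTop 0] with n h h' hn
      have hs : 0 < √(n : ℝ) := Real.sqrt_pos.2 (by exact_mod_cast hn)
      obtain ⟨A, hA⟩ := LDP.exists_isOSC n hε hd1 hkd
      -- The lower bound for all estimators reappears here to make the set of losses bounded below.
      refine le_trans (mul_le_mul_of_nonneg_left (csInf_le ⟨(LDP.limitL1 d ε - κ) / √n, ?_⟩
        ⟨A, (hosc n hn A hA).1, rfl⟩) hs.le) (h A hA)
      rintro _ ⟨A', -, rfl⟩
      rw [div_le_iff₀' hs]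
      exact h' A'
  · refine LDP.isEquivalent_limitL1 hε hd (fun κ hκ => ?_) fun κ hκ => ?_
    · filter_upwards [LDP.eventually_le_sqrt_mul_freqL1 hε hd hκ] with n h
      exact h (A n)
    · filter_upwards [LDP.eventually_sqrt_mul_freqL1_le hε hd hk hκ,
        Filter.eventually_gt_atTop 0] with n h hn
      exact h (A n) (hA n hn)
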